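/- **Setting.** Let $F(t^1,\dots,t^n)$ be a solution, smooth (or analytic) on an open set $U$, of the WDVV equations: with a constant symmetric nondegenerate matrix $(\eta^{\alpha\beta})$, $(\eta_{\alpha\beta})=(\eta^{\alpha\beta})^{-1}$, and constants $q_\alpha,r_\alpha,d,A_{\alpha\beta}=A_{\beta\alpha},B_\alpha,C$, $$F_{\alpha\beta\lambda}\eta^{\lambda\mu}F_{\mu\gamma\delta}=F_{\delta\beta\lambda}\eta^{\lambda\mu}F_{\mu\gamma\alpha},\qquad \partial_1\partial_\alpha\partial_\beta F=\eta_{\alpha\beta},$$ $$E^\varepsilon\partial_\varepsilon F=(3-d)F+\tfrac12A_{\alpha\beta}t^\alpha t^\beta+B_\alpha t^\alpha+C,\qquad E^\varepsilon=(1-q_\varepsilon)t^\varepsilon+r_\varepsilon\ (\text{no sum}),$$ with the normalization: $q_1=0$; $r_\alpha\ne0$ only if $q_\alpha=1$; $A_{\alpha\beta}\neq0$ only if $q_\alpha+q_\beta=d-1$; $B_\alpha\ne0$ only if $q_\alpha=d-2$; $C\neq0$ only if $d=3$; $A_{1\alpha}=\sum_\varepsilon\eta_{\alpha\varepsilon}r_\varepsilon$,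 $B_1=0$. Put $c_{\alpha\beta\gamma}=\partial_\alpha\partial_\beta\partial_\gamma F$, $c^{\alpha\beta}_{\gamma\mu}=\eta^{\alpha\alpha'}\eta^{\beta\beta'}\partial_{\alpha'}\partial_{\beta'}\partial_\gamma\partial_\mu F$, raise indices with $\eta$, and put $\mu_\alpha=q_\alpha-\frac d2$, $g^{\alpha\beta}=E^\varepsilon c^{\alpha\beta}_\varepsilon$, $\Gamma^{\alpha\beta}_\gamma=(\frac{1+d}2-q_\beta)c^{\alpha\beta}_\gamma$. Let $\theta_{\alpha,p}$, $p\ge0$, be functions on $U$ of the same class with $\theta_{\alpha,0}=\eta_{\alpha\varepsilon}t^\varepsilon$, $\partial_\alpha\partial_\beta\theta_{\gamma,p+1}=c^\rho_{\alpha\beta}\partial_\rho\theta_{\gamma,p}$, and put $\theta_{\alpha,-1}=0$. The genus zero hierarchy is $\partial v^\alpha/\partial T^{\beta,p}=K^{(0)\alpha}_{\beta,p}=\partial_X(\eta^{\alpha\gamma}\partial_\gamma\theta_{\beta,p+1}(v))$, $X=T^{1,0}$, with Hamiltonians $H_{\beta,p}=\int\theta_{\beta,p+1}(v)\,dX$ ($p\ge-1$)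 and brackets $$\{v^\alpha(X),v^\beta(Y)\}^{(0)}_1=\eta^{\alpha\beta}\delta'(X-Y),\qquad \{v^\alpha(X),v^\beta(Y)\}^{(0)}_2=g^{\alpha\beta}(v(X))\delta'(X-Y)+\Gamma^{\alpha\beta}_\gamma(v(X))v^\gamma_X\delta(X-Y).$$ Let $G$ be an arbitrary function on $U$ of the same class. Where $\det M\neq0$, $M_{\alpha\beta}=c_{\alpha\beta\gamma}(v)v^\gamma_X$, consider the infinitesimal Bäcklund transform, modulo $\varepsilon^4$, $$t_\alpha=v_\alpha+\varepsilon^2\frac{\partial^2}{\partial T^{\alpha,0}\partial T^{1,0}}\Big[\tfrac1{24}\log\det M(v,v_X)+G(v)\Big],$$ the time derivatives being computed along the genus zero hierarchy. Rewritten in terms of $t$ modulo $\varepsilon^4$, the flows, the Hamiltonians and the brackets become $K^{(0)}_{\beta,p}+\varepsilon^2K^{(1)}_{\beta,p}$, $H_{\beta,p}+\varepsilon^2\delta H_{\beta,p}$ and $\{\,,\}_i=\{\,,\}_i^{(0)}+\varepsilon^2\{\,,\}_i^{(1)}$. Functionals $\int f\,dX$ are densities modulo total $X$-derivatives of differential functions,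 and a bracket $\sum_sP_s\,\delta^{(s)}(X-Y)$ is the matrix differential operator $\sum_sP_s\partial_X^s$. A differential polynomial is a polynomial in $t_X,t_{XX},t_{XXX}$ with coefficients functions of $t$ on $U$ of the given class, and $\deg\partial_X^mt=m$. **Proposition.** Inserting $G$ preserves the structure of the hierarchy, of the Hamiltonians and of the brackets. Precisely: 1. $K^{(1)}_{\beta,p}$ for $G$ and for $G=0$ differ by a homogeneous differential polynomial of degree 3; in particular, one is such a differential polynomial iff the other is. 2. $\delta H_{\beta,p}$ for $G$ equals $\delta H_{\beta,p}$ for $G=0$ plus $$\delta H''_{\beta,p}=\int c^\gamma_{\xi\nu}\,c^{\sigma\xi}_\mu\,\frac{\partial\theta_{\beta,p}}{\partial t^\gamma}\frac{\partial G}{\partial t^\sigma}\,t^\mu_Xt^\nu_X\,dX ;$$ in particular, one has the form $\int\chi_{\mu\nu}(t)t_X^\mu t_X^\nu dX$, $\chi_{\mu\nu}=\chi_{\nu\mu}$, iff the other does. 3. $\{\,,\}_i^{(1)}$ for $G$ equals $\{\,,\}_i^{(1)}$ for $G=0$ plus $\{\,,\}''_i$, $i=1,2$, where $$\{t^\alpha(X),t^\beta(Y)\}''_1=\tilde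 a^{\alpha\beta}\delta'''(X-Y)+\tilde b^{\alpha\beta}\delta''(X-Y)+\tilde e^{\alpha\beta}\delta'(X-Y),$$ $$\{t^\alpha(X),t^\beta(Y)\}''_2=a^{\alpha\beta}\delta'''(X-Y)+b^{\alpha\beta}\delta''(X-Y)+e^{\alpha\beta}\delta'(X-Y)+\partial_X(q^{\alpha\beta})\,\delta(X-Y),$$ the coefficients being evaluated at $t(X)$ and given by $$\tilde a^{\alpha\beta}=2c^{\alpha\beta\mu}\partial_\mu G,\quad \tilde b^{\alpha\beta}=\tfrac32\partial_X\tilde a^{\alpha\beta}+\partial_\sigma\partial_\rho G\,(c^{\alpha\sigma}_\mu\eta^{\beta\rho}-c^{\beta\sigma}_\mu\eta^{\alpha\rho})t^\mu_X,\quad \tilde e^{\alpha\beta}=\partial_X\tilde b^{\alpha\beta}-\partial_X^2\tilde a^{\alpha\beta},$$ $$a^{\alpha\beta}=2c^{\alpha\mu}_\gamma g^{\gamma\beta}\partial_\mu G,$$ $$b^{\alpha\beta}=\tfrac32\partial_Xa^{\alpha\beta}+(c^{\alpha\rho}_\mu g^{\gamma\beta}-c^{\beta\rho}_\mu g^{\gamma\alpha})\,\partial_\gamma\partial_\rho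 G\,t^\mu_X+(\mu_\alpha-\mu_\beta)c^{\alpha\rho}_\gamma c^{\gamma\beta}_\mu\,\partial_\rho G\,t^\mu_X,$$ $$q^{\alpha\beta}=(\tfrac12-\mu_\beta)\big(\partial_\sigma\partial_\rho G\,c^{\alpha\sigma}_\mu c^{\beta\rho}_\nu-\partial_\sigma\partial_\nu G\,c^{\beta\sigma}_\rho c^{\rho\alpha}_\mu+\partial_\sigma G\,c^{\alpha\beta}_{\rho\mu}c^{\rho\sigma}_\nu\big)t^\mu_Xt^\nu_X,$$ $$e^{\alpha\beta}=q^{\alpha\beta}+q^{\beta\alpha}+\partial_Xb^{\alpha\beta}-\partial_X^2a^{\alpha\beta}.$$ The coefficient of $\delta^{(s)}$ in $\{\,,\}''_i$ is a homogeneous differential polynomial of degree $3-s$. In particular $\{\,,\}_i^{(1)}$ has the form $\sum_{s=0}^3P_s\delta^{(s)}(X-Y)$ with $P_s$ homogeneous differential polynomials of degree $3-s$ (and $P_0=0$ if $i=1$) for $G$ iff it has this form for $G=0$. 4. For all constants $a_1,a_2$ the operation $a_1\{\,,\}_1+a_2\{\,,\}_2$ is skew-symmetric and satisfies the Jacobi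 identity modulo $\varepsilon^4$. Modulo $\varepsilon^4$, the deformed flows are Hamiltonian with respect to $\{\,,\}_1$ with the Hamiltonians $H_{\beta,p}+\varepsilon^2\delta H_{\beta,p}$, and these Hamiltonians commute with respect to $\{\,,\}_1$. 5. Suppose matrices $R_k$, $k\ge1$, satisfy: $(R_k)^\varepsilon_\alpha\ne0$ only if $\mu_\varepsilon-\mu_\alpha=k$, and $E^\varepsilon\partial_\varepsilon\theta_{\alpha,p}=(p+\frac{2-d}2+\mu_\alpha)\theta_{\alpha,p}+\sum_{k=1}^p\theta_{\varepsilon,p-k}(R_k)^\varepsilon_\alpha+\mathrm{const}$. If $p+\mu_\beta+\frac12\neq0$, the deformed flow $(\beta,p)$ is, modulo $\varepsilon^4$, Hamiltonian also with respect to $\{\,,\}_2$, with Hamiltonian $$\sum_{k,l}(-1)^k(R_{p-l,k})^\varepsilon_\beta\,\frac{H_{\varepsilon,l-1}+\varepsilon^2\delta H_{\varepsilon,l-1}}{(p+\mu_\beta+\frac12)^{k+1}},\qquad R_{m,k}=\sum_{i_1+\dots+i_k=m,\ i_s\ge1}R_{i_1}\cdots R_{i_k},\quad R_{0,0}=1,\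 R_{m,0}=0\ (m>0).$$ -/

import Mathlib

open scoped ContDiff

noncomputable section

namespace OneLoop

/-! ### Jets, differential functions and formal calculus of variations -/

/-- The infinite jet of a field `t = (t¹, …, tⁿ)` at a point `X`: `j s α` is `∂_X^s t^α`. -/
abbrev Jet (𝕜 : Type*) (n : ℕ) : Type _ := ℕ → Fin n → 𝕜

section Calculus

variable {𝕜 : Type*} [RCLike 𝕜] {n : ℕ}

/-- The jet of order `N` underlying an infinite jet. -/
def truncate (N : ℕ) (j : Jet 𝕜 n) : Fin (N + 1) → Fin n → 𝕜 := fun s => j s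

/-- `f` is a differential function on the set `Ω` of jets: a smooth function of
`t, t_X, …, ∂_X^N t` for some `N`. (It is smooth over `𝕜`, hence holomorphic if `𝕜 = ℂ`.) -/
def IsDiffFun (Ω : Set (Jet 𝕜 n)) (f : Jet 𝕜 n → 𝕜) : Prop :=
  ∃ (N : ℕ) (g : (Fin (N + 1) → Fin n → 𝕜) → 𝕜),
    ContDiffOn 𝕜 ∞ g (truncate N '' Ω) ∧ ∀ j ∈ Ω, f j = g (truncate N j)

/-- `∂f/∂(∂_X^s t^γ)`. -/
def pd (s : ℕ) (γ : Fin n) (f : Jet 𝕜 n → 𝕜) (j : Jet 𝕜 n) : 𝕜 :=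
  lineDeriv 𝕜 f j (Pi.single s (Pi.single γ 1))

/-- The total derivative `∂_X f = ∑ t^γ_{s+1} ∂f/∂t^γ_s`, written as the directional derivative of
`f` in the direction of the shifted jet. -/
def DX (f : Jet 𝕜 n → 𝕜) (j : Jet 𝕜 n) : 𝕜 :=
  lineDeriv 𝕜 f j (fun s => j (s + 1))

/-- The derivative of a differential function `f` along the evolutionary vector field
`∂t^α/∂T = K^α`: it is `∑ (∂_X^s K^γ) ∂f/∂t^γ_s`. It is both the time derivative of `f` along the
flow `K`, and the coefficient of `δ` in `f[t + δ K]`. -/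
def pr (K : Fin n → Jet 𝕜 n → 𝕜) (f : Jet 𝕜 n → 𝕜) (j : Jet 𝕜 n) : 𝕜 :=
  lineDeriv 𝕜 f j (fun s γ => (DX^[s] (K γ)) j)

/-- The variational derivative `δ/δt^γ ∫ f dX = ∑_s (-∂_X)^s (∂f/∂t^γ_s)`. -/
def euler (f : Jet 𝕜 n → 𝕜) (γ : Fin n) (j : Jet 𝕜 n) : 𝕜 :=
  ∑ᶠ s : ℕ, (-1) ^ s * (DX^[s] (pd s γ f)) j

/-- The formal adjoint of the linearization `ψ ↦ ∑ (∂w^α/∂t^γ_s) ∂_X^s ψ^γ = pr ψ (w^α)` of `w`,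
namely `φ ↦ ∑_{α,s} (-∂_X)^s ((∂w^α/∂t^γ_s) φ_α)`. -/
def adjLin (w φ : Fin n → Jet 𝕜 n → 𝕜) (γ : Fin n) (j : Jet 𝕜 n) : 𝕜 :=
  ∑ α, ∑ᶠ s : ℕ, (-1) ^ s * (DX^[s] (fun i => pd s γ (w α) i * φ α i)) j

/-- `f` is a total `X`-derivative of a differential function, i.e. `∫ f dX = 0` as a local
functional. -/
def IsTotalDeriv (Ω : Set (Jet 𝕜 n)) (f : Jet 𝕜 n → 𝕜) : Prop :=
  ∃ ρ, IsDiffFun Ω ρ ∧ ∀ j ∈ Ω, f j = DX ρ j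

/-- Matrix differential operators. A bracket
`{t^α(X), t^β(Y)} = ∑_s P_s^{αβ}(t(X), t_X(X), …) δ^{(s)}(X - Y)` is identified with the operator
`(P ψ)^α = ∑_{s,β} P_s^{αβ} ∂_X^s ψ_β`, i.e. `(P ψ)^α(X) = ∫ {t^α(X), t^β(Y)} ψ_β(Y) dY`. -/
abbrev Op (𝕜 : Type*) (n : ℕ) : Type _ := (Fin n → Jet 𝕜 n → 𝕜) → Fin n → Jet 𝕜 n → 𝕜

/-- The coefficients `P s α β` of `δ^{(s)}(X - Y)`, `s = 0, 1, 2, 3`, of a bracket. -/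
abbrev Coeffs (𝕜 : Type*) (n : ℕ) : Type _ := Fin 4 → Fin n → Fin n → Jet 𝕜 n → 𝕜

/-- The operator with the given coefficients. -/
def Coeffs.op (P : Coeffs 𝕜 n) : Op 𝕜 n := fun ψ α j =>
  ∑ s : Fin 4, ∑ β, P s α β j * (DX^[(s : ℕ)] (ψ β)) j

/-- Two operators agree on all covectors of differential functions on `Ω`. -/
def OpEq (Ω : Set (Jet 𝕜 n)) (P Q : Op 𝕜 n) : Prop :=
  ∀ ψ : Fin n → Jet 𝕜 n → 𝕜, (∀ β, IsDiffFun Ω (ψ β)) → ∀ α, ∀ j ∈ Ω, P ψ α j = Q ψ α j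

/-- The derivative of the coefficients of the operator `P` along the evolutionary field `K`. -/
def prOp (K : Fin n → Jet 𝕜 n → 𝕜) (P : Op 𝕜 n) : Op 𝕜 n := fun χ α j =>
  pr K (P χ α) j - P (fun β => pr K (χ β)) α j

/-- Skew-symmetry of a bracket: `∫ φ P ψ dX = - ∫ ψ P φ dX`. -/
def IsSkew (Ω : Set (Jet 𝕜 n)) (P : Op 𝕜 n) : Prop :=
  ∀ φ ψ : Fin n → Jet 𝕜 n → 𝕜, (∀ β, IsDiffFun Ω (φ β)) → (∀ β, IsDiffFun Ω (ψ β)) →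
    IsTotalDeriv Ω fun j => ∑ α, (φ α j * P ψ α j + ψ α j * P φ α j)

/-- `φ (pr_{Qψ} P) χ`: the density of `{{t^α(X), t^β(Y)}_P, t^γ(Z)}_Q` smeared with
`φ_α(X) χ_β(Y) ψ_γ(Z)`. -/
def jacTerm (P Q : Op 𝕜 n) (φ ψ χ : Fin n → Jet 𝕜 n → 𝕜) (j : Jet 𝕜 n) : 𝕜 :=
  ∑ α, φ α j * prOp (Q ψ) P χ α j

/-- The Jacobi identity for `P₀ + ε² P₁` modulo `O(ε⁴)`, i.e. at the orders `1` and `ε²`. -/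
def IsJacobiMod (Ω : Set (Jet 𝕜 n)) (P₀ P₁ : Op 𝕜 n) : Prop :=
  ∀ φ ψ χ : Fin n → Jet 𝕜 n → 𝕜, (∀ β, IsDiffFun Ω (φ β)) → (∀ β, IsDiffFun Ω (ψ β)) →
    (∀ β, IsDiffFun Ω (χ β)) →
    IsTotalDeriv Ω (fun j => jacTerm P₀ P₀ φ ψ χ j + jacTerm P₀ P₀ ψ χ φ j
      + jacTerm P₀ P₀ χ φ ψ j) ∧
    IsTotalDeriv Ω (fun j =>
      (jacTerm P₁ P₀ φ ψ χ j + jacTerm P₁ P₀ ψ χ φ j + jacTerm P₁ P₀ χ φ ψ j)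
      + (jacTerm P₀ P₁ φ ψ χ j + jacTerm P₀ P₁ ψ χ φ j + jacTerm P₀ P₁ χ φ ψ j))

/-! ### The infinitesimal transform `t = v + ε² w(v, v_X, …)`, modulo `ε⁴`

`ε` is a formal parameter, so that `f[v + ε² w] = f[v] + ε² pr w f [v]` modulo `ε⁴`. -/

/-- If `∂v/∂T = K[v]` then `∂t/∂T = K[t] + ε² K₁[t]` modulo `ε⁴`, where `K₁` is determined by
`∂t/∂T = K[v] + ε² pr K w = (K + ε² K₁)[v + ε² w]`. -/
def flowTransform (w K : Fin n → Jet 𝕜 n → 𝕜) (α : Fin n) (j : Jet 𝕜 n) : 𝕜 :=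
  pr K (w α) j - pr w (K α) j

/-- The `ε²`-term of the density `h[v] = h[t - ε² w]` expressed through `t`. -/
def hamTransform (w : Fin n → Jet 𝕜 n → 𝕜) (h : Jet 𝕜 n → 𝕜) (j : Jet 𝕜 n) : 𝕜 :=
  - pr w h j

/-- If `{v^α(X), v^β(Y)}` has the operator `P[v]`, then by the Leibniz rule
`{t^α(X), t^β(Y)}` has the operator `(1 + ε² L) P[v] (1 + ε² L†)`, with `L` the linearization of
`w`; since `P[v] = P[t] - ε² (pr w P)[t]`, expressed through `t` this is `P + ε² P₁` modulo `ε⁴`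
with `P₁ = L P + P L† - pr w P`. -/
def bracketTransform (w : Fin n → Jet 𝕜 n → 𝕜) (P : Op 𝕜 n) : Op 𝕜 n := fun ψ α j =>
  pr (P ψ) (w α) j + P (adjLin w ψ) α j - prOp w P ψ α j

/-! ### Differential polynomials -/

/-- `f` is a homogeneous differential polynomial of degree `k ≤ 3` (`deg ∂_X^m t = m`), with
coefficients of class `C^r` on `U`. -/
def IsDiffPoly (r : WithTop ℕ∞) (U : Set (Fin n → 𝕜)) (Ω : Set (Jet 𝕜 n)) :
    ℕ → (Jet 𝕜 n → 𝕜) → Prop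
  | 0, f => ∃ a : (Fin n → 𝕜) → 𝕜, ContDiffOn 𝕜 r a U ∧ ∀ j ∈ Ω, f j = a (j 0)
  | 1, f => ∃ a : Fin n → (Fin n → 𝕜) → 𝕜, (∀ l, ContDiffOn 𝕜 r (a l) U) ∧
      ∀ j ∈ Ω, f j = ∑ l, a l (j 0) * j 1 l
  | 2, f => ∃ (a : Fin n → (Fin n → 𝕜) → 𝕜) (b : Fin n → Fin n → (Fin n → 𝕜) → 𝕜),
      (∀ l, ContDiffOn 𝕜 r (a l) U) ∧ (∀ l m, ContDiffOn 𝕜 r (b l m) U) ∧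
      ∀ j ∈ Ω, f j = ∑ l, a l (j 0) * j 2 l + ∑ l, ∑ m, b l m (j 0) * j 1 l * j 1 m
  | 3, f => ∃ (a : Fin n → (Fin n → 𝕜) → 𝕜) (b : Fin n → Fin n → (Fin n → 𝕜) → 𝕜)
      (c : Fin n → Fin n → Fin n → (Fin n → 𝕜) → 𝕜),
      (∀ l, ContDiffOn 𝕜 r (a l) U) ∧ (∀ l m, ContDiffOn 𝕜 r (b l m) U) ∧
      (∀ l m k, ContDiffOn 𝕜 r (c l m k) U) ∧
      ∀ j ∈ Ω, f j = ∑ l, a l (j 0) * j 3 l + ∑ l, ∑ m, b l m (j 0) * j 2 l * j 1 m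
        + ∑ l, ∑ m, ∑ k, c l m k (j 0) * j 1 l * j 1 m * j 1 k
  | _, _ => False

/-- The functional `∫ f dX` has the form `∫ χ_{μν}(t) t_X^μ t_X^ν dX` with `χ` symmetric of class
`C^r` on `U`. -/
def IsQuadraticFunctional (r : WithTop ℕ∞) (U : Set (Fin n → 𝕜)) (Ω : Set (Jet 𝕜 n))
    (f : Jet 𝕜 n → 𝕜) : Prop :=
  ∃ χ : Fin n → Fin n → (Fin n → 𝕜) → 𝕜, (∀ μ ν, ContDiffOn 𝕜 r (χ μ ν) U) ∧
    (∀ μ ν, χ μ ν = χ ν μ) ∧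
    IsTotalDeriv Ω fun j => f j - ∑ μ, ∑ ν, χ μ ν (j 0) * j 1 μ * j 1 ν

/-- The bracket is a combination of `δ, δ', δ'', δ'''`, the coefficient of `δ^{(s)}` being a
homogeneous differential polynomial of degree `3 - s`. -/
def IsPolyBracket (r : WithTop ℕ∞) (U : Set (Fin n → 𝕜)) (Ω : Set (Jet 𝕜 n)) (P : Op 𝕜 n) :
    Prop :=
  ∃ Q : Coeffs 𝕜 n, OpEq Ω P Q.op ∧
    ∀ (s : Fin 4) (α β : Fin n), IsDiffPoly r U Ω (3 - (s : ℕ)) (Q s α β)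

/-- As `IsPolyBracket`, without a term `δ(X - Y)`. -/
def IsPolyBracketNoDelta (r : WithTop ℕ∞) (U : Set (Fin n → 𝕜)) (Ω : Set (Jet 𝕜 n))
    (P : Op 𝕜 n) : Prop :=
  ∃ Q : Coeffs 𝕜 n, OpEq Ω P Q.op ∧ Q 0 = 0 ∧
    ∀ (s : Fin 4) (α β : Fin n), IsDiffPoly r U Ω (3 - (s : ℕ)) (Q s α β)

end Calculus

/-! ### Frobenius manifolds -/

/-- The partial derivative `∂f/∂t^α` of a function of `t¹, …, tⁿ`. -/
def partialD {𝕜 : Type*} [RCLike 𝕜] {n : ℕ} (α : Fin n) (f : (Fin n → 𝕜) → 𝕜)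
    (t : Fin n → 𝕜) : 𝕜 :=
  fderiv 𝕜 f t (Pi.single α 1)

/-- A quasihomogeneous solution of the WDVV equations of associativity on an open set `U`, of
class `C^r`: `F` is the free energy and `η` is the matrix `η^{αβ}` with upper indices. The
coordinate `t¹` of the unit is the one with index `0`. -/
structure FrobeniusManifold (𝕜 : Type*) [RCLike 𝕜] (n : ℕ) [NeZero n] (r : WithTop ℕ∞) where
  U : Set (Fin n → 𝕜)
  isOpen_U : IsOpen U
  F : (Fin n → 𝕜) → 𝕜
  contDiffOn_F : ContDiffOn 𝕜 r F U
  η : Matrix (Fin n) (Fin n) 𝕜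
  η_symm : η.IsSymm
  η_nondeg : IsUnit η.det
  q : Fin n → 𝕜
  rr : Fin n → 𝕜
  d : 𝕜
  A : Matrix (Fin n) (Fin n) 𝕜
  B : Fin n → 𝕜
  C : 𝕜
  assoc : ∀ t ∈ U, ∀ α β γ δ,
    ∑ l, ∑ m, partialD α (partialD β (partialD l F)) t * η l m
        * partialD m (partialD γ (partialD δ F)) t
      = ∑ l, ∑ m, partialD δ (partialD β (partialD l F)) t * η l m
        * partialD m (partialD γ (partialD α F)) t
  unit : ∀ t ∈ U, ∀ α β, partialD 0 (partialD α (partialD β F)) t = η⁻¹ α β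
  quasihom : ∀ t ∈ U,
    ∑ α, ((1 - q α) * t α + rr α) * partialD α F t
      = (3 - d) * F t + 1 / 2 * ∑ α, ∑ β, A α β * t α * t β + ∑ α, B α * t α + C
  q_zero : q 0 = 0
  rr_ne : ∀ α, rr α ≠ 0 → q α = 1
  A_symm : A.IsSymm
  A_ne : ∀ α β, A α β ≠ 0 → q α + q β = d - 1
  B_ne : ∀ α, B α ≠ 0 → q α = d - 2
  C_ne : C ≠ 0 → d = 3
  A_zero : ∀ α, A 0 α = ∑ ε, η⁻¹ α ε * rr ε
  B_zero : B 0 = 0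

namespace FrobeniusManifold

variable {𝕜 : Type*} [RCLike 𝕜] {n : ℕ} [NeZero n] {r : WithTop ℕ∞}
  (M : FrobeniusManifold 𝕜 n r)

/-- `c_{αβγ} = ∂_α ∂_β ∂_γ F`. -/
def c₀ (α β γ : Fin n) (t : Fin n → 𝕜) : 𝕜 := partialD α (partialD β (partialD γ M.F)) t

/-- `c^α_{βγ}`. -/
def c₁ (α β γ : Fin n) (t : Fin n → 𝕜) : 𝕜 := ∑ α', M.η α α' * M.c₀ α' β γ t

/-- `c^{αβ}_γ`. -/
def c₂ (α β γ : Fin n) (t : Fin n → 𝕜) : 𝕜 := ∑ α', ∑ β', M.η α α' * M.η β β' * M.c₀ α' β' γ t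

/-- `c^{αβγ}`. -/
def c₃ (α β γ : Fin n) (t : Fin n → 𝕜) : 𝕜 :=
  ∑ α', ∑ β', ∑ γ', M.η α α' * M.η β β' * M.η γ γ' * M.c₀ α' β' γ' t

/-- `c^{αβ}_{γμ} = η^{αα'} η^{ββ'} ∂_{α'} ∂_{β'} ∂_γ ∂_μ F`. -/
def c₂₂ (α β γ μ : Fin n) (t : Fin n → 𝕜) : 𝕜 :=
  ∑ α', ∑ β', M.η α α' * M.η β β' * partialD α' (partialD β' (partialD γ (partialD μ M.F))) t

/-- The components of the Euler vector field `E^ε = (1 - q_ε) t^ε + r_ε`. -/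
def E (ε : Fin n) (t : Fin n → 𝕜) : 𝕜 := (1 - M.q ε) * t ε + M.rr ε

/-- The intersection form `g^{αβ} = E^ε c^{αβ}_ε`. -/
def g (α β : Fin n) (t : Fin n → 𝕜) : 𝕜 := ∑ ε, M.E ε t * M.c₂ α β ε t

/-- `μ_α = q_α - d/2`. -/
def mu (α : Fin n) : 𝕜 := M.q α - M.d / 2

/-- `Γ^{αβ}_γ = ((1 + d)/2 - q_β) c^{αβ}_γ`. -/
def Γ (α β γ : Fin n) (t : Fin n → 𝕜) : 𝕜 := ((1 + M.d) / 2 - M.q β) * M.c₂ α β γ t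

/-- `{v^α(X), v^β(Y)}_1^{(0)} = η^{αβ} δ'(X - Y)`. -/
def bracket₁ : Op 𝕜 n := fun ψ α j => ∑ β, M.η α β * DX (ψ β) j

/-- `{v^α(X), v^β(Y)}_2^{(0)} = g^{αβ}(v(X)) δ'(X - Y) + Γ^{αβ}_γ(v(X)) v^γ_X δ(X - Y)`. -/
def bracket₂ : Op 𝕜 n := fun ψ α j =>
  ∑ β, (M.g α β (j 0) * DX (ψ β) j + (∑ γ, M.Γ α β γ (j 0) * j 1 γ) * ψ β j)

/-- The coefficients `θ α p` of deformed flat coordinates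
`θ_α(t, z) = ∑_p θ_{α,p}(t) z^p`: `θ_{α,0} = t_α` and
`∂_α ∂_β θ_{γ,p+1} = c^ρ_{αβ} ∂_ρ θ_{γ,p}`. -/
structure IsDeformedFlat (θ : Fin n → ℕ → (Fin n → 𝕜) → 𝕜) : Prop where
  contDiffOn : ∀ γ p, ContDiffOn 𝕜 r (θ γ p) M.U
  zero : ∀ γ, ∀ t ∈ M.U, θ γ 0 t = ∑ ε, M.η⁻¹ γ ε * t ε
  succ : ∀ γ p α β, ∀ t ∈ M.U,
    partialD α (partialD β (θ γ (p + 1))) t = ∑ ρ, M.c₁ ρ α β t * partialD ρ (θ γ p) t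

/-- The matrices `R_k` (`k ≥ 1`), with `(R_k)^ε_α ≠ 0` only if `μ_ε - μ_α = k`, enter the
quasihomogeneity of the `θ_{α,p}`:
`L_E θ_{α,p} = (p + (2-d)/2 + μ_α) θ_{α,p} + ∑_{k=1}^p θ_{ε,p-k} (R_k)^ε_α + const`. -/
structure IsMonodromy (θ : Fin n → ℕ → (Fin n → 𝕜) → 𝕜)
    (R : ℕ → Matrix (Fin n) (Fin n) 𝕜) : Prop where
  grading : ∀ k, 1 ≤ k → ∀ ε α, R k ε α ≠ 0 → M.mu ε - M.mu α = k
  scaling : ∀ α p, ∃ const : 𝕜, ∀ t ∈ M.U,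
    ∑ ε, M.E ε t * partialD ε (θ α p) t
      = (p + (2 - M.d) / 2 + M.mu α) * θ α p t
        + ∑ k ∈ Finset.Icc 1 p, ∑ ε, θ ε (p - k) t * R k ε α + const

variable (θ : Fin n → ℕ → (Fin n → 𝕜) → 𝕜)

/-- The genus zero hierarchy `∂v^α/∂T^{β,p} = ∂_X (η^{αγ} ∂_γ θ_{β,p+1}(v))`. -/
def K₀ (β : Fin n) (p : ℕ) (α : Fin n) : Jet 𝕜 n → 𝕜 :=
  DX fun j => ∑ γ, M.η α γ * partialD γ (θ β (p + 1)) (j 0)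

/-- `det M_{αβ}(t, t_X)`, `M_{αβ} = c_{αβγ}(t) t_X^γ`. -/
def detM (j : Jet 𝕜 n) : 𝕜 :=
  (Matrix.of fun α β => ∑ γ, M.c₀ α β γ (j 0) * j 1 γ).det

/-- The jets at which the genus one free energy is defined. -/
def Ω : Set (Jet 𝕜 n) := {j | j 0 ∈ M.U ∧ M.detM j ≠ 0}

/-- `w^α = η^{αβ} w_β` with
`w_β = ∂²/∂T^{β,0}∂T^{1,0} [ (1/24) log det M(v, v_X) + G(v) ]` computed along the genus zero
hierarchy, where `T^{1,0} = X`. The derivative of the logarithm is written as a logarithmic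
derivative, so that no branch has to be chosen. -/
def w (G : (Fin n → 𝕜) → 𝕜) (α : Fin n) (j : Jet 𝕜 n) : 𝕜 :=
  ∑ β, M.η α β * DX (fun i => 1 / 24 * (pr (M.K₀ θ β 0) M.detM i / M.detM i)
    + pr (M.K₀ θ β 0) (fun k => G (k 0)) i) j

/-- The `ε²`-correction `K^{(1)}_{β,p}` to the hierarchy. -/
def flowCorr (G : (Fin n → 𝕜) → 𝕜) (β : Fin n) (p : ℕ) : Fin n → Jet 𝕜 n → 𝕜 :=
  flowTransform (M.w θ G) (M.K₀ θ β p)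

/-- The density of the `ε²`-correction to `H_{β,m-1} = ∫ θ_{β,m}(v) dX`. -/
def hamCorr (G : (Fin n → 𝕜) → 𝕜) (β : Fin n) (m : ℕ) : Jet 𝕜 n → 𝕜 :=
  hamTransform (M.w θ G) fun j => θ β m (j 0)

/-- The `ε²`-correction to the first Poisson bracket. -/
def bracketCorr₁ (G : (Fin n → 𝕜) → 𝕜) : Op 𝕜 n := bracketTransform (M.w θ G) M.bracket₁

/-- The `ε²`-correction to the second Poisson bracket. -/
def bracketCorr₂ (G : (Fin n → 𝕜) → 𝕜) : Op 𝕜 n := bracketTransform (M.w θ G) M.bracket₂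

/-- The density of `δH''_{α,m-1}`:
`c^γ_{ξν} c^{σξ}_μ ∂_γ θ_{α,m-1} ∂_σ G t_X^μ t_X^ν`, with `θ_{α,-1} = 0`. -/
def δH'' (G : (Fin n → 𝕜) → 𝕜) (α : Fin n) : ℕ → Jet 𝕜 n → 𝕜
  | 0, _ => 0
  | p + 1, j => ∑ γ, ∑ ξ, ∑ ν, ∑ σ, ∑ μ, M.c₁ γ ξ ν (j 0) * M.c₂ σ ξ μ (j 0)
      * partialD γ (θ α p) (j 0) * partialD σ G (j 0) * j 1 μ * j 1 ν

variable (G : (Fin n → 𝕜) → 𝕜)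

/-- `ã^{αβ}`. -/
def a₁ (α β : Fin n) (j : Jet 𝕜 n) : 𝕜 := 2 * ∑ μ, M.c₃ α β μ (j 0) * partialD μ G (j 0)

/-- `b̃^{αβ}`. -/
def b₁ (α β : Fin n) (j : Jet 𝕜 n) : 𝕜 :=
  3 / 2 * DX (M.a₁ G α β) j
    + ∑ σ, ∑ ρ, ∑ μ, partialD σ (partialD ρ G) (j 0)
      * (M.c₂ α σ μ (j 0) * M.η β ρ - M.c₂ β σ μ (j 0) * M.η α ρ) * j 1 μ

/-- `ẽ^{αβ}`. -/
def e₁ (α β : Fin n) (j : Jet 𝕜 n) : 𝕜 := DX (M.b₁ G α β) j - DX (DX (M.a₁ G α β)) j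

/-- `a^{αβ}`. -/
def a₂ (α β : Fin n) (j : Jet 𝕜 n) : 𝕜 :=
  2 * ∑ μ, ∑ γ, M.c₂ α μ γ (j 0) * M.g γ β (j 0) * partialD μ G (j 0)

/-- `b^{αβ}`. -/
def b₂ (α β : Fin n) (j : Jet 𝕜 n) : 𝕜 :=
  3 / 2 * DX (M.a₂ G α β) j
    + ∑ ρ, ∑ γ, ∑ μ, (M.c₂ α ρ μ (j 0) * M.g γ β (j 0) - M.c₂ β ρ μ (j 0) * M.g γ α (j 0))
      * partialD γ (partialD ρ G) (j 0) * j 1 μ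
    + (M.mu α - M.mu β) * ∑ ρ, ∑ γ, ∑ μ, M.c₂ α ρ γ (j 0) * M.c₂ γ β μ (j 0)
      * partialD ρ G (j 0) * j 1 μ

/-- `q^{αβ}`. -/
def q₂ (α β : Fin n) (j : Jet 𝕜 n) : 𝕜 :=
  (1 / 2 - M.mu β) * ∑ σ, ∑ ρ, ∑ μ, ∑ ν,
    (partialD σ (partialD ρ G) (j 0) * M.c₂ α σ μ (j 0) * M.c₂ β ρ ν (j 0)
      - partialD σ (partialD ν G) (j 0) * M.c₂ β σ ρ (j 0) * M.c₂ ρ α μ (j 0)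
      + partialD σ G (j 0) * M.c₂₂ α β ρ μ (j 0) * M.c₂ ρ σ ν (j 0)) * j 1 μ * j 1 ν

/-- `e^{αβ}`. -/
def e₂ (α β : Fin n) (j : Jet 𝕜 n) : 𝕜 :=
  M.q₂ G α β j + M.q₂ G β α j + DX (M.b₂ G α β) j - DX (DX (M.a₂ G α β)) j

/-- `{t^α(X), t^β(Y)}''_1 = ã^{αβ} δ''' + b̃^{αβ} δ'' + ẽ^{αβ} δ'`. -/
def bracket₁'' : Coeffs 𝕜 n := ![0, M.e₁ G, M.b₁ G, M.a₁ G]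

/-- `{t^α(X), t^β(Y)}''_2 = a^{αβ} δ''' + b^{αβ} δ'' + e^{αβ} δ' + ∂_X(q^{αβ}) δ`. -/
def bracket₂'' : Coeffs 𝕜 n := ![fun α β => DX (M.q₂ G α β), M.e₂ G, M.b₂ G, M.a₂ G]

end FrobeniusManifold

/-- `R_{k,l} = ∑_{i_1 + ⋯ + i_l = k, i_s ≥ 1} R_{i_1} ⋯ R_{i_l}`, as `matR R l k`. -/
def matR {𝕜 : Type*} [RCLike 𝕜] {n : ℕ} (R : ℕ → Matrix (Fin n) (Fin n) 𝕜) :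
    ℕ → ℕ → Matrix (Fin n) (Fin n) 𝕜
  | 0, k => if k = 0 then 1 else 0
  | l + 1, k => ∑ i ∈ Finset.Icc 1 k, R i * matR R l (k - i)

/-- From densities `h ε l` of functionals `H_{ε,l-1}`, the density of
`∑_{k,l} (-1)^k (R_{p-l,k})^ε_β H_{ε,l-1} / (p + μ_β + 1/2)^{k+1}`, for the given value
`s = p + μ_β + 1/2`. -/
def hatDensity {𝕜 : Type*} [RCLike 𝕜] {n : ℕ} (R : ℕ → Matrix (Fin n) (Fin n) 𝕜) (s : 𝕜)
    (β : Fin n) (p : ℕ) (h : Fin n → ℕ → Jet 𝕜 n → 𝕜) (j : Jet 𝕜 n) : 𝕜 :=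
  ∑ l ∈ Finset.range (p + 1), ∑ k ∈ Finset.range (p - l + 1), ∑ ε,
    (-1) ^ k * matR R k (p - l) ε β * h ε l j / s ^ (k + 1)

end OneLoop

end

open OneLoop

/-! ### Formal calculus of variations in an abstract algebra of differential functions -/

noncomputable section

namespace OneLoop

/-! Modulo `ε⁴` the substitution `t = v + ε² w` changes every object by minus its Lie derivative
along the evolutionary field `w`: the flow `K` by `prV K w - prV w K`, the density `h` by `-pr w h`,
the bracket `P` by `deform w P`. All three are additive in `w`. The logarithmic part of `w` does not
involve `G`, and since the flows `T^{β,0}` act by multiplication by `t_X`, the part that does is `u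
= ∂_X h` with `h^α = c^{ασ}_μ t^μ_X ∂_σ G` (`exists_rep_w`). The logarithmic part is never computed.
Items 1–3 compare `G` with `0`, so they only ask for the Lie derivatives along `u`.

For the flows this is a count of degrees: `K` has degree 1 and `u` has degree 2, both polynomial in
the jets. For the Hamiltonians it is one integration by parts together with the recursion for `θ`.

For the brackets, both are instances of one construction `bracket W n`, with operator `g ∂_X + C N`.
Here `g` is multiplication by a vector field `W`, `C` is multiplication by `t_X`, and `N` is a
constant diagonal matrix satisfying `∂_γ g^{αβ} = (n_α + n_β) c^{αβ}_γ` (`Compat`). The unit field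
with `n = 0` gives the first bracket, the Euler field with `n_α = 1/2 - μ_α` the second. The Lie
derivative is then normally ordered once and for all in a noncommutative ring of operators
(`deformation_operator_identity`, `deform_bracket`); the inputs are associativity, `Compat` and the
constancy of `N`.

Item 4 is naturality. The operator `bracket W n` is linear in the pair `(W, n)`, so every member of
the pencil is again of this kind. Its Jacobi identity holds because the smeared Jacobi expression
reduces to a totally symmetric trilinear form (`bracket_jacobi`). A Lie derivative of a Poisson
structure satisfies the linearized Jacobi identity, the second derivatives of `w` cancelling in the
cyclic sum (`cycJac_deform`). Variational derivatives commute with Lie derivatives (`euler_pr`), so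
Hamiltonian flows and vanishing brackets of Hamiltonians persist.

For item 5, quasihomogeneity gives `P₂ dθ_{β,p} = (p + μ_β + 1/2) K_{β,p} + ∑ K_{ε,p-k} (R_k)^ε_β`,
where `P₂` is the second bracket. The grading of the `R_k` makes this a scalar plus a nilpotent,
inverted by a finite geometric series (`Kp_eq_P₂`); naturality does the rest.

All of this takes place in an abstract `JetAlgebra`, where local functionals are classes modulo the
image of `D`. An identity tested under the integral against all tuples holds pointwise
(`eq_of_int_dotProduct`). The relation `Rep` carries the results back to functions on the open set
of jets. -/

/-- A commutative algebra of differential functions: jet coordinates `x s γ` and commuting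
derivations `∂ s γ` dual to them, only finitely many of which act nontrivially on each element. -/
structure JetAlgebra (𝕜 ι 𝒜 : Type*) [Field 𝕜] [DecidableEq ι] [CommRing 𝒜] [Algebra 𝕜 𝒜] where
  x : ℕ → ι → 𝒜
  pd : ℕ → ι → Derivation 𝕜 𝒜 𝒜
  pd_comm : ∀ s γ t δ f, pd s γ (pd t δ f) = pd t δ (pd s γ f)
  pd_x : ∀ s γ t δ, pd s γ (x t δ) = if t = s ∧ δ = γ then 1 else 0
  exists_bound : ∀ f, ∃ N, ∀ s, N ≤ s → ∀ γ, pd s γ f = 0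

namespace JetAlgebra

variable {𝕜 ι 𝒜 : Type*} [Field 𝕜] [DecidableEq ι] [CommRing 𝒜] [Algebra 𝕜 𝒜]
  (J : JetAlgebra 𝕜 ι 𝒜)

/-- `N` bounds the order of `f`. -/
def Bounds (N : ℕ) (f : 𝒜) : Prop := ∀ s, N ≤ s → ∀ γ, J.pd s γ f = 0

variable {J} in
theorem Bounds.mono {N N' : ℕ} {f : 𝒜} (h : J.Bounds N f) (hN : N ≤ N') : J.Bounds N' f :=
  fun s hs => h s (hN.trans hs)

/-- A bound for the order of `f`. -/
def ord (f : 𝒜) : ℕ := (J.exists_bound f).choose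

theorem bounds_ord (f : 𝒜) : J.Bounds (J.ord f) f := (J.exists_bound f).choose_spec

variable {J} in
theorem Bounds.pd {N : ℕ} {f : 𝒜} (h : J.Bounds N f) (t : ℕ) (δ : ι) :
    J.Bounds N (J.pd t δ f) := fun s hs γ => by rw [J.pd_comm, h s hs, map_zero]

theorem exists_bounds₂ (f g : 𝒜) : ∃ N, J.Bounds N f ∧ J.Bounds N g :=
  ⟨max (J.ord f) (J.ord g), (J.bounds_ord f).mono (le_max_left _ _),
    (J.bounds_ord g).mono (le_max_right _ _)⟩

variable [Fintype ι]

/-- Terms past either bound are zero. Hence the bound picked by choice in `ord` is immaterial, and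
elements with different bounds can be treated with a common one. -/
theorem sum_range_of_bounds {X : Type*} [AddCommMonoid X] {N N' : ℕ} {f : 𝒜}
    (h : J.Bounds N f) (h' : J.Bounds N' f) (G : ℕ → ι → 𝒜 → X) (hG : ∀ s γ, G s γ 0 = 0) :
    ∑ s ∈ Finset.range N, ∑ γ, G s γ (J.pd s γ f)
      = ∑ s ∈ Finset.range N', ∑ γ, G s γ (J.pd s γ f) := by
  wlog hN : N ≤ N' generalizing N N'
  · exact (this h' h (le_of_not_ge hN)).symm
  · refine Finset.sum_subset (Finset.range_subset_range.2 hN) fun s _ hs => ?_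
    refine Finset.sum_eq_zero fun γ _ => ?_
    rw [h s (by simpa using hs), hG]

/-- The vector field `∑ a_{s,γ} ∂/∂x_{s,γ}`, as a function. -/
def vfFun (a : ℕ → ι → 𝒜) (f : 𝒜) : 𝒜 := ∑ s ∈ Finset.range (J.ord f), ∑ γ, a s γ * J.pd s γ f

theorem vfFun_eq (a : ℕ → ι → 𝒜) {f : 𝒜} {N : ℕ} (h : J.Bounds N f) :
    J.vfFun a f = ∑ s ∈ Finset.range N, ∑ γ, a s γ * J.pd s γ f :=
  J.sum_range_of_bounds (J.bounds_ord f) h (fun s γ y => a s γ * y) (by simp)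

/-- The vector field `∑ a_{s,γ} ∂/∂x_{s,γ}`. -/
def vf (a : ℕ → ι → 𝒜) : Derivation 𝕜 𝒜 𝒜 :=
  Derivation.mk'
    { toFun := J.vfFun a
      map_add' := fun f g => by
        obtain ⟨N, hf, hg⟩ := J.exists_bounds₂ f g
        have hfg : J.Bounds N (f + g) := fun s hs γ => by rw [map_add, hf s hs, hg s hs, add_zero]
        simp only [J.vfFun_eq a hf, J.vfFun_eq a hg, J.vfFun_eq a hfg, map_add, mul_add,
          Finset.sum_add_distrib]
      map_smul' := fun c f => by
        have hf := J.bounds_ord f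
        have hcf : J.Bounds (J.ord f) (c • f) := fun s hs γ => by
          rw [Derivation.map_smul, hf s hs, smul_zero]
        simp only [J.vfFun_eq a hf, J.vfFun_eq a hcf, Derivation.map_smul, mul_smul_comm, Finset.smul_sum,
          RingHom.id_apply] }
    fun f g => by
      obtain ⟨N, hf, hg⟩ := J.exists_bounds₂ f g
      have hfg : J.Bounds N (f * g) := fun s hs γ => by
        rw [Derivation.leibniz, hf s hs, hg s hs, smul_zero, smul_zero, add_zero]
      change J.vfFun a (f * g) = f • J.vfFun a g + g • J.vfFun a f
      simp only [J.vfFun_eq a hf, J.vfFun_eq a hg, J.vfFun_eq a hfg, Derivation.leibniz,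
        smul_eq_mul, Finset.mul_sum, ← Finset.sum_add_distrib]
      exact Finset.sum_congr rfl fun s _ => Finset.sum_congr rfl fun γ _ => by ring

theorem vf_eq (a : ℕ → ι → 𝒜) {f : 𝒜} {N : ℕ} (h : J.Bounds N f) :
    J.vf a f = ∑ s ∈ Finset.range N, ∑ γ, a s γ * J.pd s γ f := J.vfFun_eq a h

theorem vf_x (a : ℕ → ι → 𝒜) (s : ℕ) (γ : ι) : J.vf a (J.x s γ) = a s γ := by
  have h : J.Bounds (s + 1) (J.x s γ) := fun t ht δ => by
    rw [J.pd_x, if_neg]; rintro ⟨rfl, -⟩; omega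
  rw [J.vf_eq a h, Finset.sum_eq_single s, Finset.sum_eq_single γ]
  · simp [J.pd_x]
  · intro δ _ hδ
    simp [J.pd_x, hδ.symm]
  · simp
  · intro t _ ht
    simp [J.pd_x, ht.symm]
  · simp

theorem vf_add (a b : ℕ → ι → 𝒜) (f : 𝒜) : J.vf (a + b) f = J.vf a f + J.vf b f := by
  simp only [J.vf_eq _ (J.bounds_ord f), Pi.add_apply, add_mul, Finset.sum_add_distrib]

theorem vf_sub (a b : ℕ → ι → 𝒜) (f : 𝒜) : J.vf (a - b) f = J.vf a f - J.vf b f := by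
  simp only [J.vf_eq _ (J.bounds_ord f), Pi.sub_apply, sub_mul, Finset.sum_sub_distrib]

theorem vf_smul (c : 𝕜) (a : ℕ → ι → 𝒜) (f : 𝒜) : J.vf (c • a) f = c • J.vf a f := by
  simp only [J.vf_eq _ (J.bounds_ord f), Pi.smul_apply, smul_mul_assoc, Finset.smul_sum]

/-- The second-order terms are symmetric in the two fields because the partial derivatives commute,
so only the derivatives of the coefficients survive. -/
theorem vf_commutator (a b : ℕ → ι → 𝒜) (f : 𝒜) :
    J.vf b (J.vf a f) - J.vf a (J.vf b f)
      = J.vf (fun s γ => J.vf b (a s γ) - J.vf a (b s γ)) f := by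
  have h := J.bounds_ord f
  have key : ∀ a b : ℕ → ι → 𝒜, J.vf b (J.vf a f)
      = J.vf (fun s γ => J.vf b (a s γ)) f + ∑ s ∈ Finset.range (J.ord f), ∑ γ,
        ∑ t ∈ Finset.range (J.ord f), ∑ δ, a s γ * b t δ * J.pd s γ (J.pd t δ f) := fun a b => by
    conv_lhs => rw [J.vf_eq a h]
    simp only [map_sum, Derivation.leibniz, J.vf_eq _ h, ← Finset.sum_add_distrib, smul_eq_mul]
    refine Finset.sum_congr rfl fun s _ => Finset.sum_congr rfl fun γ _ => ?_
    rw [J.vf_eq b (h.pd s γ), add_comm, mul_comm (J.vf b _)]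
    simp only [Finset.mul_sum]
    rw [mul_comm]
    refine congrArg _ (Finset.sum_congr rfl fun t _ => Finset.sum_congr rfl fun δ _ => ?_)
    rw [J.pd_comm t δ s γ, mul_assoc]
  rw [key a b, key b a]
  have hsymm : ∑ s ∈ Finset.range (J.ord f), ∑ γ, ∑ t ∈ Finset.range (J.ord f), ∑ δ,
        b s γ * a t δ * J.pd s γ (J.pd t δ f)
      = ∑ s ∈ Finset.range (J.ord f), ∑ γ, ∑ t ∈ Finset.range (J.ord f), ∑ δ,
        a s γ * b t δ * J.pd s γ (J.pd t δ f) := by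
    have hc : ∀ s γ t δ, b s γ * a t δ * J.pd s γ (J.pd t δ f)
        = a t δ * b s γ * J.pd t δ (J.pd s γ f) := fun s γ t δ => by
      rw [J.pd_comm, mul_comm (b s γ)]
    simp only [hc]
    exact (Finset.sum_congr rfl fun s _ => Finset.sum_comm).trans <| Finset.sum_comm.trans <|
      Finset.sum_congr rfl fun t _ => (Finset.sum_congr rfl fun s _ => Finset.sum_comm).trans
        Finset.sum_comm
  rw [hsymm, add_sub_add_right_eq_sub]
  exact (J.vf_sub _ _ f).symm

/-- The total derivative `∂_X`. -/
def D : Derivation 𝕜 𝒜 𝒜 := J.vf fun s γ => J.x (s + 1) γ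

theorem D_x (s : ℕ) (γ : ι) : J.D (J.x s γ) = J.x (s + 1) γ := J.vf_x _ s γ

/-- The prolongation of the evolutionary vector field `K`. -/
def pr (K : ι → 𝒜) : Derivation 𝕜 𝒜 𝒜 := J.vf fun s γ => J.D^[s] (K γ)

theorem iterate_D_add (s : ℕ) (f g : 𝒜) : J.D^[s] (f + g) = J.D^[s] f + J.D^[s] g := by
  induction s generalizing f g with
  | zero => rfl
  | succ s ih => simp only [Function.iterate_succ, Function.comp, map_add, ih]

theorem iterate_D_sub (s : ℕ) (f g : 𝒜) : J.D^[s] (f - g) = J.D^[s] f - J.D^[s] g := by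
  induction s generalizing f g with
  | zero => rfl
  | succ s ih => simp only [Function.iterate_succ, Function.comp, map_sub, ih]

theorem iterate_D_smul (s : ℕ) (c : 𝕜) (f : 𝒜) : J.D^[s] (c • f) = c • J.D^[s] f := by
  induction s generalizing f with
  | zero => rfl
  | succ s ih => simp only [Function.iterate_succ, Function.comp, Derivation.map_smul, ih]

theorem iterate_D_zero (s : ℕ) : J.D^[s] (0 : 𝒜) = 0 := by
  induction s with
  | zero => rfl
  | succ s ih => simp only [Function.iterate_succ, Function.comp, map_zero, ih]

/-- The prolongation has the coefficients `D^[s] K` precisely so that all coefficients of its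
commutator with `D` vanish. -/
theorem pr_D (K : ι → 𝒜) (f : 𝒜) : J.pr K (J.D f) = J.D (J.pr K f) := by
  have h := J.vf_commutator (fun s γ => J.x (s + 1) γ) (fun s γ => J.D^[s] (K γ)) f
  have h0 : (fun s γ => J.vf (fun s γ => J.D^[s] (K γ)) (J.x (s + 1) γ)
      - J.vf (fun s γ => J.x (s + 1) γ) (J.D^[s] (K γ))) = 0 := by
    funext s γ
    rw [J.vf_x, Function.iterate_succ_apply']
    exact sub_self _
  rw [h0] at h
  have hz : J.vf 0 f = 0 := by simp [J.vf_eq _ (J.bounds_ord f)]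
  exact sub_eq_zero.1 (h.trans hz)

theorem pr_iterate_D (K : ι → 𝒜) (s : ℕ) (f : 𝒜) : J.pr K (J.D^[s] f) = J.D^[s] (J.pr K f) := by
  induction s generalizing f with
  | zero => rfl
  | succ s ih => rw [Function.iterate_succ_apply, ih, J.pr_D, Function.iterate_succ_apply]

theorem pr_commutator (K L : ι → 𝒜) (f : 𝒜) :
    J.pr K (J.pr L f) - J.pr L (J.pr K f) = J.pr (fun γ => J.pr K (L γ) - J.pr L (K γ)) f := by
  refine (J.vf_commutator _ _ f).trans ?_
  unfold pr
  congr 2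
  funext s γ
  rw [J.iterate_D_sub]
  exact congrArg₂ _ (J.pr_iterate_D K s _) (J.pr_iterate_D L s _)

theorem pr_add (K L : ι → 𝒜) (f : 𝒜) : J.pr (K + L) f = J.pr K f + J.pr L f := by
  rw [pr, pr, pr, ← J.vf_add]
  congr 2
  funext s γ
  exact J.iterate_D_add s _ _

theorem pr_sub (K L : ι → 𝒜) (f : 𝒜) : J.pr (K - L) f = J.pr K f - J.pr L f := by
  rw [pr, pr, pr, ← J.vf_sub]
  congr 2
  funext s γ
  exact J.iterate_D_sub s _ _

theorem pr_smul (c : 𝕜) (K : ι → 𝒜) (f : 𝒜) : J.pr (c • K) f = c • J.pr K f := by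
  rw [pr, pr, ← J.vf_smul]
  congr 2
  funext s γ
  exact J.iterate_D_smul s _ _

/-- The only coefficient of `D` involving `x (t + 1) δ` is the one in front of `∂/∂x_{t,δ}`. This
relation is what detects the order of a primitive. -/
theorem pd_D_succ (t : ℕ) (δ : ι) (f : 𝒜) :
    J.pd (t + 1) δ (J.D f) = J.D (J.pd (t + 1) δ f) + J.pd t δ f := by
  have hN : J.Bounds (J.ord f + t + 1) f := (J.bounds_ord f).mono (by omega)
  rw [D, J.vf_eq _ hN, J.vf_eq _ (hN.pd (t + 1) δ)]
  simp only [map_sum, Derivation.leibniz, J.pd_x, smul_eq_mul, J.pd_comm (t + 1) δ,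
    Finset.sum_add_distrib]
  congr 1
  rw [Finset.sum_eq_single t, Finset.sum_eq_single δ]
  · simp
  · intro γ _ hγ; simp [hγ]
  · simp
  · intro s _ hs; simp [hs]
  · intro h; exact absurd (Finset.mem_range.2 (by omega)) h

/-! ### Local functionals -/

/-- The space of local functionals. -/
abbrev Functional : Type _ := 𝒜 ⧸ LinearMap.range (J.D : 𝒜 →ₗ[𝕜] 𝒜)

/-- The local functional `∫ f dX`. -/
def int : 𝒜 →ₗ[𝕜] J.Functional := Submodule.mkQ _

theorem int_eq_zero {f : 𝒜} : J.int f = 0 ↔ ∃ ρ, f = J.D ρ := by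
  rw [int, Submodule.mkQ_apply, Submodule.Quotient.mk_eq_zero, LinearMap.mem_range]
  exact exists_congr fun ρ => eq_comm

theorem int_D (f : 𝒜) : J.int (J.D f) = 0 := J.int_eq_zero.2 ⟨f, rfl⟩

theorem int_mul_D (f g : 𝒜) : J.int (f * J.D g) = - J.int (J.D f * g) := by
  rw [eq_neg_iff_add_eq_zero, ← map_add, J.int_eq_zero]
  exact ⟨f * g, by rw [Derivation.leibniz]; simp only [smul_eq_mul]; ring⟩

theorem int_mul_iterate_D (s : ℕ) (f g : 𝒜) :
    J.int (f * ((-1) ^ s * J.D^[s] g)) = J.int (J.D^[s] f * g) := by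
  induction s generalizing f g with
  | zero => simp
  | succ s ih =>
    have : f * ((-1) ^ (s + 1) * J.D^[s + 1] g) = -(f * ((-1) ^ s * J.D^[s] (J.D g))) := by
      rw [Function.iterate_succ_apply]; ring
    rw [this, map_neg, ih, J.int_mul_D, neg_neg, Function.iterate_succ_apply']

/-- The derivative of local functionals along an evolutionary vector field. -/
def prInt (K : ι → 𝒜) : J.Functional →ₗ[𝕜] J.Functional :=
  Submodule.mapQ _ _ (J.pr K : 𝒜 →ₗ[𝕜] 𝒜) (by
    rintro _ ⟨ρ, rfl⟩
    exact ⟨J.pr K ρ, (J.pr_D K ρ).symm⟩)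

theorem prInt_int (K : ι → 𝒜) (f : 𝒜) : J.prInt K (J.int f) = J.int (J.pr K f) := rfl

/-- The variational derivative. -/
def euler (f : 𝒜) (γ : ι) : 𝒜 := ∑ s ∈ Finset.range (J.ord f), (-1) ^ s * J.D^[s] (J.pd s γ f)

theorem euler_eq {f : 𝒜} {N : ℕ} (h : J.Bounds N f) (γ : ι) :
    J.euler f γ = ∑ s ∈ Finset.range N, (-1) ^ s * J.D^[s] (J.pd s γ f) := by
  have := J.sum_range_of_bounds (J.bounds_ord f) h
    (fun s δ y => if δ = γ then (-1) ^ s * J.D^[s] y else 0) (by simp [J.iterate_D_zero])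
  simpa [euler] using this

/-- Each `D^[s]` is moved off `ψ` by parts. Together with `eq_of_int_dotProduct` this characterizes
the variational derivative, so its defining sum is rarely needed again. -/
theorem int_euler (ψ : ι → 𝒜) (f : 𝒜) : J.int (ψ ⬝ᵥ J.euler f) = J.int (J.pr ψ f) := by
  rw [pr, J.vf_eq _ (J.bounds_ord f)]
  simp only [dotProduct, euler, Finset.mul_sum, map_sum, J.int_mul_iterate_D]
  exact Finset.sum_comm

/-- The formal adjoint of the linearization of `w`. -/
def adjLin (w φ : ι → 𝒜) (γ : ι) : 𝒜 :=
  ∑ α, ∑ s ∈ Finset.range (J.ord (w α)), (-1) ^ s * J.D^[s] (J.pd s γ (w α) * φ α)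

theorem int_adjLin (w φ ψ : ι → 𝒜) :
    J.int (ψ ⬝ᵥ J.adjLin w φ) = J.int (φ ⬝ᵥ fun α => J.pr ψ (w α)) := by
  simp only [pr, J.vf_eq _ (J.bounds_ord (w _))]
  simp only [dotProduct, adjLin, Finset.mul_sum, map_sum, J.int_mul_iterate_D]
  rw [Finset.sum_comm]
  refine Finset.sum_congr rfl fun α _ => ?_
  rw [Finset.sum_comm]
  refine Finset.sum_congr rfl fun s _ => Finset.sum_congr rfl fun γ _ => ?_
  congr 1; ring

/-- A differential function whose product with every differential function is a total derivative
vanishes. -/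
theorem eq_zero_of_int_mul [CharZero 𝕜] [Nonempty ι] {F : 𝒜} (h : ∀ ψ, J.int (ψ * F) = 0) :
    F = 0 := by
  obtain ⟨δ⟩ := ‹Nonempty ι›
  set m := J.ord F with hm
  -- The test function is the square of a coordinate of order beyond that of `F`. A primitive `ρ` of
  -- the product has order at most `m`, so `D ρ` is linear in the coordinates of order `m + 1`,
  -- whereas the product has second derivative `2 F` there.
  obtain ⟨ρ, hρ⟩ := J.int_eq_zero.1 (h (J.x (m + 1) δ * J.x (m + 1) δ))
  have hF : ∀ s, m ≤ s → ∀ γ, J.pd s γ F = 0 := J.bounds_ord F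
  have hxF : J.Bounds (m + 2) (J.x (m + 1) δ * J.x (m + 1) δ * F) := fun s hs γ => by
    have : ¬ (m + 1 = s ∧ δ = γ) := by omega
    simp [Derivation.leibniz, hF s (by omega), J.pd_x, this]
  -- Descending induction on the order of `ρ`: the truncated subtraction stops at the bound `m + 1`,
  -- reached for `k = J.ord ρ`.
  have hdesc : ∀ k, m + 1 + (J.ord ρ - k) ≥ m + 1 ∧ J.Bounds (m + 1 + (J.ord ρ - k)) ρ := by
    intro k
    refine ⟨by omega, ?_⟩
    induction k with
    | zero => exact (J.bounds_ord ρ).mono (by omega)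
    | succ k ih =>
      by_cases hk : J.ord ρ ≤ k
      · convert ih using 2; omega
      · intro s hs γ
        by_cases hs' : m + 1 + (J.ord ρ - k) ≤ s
        · exact ih s hs' γ
        · have h1 := J.pd_D_succ s γ ρ
          rw [← hρ, hxF (s + 1) (by omega), ih (s + 1) (by omega), map_zero, zero_add] at h1
          exact h1.symm
  have hb : J.Bounds (m + 1) ρ := by simpa using (hdesc (J.ord ρ)).2
  have h1 := J.pd_D_succ m δ ρ
  rw [hb (m + 1) le_rfl, map_zero, zero_add] at h1
  have h2 : J.pd (m + 1) δ (J.pd (m + 1) δ (J.D ρ)) = 0 := by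
    rw [h1, J.pd_comm, hb (m + 1) le_rfl, map_zero]
  rw [← hρ] at h2
  have h3 : (2 : 𝕜) • F = 0 := by
    rw [← h2]
    simp only [Derivation.leibniz, J.pd_x, hF (m + 1) (by omega), smul_eq_mul, map_add]
    simp only [two_smul, and_self, if_true, mul_one, mul_zero]
    simp [mul_add]
  exact (smul_eq_zero_iff_right (two_ne_zero)).1 h3

theorem eq_of_int_dotProduct [CharZero 𝕜] {φ ψ : ι → 𝒜}
    (h : ∀ χ, J.int (χ ⬝ᵥ φ) = J.int (χ ⬝ᵥ ψ)) : φ = ψ := by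
  funext γ
  have : Nonempty ι := ⟨γ⟩
  refine sub_eq_zero.1 (J.eq_zero_of_int_mul fun f => ?_)
  have := h (Pi.single γ f)
  rw [single_dotProduct, single_dotProduct] at this
  rw [mul_sub, map_sub, this, sub_self]

end JetAlgebra
end OneLoop
-- Lie derivatives of evolutionary fields, covectors and brackets
namespace OneLoop
namespace JetAlgebra

variable {𝕜 ι 𝒜 : Type*} [Field 𝕜] [DecidableEq ι] [CommRing 𝒜] [Algebra 𝕜 𝒜]
  (J : JetAlgebra 𝕜 ι 𝒜) [Fintype ι]

/-- The componentwise derivative of a tuple along an evolutionary vector field. -/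
def prV (K X : ι → 𝒜) : ι → 𝒜 := fun α => J.pr K (X α)

theorem prV_add (K X Y : ι → 𝒜) : J.prV K (X + Y) = J.prV K X + J.prV K Y :=
  funext fun _ => map_add _ _ _

theorem prV_sub (K X Y : ι → 𝒜) : J.prV K (X - Y) = J.prV K X - J.prV K Y :=
  funext fun _ => map_sub _ _ _

theorem add_prV (K L X : ι → 𝒜) : J.prV (K + L) X = J.prV K X + J.prV L X :=
  funext fun _ => J.pr_add _ _ _

theorem sub_prV (K L X : ι → 𝒜) : J.prV (K - L) X = J.prV K X - J.prV L X :=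
  funext fun _ => J.pr_sub _ _ _

theorem prV_commutator (K L X : ι → 𝒜) :
    J.prV K (J.prV L X) - J.prV L (J.prV K X) = J.prV (J.prV K L - J.prV L K) X :=
  funext fun _ => J.pr_commutator _ _ _

theorem pr_dotProduct (K φ X : ι → 𝒜) :
    J.pr K (φ ⬝ᵥ X) = J.prV K φ ⬝ᵥ X + φ ⬝ᵥ J.prV K X := by
  simp only [dotProduct, map_sum, Derivation.leibniz, prV, smul_eq_mul, ← Finset.sum_add_distrib]
  exact Finset.sum_congr rfl fun α _ => by ring

/-- The Lie derivative of the evolutionary vector field `K` along `w`. -/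
def lieVec (w K : ι → 𝒜) : ι → 𝒜 := J.prV w K - J.prV K w

/-- The Lie derivative of the variational covector `φ` along `w`. -/
def lieCov (w φ : ι → 𝒜) : ι → 𝒜 := J.prV w φ + J.adjLin w φ

/-- Leibniz rule for the integrated pairing. The adjoint term of `lieCov` integrates to the term
`prV K w` subtracted in `lieVec`, so the two cancel. -/
theorem prInt_dotProduct (w φ K : ι → 𝒜) :
    J.prInt w (J.int (φ ⬝ᵥ K)) = J.int (J.lieCov w φ ⬝ᵥ K) + J.int (φ ⬝ᵥ J.lieVec w K) := by
  have h : J.int (J.adjLin w φ ⬝ᵥ K) = J.int (φ ⬝ᵥ J.prV K w) := by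
    rw [dotProduct_comm]; exact J.int_adjLin w φ K
  rw [J.prInt_int, J.pr_dotProduct, lieCov, lieVec, add_dotProduct, dotProduct_sub]
  simp only [map_add, map_sub, h]
  abel

/-- Paired with an arbitrary field, both sides agree by the commutator formula for prolongations and
the Leibniz rule of the pairing; nondegeneracy of the pairing removes the test field. -/
theorem euler_pr [CharZero 𝕜] (w : ι → 𝒜) (f : 𝒜) :
    J.euler (J.pr w f) = J.lieCov w (J.euler f) := by
  refine J.eq_of_int_dotProduct fun χ => ?_
  have h1 := congrArg J.int (J.pr_commutator w χ f)
  have h2 := J.prInt_dotProduct w (J.euler f) χ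
  have h3 : J.int (J.euler f ⬝ᵥ J.lieVec w χ) = J.int (J.pr (J.lieVec w χ) f) := by
    rw [dotProduct_comm, J.int_euler]
  rw [dotProduct_comm _ χ, J.int_euler, J.prInt_int, h3, dotProduct_comm _ χ] at h2
  rw [J.int_euler, ← sub_eq_zero]
  rw [map_sub] at h1
  have h4 : J.lieVec w χ = fun γ => J.pr w (χ γ) - J.pr χ (w γ) := rfl
  rw [← h4] at h1
  rw [h2] at h1
  have h5 : J.int (J.pr χ (J.pr w f)) - J.int (χ ⬝ᵥ J.lieCov w (J.euler f))
      = -((J.int (χ ⬝ᵥ J.lieCov w (J.euler f)) + J.int (J.pr (J.lieVec w χ) f)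
        - J.int (J.pr χ (J.pr w f))) - J.int (J.pr (J.lieVec w χ) f)) := by abel
  rw [h5, h1, sub_self, neg_zero]

theorem euler_neg [CharZero 𝕜] (f : 𝒜) : J.euler (-f) = -J.euler f := by
  refine J.eq_of_int_dotProduct fun χ => ?_
  rw [J.int_euler, dotProduct_neg, map_neg, map_neg, map_neg, J.int_euler]

/-- Skew-symmetry of an operator from covectors to vectors. -/
def SkewOp (P : (ι → 𝒜) → ι → 𝒜) : Prop :=
  ∀ φ ψ, J.int (φ ⬝ᵥ P ψ) = - J.int (ψ ⬝ᵥ P φ)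

/-- Minus the Lie derivative of the bivector `P` along `w`. -/
def deform (w : ι → 𝒜) (P : (ι → 𝒜) → ι → 𝒜) (ψ : ι → 𝒜) : ι → 𝒜 :=
  P (J.lieCov w ψ) - J.lieVec w (P ψ)

variable {J} in
-- Differentiate the skew-symmetry of `P` along `w` using the Leibniz rule of the pairing.
theorem SkewOp.deform {P : (ι → 𝒜) → ι → 𝒜} (hP : J.SkewOp P) (w : ι → 𝒜) :
    J.SkewOp (J.deform w P) := fun φ ψ => by
  have h1 := J.prInt_dotProduct w φ (P ψ)
  have h2 := J.prInt_dotProduct w ψ (P φ)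
  rw [hP φ ψ, map_neg] at h1
  simp only [JetAlgebra.deform, dotProduct_sub, map_sub]
  rw [hP φ (J.lieCov w ψ), hP ψ (J.lieCov w φ)]
  have h4 : J.int (φ ⬝ᵥ J.lieVec w (P ψ)) = -J.prInt w (J.int (ψ ⬝ᵥ P φ))
      - J.int (J.lieCov w φ ⬝ᵥ P ψ) := by rw [h1]; abel
  have h5 : J.int (ψ ⬝ᵥ J.lieVec w (P φ)) = J.prInt w (J.int (ψ ⬝ᵥ P φ))
      - J.int (J.lieCov w ψ ⬝ᵥ P φ) := by rw [h2]; abel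
  rw [h4, h5]
  abel

/-- A Hamiltonian flow stays Hamiltonian under an infinitesimal change of variables. -/
theorem flow_eq_of_hamiltonian [CharZero 𝕜] (P : (ι → 𝒜) →ₗ[𝕜] ι → 𝒜) (w K : ι → 𝒜) (f : 𝒜)
    (h : K = P (J.euler f)) :
    J.prV K w - J.prV w K = P (J.euler (-J.pr w f)) + J.deform w P (J.euler f) := by
  rw [J.euler_neg, map_neg, J.euler_pr, deform, ← h, lieVec]
  abel

/-- The brackets of functionals are invariant under an infinitesimal change of variables. -/
theorem int_bracket_deform [CharZero 𝕜] (P : (ι → 𝒜) →ₗ[𝕜] ι → 𝒜) (w : ι → 𝒜) (f g : 𝒜)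
    (h : J.int (J.euler f ⬝ᵥ P (J.euler g)) = 0) :
    J.int (J.euler (-J.pr w f) ⬝ᵥ P (J.euler g) + J.euler f ⬝ᵥ J.deform w P (J.euler g)
      + J.euler f ⬝ᵥ P (J.euler (-J.pr w g))) = 0 := by
  have h1 := J.prInt_dotProduct w (J.euler f) (P (J.euler g))
  rw [h, map_zero] at h1
  simp only [J.euler_neg, J.euler_pr, deform, map_neg, neg_dotProduct, dotProduct_neg, dotProduct_sub,
    map_add, map_sub]
  have h2 : J.int (J.euler f ⬝ᵥ J.lieVec w (P (J.euler g)))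
      = - J.int (J.lieCov w (J.euler f) ⬝ᵥ P (J.euler g)) :=
    eq_neg_of_add_eq_zero_right h1.symm
  rw [h2]
  abel

/-- The derivative of the coefficients of `P` along `K`. -/
def prOp (K : ι → 𝒜) (P : (ι → 𝒜) → ι → 𝒜) (χ : ι → 𝒜) : ι → 𝒜 :=
  J.prV K (P χ) - P (J.prV K χ)

/-- The second derivative of `w` in the directions `K` and `L`. -/
def hess (w K L : ι → 𝒜) : ι → 𝒜 := J.prV K (J.prV L w) - J.prV (J.prV K L) w

theorem hess_symm (w K L : ι → 𝒜) : J.hess w K L = J.hess w L K := by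
  have h := J.prV_commutator K L w
  rw [J.sub_prV] at h
  rw [hess, hess, ← sub_eq_zero]
  rw [← sub_eq_zero] at h
  rw [← h]
  abel

/-- Differentiating the adjunction between `adjLin w` and the linearization of `w` along `K`: the
derivative of the coefficients of the adjoint is the adjoint of the second derivative of `w`. -/
theorem int_adjLin_commutator (w K L χ : ι → 𝒜) :
    J.int ((J.prV K (J.adjLin w χ) - J.adjLin w (J.prV K χ)) ⬝ᵥ L)
      = J.int (χ ⬝ᵥ J.hess w K L) := by
  have adj : ∀ χ L, J.int (J.adjLin w χ ⬝ᵥ L) = J.int (χ ⬝ᵥ J.prV L w) := fun χ L => by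
    rw [dotProduct_comm]; exact J.int_adjLin w χ L
  have h1 := J.prInt_int K (J.adjLin w χ ⬝ᵥ L)
  rw [adj, J.prInt_int, J.pr_dotProduct, J.pr_dotProduct, map_add, map_add,
    adj χ (J.prV K L)] at h1
  rw [sub_dotProduct, map_sub, adj, hess, dotProduct_sub, map_sub]
  rw [← sub_eq_zero] at h1 ⊢
  rw [← neg_eq_zero, ← h1]
  abel

/-- Differentiating coefficients is not a tensorial operation, so the Leibniz rule fails by second
derivatives of `w`. One such term comes from `prV K w`, the other from the adjoint linearization
after skewness of `P` moves it to the other argument. -/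
theorem prInt_dotProduct_prOp (P : (ι → 𝒜) →ₗ[𝕜] ι → 𝒜) (hP : J.SkewOp P) (w K φ χ : ι → 𝒜) :
    J.prInt w (J.int (φ ⬝ᵥ J.prOp K P χ))
      = J.int (J.lieCov w φ ⬝ᵥ J.prOp K P χ) + J.int (φ ⬝ᵥ J.prOp K P (J.lieCov w χ))
        + J.int (φ ⬝ᵥ J.prOp (J.lieVec w K) P χ) - J.int (φ ⬝ᵥ J.prOp K (J.deform w P) χ)
        + (J.int (φ ⬝ᵥ J.hess w K (P χ)) - J.int (χ ⬝ᵥ J.hess w K (P φ))) := by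
  have hvec : J.lieVec w (J.prOp K P χ)
      = J.prOp K P (J.lieCov w χ) + J.prOp (J.lieVec w K) P χ - J.prOp K (J.deform w P) χ
        + J.hess w K (P χ) + P (J.prV K (J.adjLin w χ) - J.adjLin w (J.prV K χ)) := by
    have c1 := J.prV_commutator w K (P χ)
    have c2 := congrArg P (J.prV_commutator w K χ)
    rw [map_sub] at c2
    simp only [prOp, lieVec, lieCov, deform, hess, prV_add, prV_sub, sub_prV, map_add, map_sub]
      at c1 c2 ⊢
    rw [← c1, ← c2]
    abel
  rw [J.prInt_dotProduct, hvec]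
  simp only [dotProduct_add, dotProduct_sub, map_add, map_sub]
  have h2 := hP φ (J.prV K (J.adjLin w χ) - J.adjLin w (J.prV K χ))
  rw [J.int_adjLin_commutator, map_sub, dotProduct_sub, map_sub] at h2
  rw [← neg_eq_iff_eq_neg.2 h2]
  abel

/-- The Jacobi expression `{{·,·}_P,·}_Q` smeared with `φ, ψ, χ`. -/
def jac (P Q : (ι → 𝒜) → ι → 𝒜) (φ ψ χ : ι → 𝒜) : 𝒜 := φ ⬝ᵥ J.prOp (Q ψ) P χ

theorem prInt_jac (P : (ι → 𝒜) →ₗ[𝕜] ι → 𝒜) (hP : J.SkewOp P) (w φ ψ χ : ι → 𝒜) :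
    J.prInt w (J.int (J.jac P P φ ψ χ))
      = J.int (J.jac P P (J.lieCov w φ) ψ χ) + J.int (J.jac P P φ (J.lieCov w ψ) χ)
        + J.int (J.jac P P φ ψ (J.lieCov w χ))
        - J.int (J.jac (J.deform w P) P φ ψ χ) - J.int (J.jac P (J.deform w P) φ ψ χ)
        + (J.int (φ ⬝ᵥ J.hess w (P ψ) (P χ)) - J.int (χ ⬝ᵥ J.hess w (P ψ) (P φ))) := by
  have h : J.lieVec w (P ψ) = P (J.lieCov w ψ) - J.deform w P ψ := by rw [deform]; abel
  have h' : J.prOp (J.lieVec w (P ψ)) P χ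
      = J.prOp (P (J.lieCov w ψ)) P χ - J.prOp (J.deform w P ψ) P χ := by
    rw [h]
    simp only [prOp, sub_prV, map_sub]
    abel
  simp only [jac]
  rw [J.prInt_dotProduct_prOp P hP, h', dotProduct_sub, map_sub]
  abel

/-- The cyclic sum of `int (jac P Q)`. -/
def cycJac (P Q : (ι → 𝒜) → ι → 𝒜) (φ ψ χ : ι → 𝒜) : J.Functional :=
  J.int (J.jac P Q φ ψ χ) + J.int (J.jac P Q ψ χ φ) + J.int (J.jac P Q χ φ ψ)

/-- Differentiate the Jacobi identity of `P` along `w`. The terms with a Lie-differentiated argument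
vanish by Jacobi itself, and the second derivatives of `w`, symmetric in their two directions,
cancel in pairs over the cyclic sum. -/
theorem cycJac_deform (P : (ι → 𝒜) →ₗ[𝕜] ι → 𝒜) (hP : J.SkewOp P)
    (hJ : ∀ φ ψ χ, J.cycJac P P φ ψ χ = 0) (w φ ψ χ : ι → 𝒜) :
    J.cycJac (J.deform w P) P φ ψ χ + J.cycJac P (J.deform w P) φ ψ χ = 0 := by
  have h0 := congrArg (J.prInt w) (hJ φ ψ χ)
  have h1 := hJ (J.lieCov w φ) ψ χ
  have h2 := hJ φ (J.lieCov w ψ) χ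
  have h3 := hJ φ ψ (J.lieCov w χ)
  simp only [cycJac, map_add, map_zero, J.prInt_jac P hP] at h0 h1 h2 h3 ⊢
  rw [J.hess_symm w (P χ) (P ψ), J.hess_symm w (P φ) (P χ), J.hess_symm w (P ψ) (P φ)] at h0
  have e : ∀ a b c d : J.Functional, a = 0 → b = 0 → c = 0 → d = 0 → a + b + c - d = 0 := by
    rintro a b c d rfl rfl rfl rfl; simp
  have := e _ _ _ _ h1 h2 h3 h0
  rw [← this]
  abel

end JetAlgebra
end OneLoop
-- Normal ordering of the deformed operator, and matrices as operators
set_option linter.unusedSectionVars false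
namespace OneLoop

/-- The left side is the deformation of `g D + C N` along `u = ∂_X h`; the right side has all powers
of `D` on the right. `C` is multiplication by `t_X`, `A1` and `dG` are the matrices `cot` of `∂G`
and `∂_X ∂G`, `X` is `C` times the Hessian of `G`, and `Y` is multiplication by `u`; a trailing `t`
marks a transpose. Commutators with `D` are derivatives of matrices. The hypotheses are the
constancy of `N`, `Compat`, and associativity in three places. -/
theorem deformation_operator_identity {R : Type*} [Ring R]
    {D C N g A1 A1t X Xt dG dGt Y : R} (hN : D * N = N * D)
    (hg : D * g = g * D + (N * C + C * N))
    (hC : A1 * C = C * A1t) (hA : A1 * g = g * A1t) (hdG : dG * g = g * dGt) :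
    D * (A1 * D + (D * A1 - A1 * D - dG + X)) * (g * D + C * N)
        - (g * D + C * N) * (-(D * A1t) + (D * A1t - A1t * D - dGt + Xt)) * D
        - ((N * Y + Y * N) * D + (D * Y - Y * D) * N)
      = 2 * (A1 * g) * D * D * D
        + (D * (2 * (A1 * g)) - 2 * (A1 * g) * D
          + (D * (A1 * g) - A1 * g * D
            + (X * g - g * Xt + (A1 * C * N - N * (A1 * C))))) * D * D
        + ((A1 * (D * C - C * D) + (D * A1 - A1 * D - dG + X) * C - Y) * N
          + N * ((D * C - C * D) * A1t + C * (D * A1t - A1t * D - dGt + Xt) - Y)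
          + (D * (D * (A1 * g) - A1 * g * D + (X * g - g * Xt + (A1 * C * N - N * (A1 * C))))
            - (D * (A1 * g) - A1 * g * D
              + (X * g - g * Xt + (A1 * C * N - N * (A1 * C)))) * D)) * D
        + (D * ((A1 * (D * C - C * D) + (D * A1 - A1 * D - dG + X) * C - Y) * N)
          - (A1 * (D * C - C * D) + (D * A1 - A1 * D - dG + X) * C - Y) * N * D) := by
  linear_combination (norm := (noncomm_ring)) hg * (-(D * A1t) + (D * A1t - A1t * D - dGt + Xt)) * D
    - D * hA * D * D - D * hdG * D + Y * hN + D * A1 * C * hN + hN * A1 * C * D + N * D * hC * D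

/-- The derivative of a matrix. -/
def matD {𝕜 ι 𝒜 : Type*} [Field 𝕜] [CommRing 𝒜] [Algebra 𝕜 𝒜] (d : Derivation 𝕜 𝒜 𝒜)
    (A : Matrix ι ι 𝒜) : Matrix ι ι 𝒜 := A.map d

theorem matD_mul {𝕜 ι 𝒜 : Type*} [Fintype ι] [Field 𝕜] [CommRing 𝒜] [Algebra 𝕜 𝒜]
    (d : Derivation 𝕜 𝒜 𝒜) (A B : Matrix ι ι 𝒜) : matD d (A * B) = matD d A * B + A * matD d B := by
  ext i k
  simp only [matD, Matrix.map_apply, Matrix.mul_apply, map_sum, Derivation.leibniz,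
    Matrix.add_apply, ← Finset.sum_add_distrib, smul_eq_mul]
  exact Finset.sum_congr rfl fun j _ => by ring

theorem matD_transpose {𝕜 ι 𝒜 : Type*} [Field 𝕜] [CommRing 𝒜] [Algebra 𝕜 𝒜]
    (d : Derivation 𝕜 𝒜 𝒜) (A : Matrix ι ι 𝒜) : matD d A.transpose = (matD d A).transpose := rfl

theorem matD_add {𝕜 ι 𝒜 : Type*} [Field 𝕜] [CommRing 𝒜] [Algebra 𝕜 𝒜]
    (d : Derivation 𝕜 𝒜 𝒜) (A B : Matrix ι ι 𝒜) : matD d (A + B) = matD d A + matD d B := by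
  ext; simp [matD]

namespace JetAlgebra

variable {𝕜 ι 𝒜 : Type*} [Field 𝕜] [DecidableEq ι] [CommRing 𝒜] [Algebra 𝕜 𝒜]
  (J : JetAlgebra 𝕜 ι 𝒜) [Fintype ι]

/-- Functions of the coordinates `x 0 γ` only. -/
def IsPoint (f : 𝒜) : Prop := ∀ s γ, J.pd (s + 1) γ f = 0

variable {J} in
theorem IsPoint.pd {f : 𝒜} (h : J.IsPoint f) (γ : ι) : J.IsPoint (J.pd 0 γ f) := fun s δ => by
  rw [J.pd_comm, h, map_zero]

variable {J} in
theorem IsPoint.pr {f : 𝒜} (h : J.IsPoint f) (K : ι → 𝒜) :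
    J.pr K f = ∑ γ, K γ * J.pd 0 γ f := by
  have hb : J.Bounds 1 f := fun s hs γ => by
    obtain ⟨s, rfl⟩ := Nat.exists_eq_add_of_le' hs
    exact h s γ
  rw [JetAlgebra.pr, J.vf_eq _ hb]
  simp

variable {J} in
theorem IsPoint.D {f : 𝒜} (h : J.IsPoint f) : J.D f = ∑ γ, J.x 1 γ * J.pd 0 γ f := by
  have hb : J.Bounds 1 f := fun s hs γ => by
    obtain ⟨s, rfl⟩ := Nat.exists_eq_add_of_le' hs
    exact h s γ
  rw [JetAlgebra.D, J.vf_eq _ hb]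
  simp


/-- Componentwise total derivative. -/
def opD : Module.End 𝕜 (ι → 𝒜) where
  toFun v i := J.D (v i)
  map_add' _ _ := funext fun _ => map_add _ _ _
  map_smul' _ _ := funext fun _ => Derivation.map_smul _ _ _

theorem opD_apply (v : ι → 𝒜) (i : ι) : J.opD v i = J.D (v i) := rfl

end JetAlgebra

/-- Multiplication by a matrix. -/
def opM (𝕜 : Type*) {ι 𝒜 : Type*} [Field 𝕜] [CommRing 𝒜] [Algebra 𝕜 𝒜] [Fintype ι]
    (A : Matrix ι ι 𝒜) : Module.End 𝕜 (ι → 𝒜) := A.mulVecLin.restrictScalars 𝕜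

section opM
variable {𝕜 ι 𝒜 : Type*} [Field 𝕜] [DecidableEq ι] [CommRing 𝒜] [Algebra 𝕜 𝒜] [Fintype ι]
open Matrix

theorem opM_apply (A : Matrix ι ι 𝒜) (v : ι → 𝒜) : opM 𝕜 A v = A *ᵥ v := rfl

theorem opM_mul (A B : Matrix ι ι 𝒜) : opM 𝕜 (A * B) = opM 𝕜 A * opM 𝕜 B :=
  LinearMap.ext fun v => (Matrix.mulVec_mulVec v A B).symm

theorem opM_add (A B : Matrix ι ι 𝒜) : opM 𝕜 (A + B) = opM 𝕜 A + opM 𝕜 B :=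
  LinearMap.ext fun v => Matrix.add_mulVec A B v

theorem opM_sub (A B : Matrix ι ι 𝒜) : opM 𝕜 (A - B) = opM 𝕜 A - opM 𝕜 B :=
  LinearMap.ext fun v => Matrix.sub_mulVec A B v

/-- The derivative of a matrix is a commutator, which lets matrix and differential computations be
done together in the ring of endomorphisms. -/
theorem opM_matD (J : JetAlgebra 𝕜 ι 𝒜) (A : Matrix ι ι 𝒜) :
    opM 𝕜 (matD J.D A) = J.opD * opM 𝕜 A - opM 𝕜 A * J.opD := by
  refine LinearMap.ext fun v => funext fun i => ?_
  change _ = J.D ((A *ᵥ v) i) - (A *ᵥ J.opD v) i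
  simp only [opM_apply, mulVec, dotProduct, matD, map_apply, map_sum, Derivation.leibniz,
    smul_eq_mul, J.opD_apply, Finset.sum_add_distrib]
  rw [add_sub_cancel_left]
  exact Finset.sum_congr rfl fun j _ => mul_comm _ _

end opM

/-! ### Brackets of hydrodynamic type from an associative product, and their deformation -/

namespace JetAlgebra
open Matrix

variable {𝕜 ι 𝒜 : Type*} [Field 𝕜] [DecidableEq ι] [CommRing 𝒜] [Algebra 𝕜 𝒜]
  (J : JetAlgebra 𝕜 ι 𝒜) [Fintype ι]

theorem D_dotProduct (φ X : ι → 𝒜) : J.D (φ ⬝ᵥ X) = J.opD φ ⬝ᵥ X + φ ⬝ᵥ J.opD X := by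
  simp only [dotProduct, map_sum, Derivation.leibniz, opD_apply, smul_eq_mul,
    ← Finset.sum_add_distrib]
  exact Finset.sum_congr rfl fun α _ => by ring

theorem int_dotProduct_opD (φ X : ι → 𝒜) :
    J.int (φ ⬝ᵥ J.opD X) = - J.int (J.opD φ ⬝ᵥ X) := by
  have h := J.int_D (φ ⬝ᵥ X)
  rw [J.D_dotProduct, map_add] at h
  exact eq_neg_of_add_eq_zero_right h

/-- The potential `Φ^{αβ}` of a commutative associative multiplication with structure constants
`∂_γ Φ^{αβ}`. -/
structure ProductData where
  Φ : Matrix ι ι 𝒜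
  symm : Φ.IsSymm
  point : ∀ α β, J.IsPoint (Φ α β)
  assoc : ∀ σ α β μ, ∑ ρ, J.pd 0 ρ (Φ α σ) * J.pd 0 μ (Φ ρ β)
    = ∑ ρ, J.pd 0 ρ (Φ β σ) * J.pd 0 μ (Φ ρ α)

namespace ProductData

variable {J} (S : J.ProductData)

/-- The structure constants `c^{αβ}_γ`. -/
def c (α β γ : ι) : 𝒜 := J.pd 0 γ (S.Φ α β)

theorem c_symm (α β γ : ι) : S.c α β γ = S.c β α γ := by rw [c, c, ← S.symm.apply]

/-- Multiplication by a vector. -/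
def tan (V : ι → 𝒜) : Matrix ι ι 𝒜 := Matrix.of fun α β => ∑ μ, V μ * S.c α β μ

/-- Multiplication by a covector. -/
def cot (y : ι → 𝒜) : Matrix ι ι 𝒜 := Matrix.of fun α ρ => ∑ σ, y σ * S.c α σ ρ

theorem tan_transpose (V : ι → 𝒜) : (S.tan V)ᵀ = S.tan V := by
  ext α β
  simp [tan, S.c_symm α β]

theorem cot_mul_tan_apply (y V : ι → 𝒜) (α β : ι) :
    (S.cot y * S.tan V) α β = ∑ σ, ∑ μ, y σ * V μ * ∑ ρ, S.c α σ ρ * S.c ρ β μ := by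
  simp only [Matrix.mul_apply, cot, tan, of_apply, Finset.sum_mul, Finset.mul_sum]
  rw [Finset.sum_comm, Finset.sum_comm (s := Finset.univ (α := ι))]
  refine (Finset.sum_comm.trans (Finset.sum_congr rfl fun μ _ => ?_)).trans Finset.sum_comm
  rw [Finset.sum_comm]
  exact Finset.sum_congr rfl fun σ _ => Finset.sum_congr rfl fun ρ _ => by ring

/-- The right side is the transpose of the left. Associativity makes `∑_ρ c^{ασ}_ρ c^{ρβ}_μ`
symmetric in `α` and `β`, although `cot y` alone need not be symmetric. -/
theorem cot_mul_tan (y V : ι → 𝒜) : S.cot y * S.tan V = S.tan V * (S.cot y)ᵀ := by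
  have h : S.tan V * (S.cot y)ᵀ = (S.cot y * S.tan V)ᵀ := by
    rw [transpose_mul, tan_transpose]
  rw [h]
  ext α β
  rw [transpose_apply, cot_mul_tan_apply, cot_mul_tan_apply]
  exact Finset.sum_congr rfl fun σ _ => Finset.sum_congr rfl fun μ _ =>
    congrArg _ (S.assoc σ α β μ)

theorem matD_pr_Φ (K : ι → 𝒜) : matD (J.pr K) S.Φ = S.tan K := by
  ext α β
  exact (S.point α β).pr K

theorem matD_D_Φ : matD J.D S.Φ = S.tan (J.x 1) := by
  ext α β
  exact (S.point α β).D

/-- The diagonal matrix with constant entries. -/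
def diag (n : ι → 𝕜) : Matrix ι ι 𝒜 := Matrix.diagonal fun α => algebraMap 𝕜 𝒜 (n α)

theorem matD_diag (d : Derivation 𝕜 𝒜 𝒜) (n : ι → 𝕜) : matD d (diag n : Matrix ι ι 𝒜) = 0 := by
  ext α β
  by_cases h : α = β
  · subst h; simp [matD, diag]
  · simp [matD, diag, h]

/-- The vector field `W` and the exponents `n` satisfy
`∂_γ (W · c)^{αβ} = (n_α + n_β) c^{αβ}_γ`. -/
structure Compat (W : ι → 𝒜) (n : ι → 𝕜) : Prop where
  point : ∀ α β, J.IsPoint (S.tan W α β)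
  pd : ∀ α β γ, J.pd 0 γ (S.tan W α β) = (n α + n β) • S.c α β γ

theorem sum_smul_c (n : ι → 𝕜) (V : ι → 𝒜) (α β : ι) :
    ∑ γ, V γ * (n α + n β) • S.c α β γ = (diag n * S.tan V + S.tan V * diag n : Matrix ι ι 𝒜) α β := by
  simp only [diag, Matrix.add_apply, diagonal_mul, mul_diagonal, tan, of_apply, Finset.mul_sum,
    Finset.sum_mul, ← Finset.sum_add_distrib, Algebra.smul_def, map_add]
  exact Finset.sum_congr rfl fun μ _ => by ring

variable {S} in
theorem Compat.matD_pr {W : ι → 𝒜} {n : ι → 𝕜} (h : S.Compat W n) (K : ι → 𝒜) :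
    matD (J.pr K) (S.tan W) = diag n * S.tan K + S.tan K * diag n := by
  ext α β
  refine ((h.point α β).pr K).trans ?_
  simp only [h.pd, sum_smul_c]

variable {S} in
theorem Compat.matD_D {W : ι → 𝒜} {n : ι → 𝕜} (h : S.Compat W n) :
    matD J.D (S.tan W) = diag n * S.tan (J.x 1) + S.tan (J.x 1) * diag n := by
  ext α β
  refine ((h.point α β).D).trans ?_
  simp only [h.pd, sum_smul_c]

/-- The bracket of hydrodynamic type defined by `W` and `n`. -/
def bracket (W : ι → 𝒜) (n : ι → 𝕜) : Module.End 𝕜 (ι → 𝒜) :=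
  opM 𝕜 (S.tan W) * J.opD + opM 𝕜 (S.tan (J.x 1)) * opM 𝕜 (diag n)

theorem bracket_apply (W : ι → 𝒜) (n : ι → 𝕜) (ψ : ι → 𝒜) :
    S.bracket W n ψ = S.tan W *ᵥ J.opD ψ + S.tan (J.x 1) *ᵥ (diag n *ᵥ ψ) := rfl

theorem dotProduct_mulVec_tan (V φ ψ : ι → 𝒜) : φ ⬝ᵥ S.tan V *ᵥ ψ = ψ ⬝ᵥ S.tan V *ᵥ φ := by
  rw [dotProduct_mulVec, ← mulVec_transpose, tan_transpose, dotProduct_comm]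

theorem dotProduct_mulVec_diag (n : ι → 𝕜) (φ ψ : ι → 𝒜) :
    φ ⬝ᵥ (diag n : Matrix ι ι 𝒜) *ᵥ ψ = (diag n : Matrix ι ι 𝒜) *ᵥ φ ⬝ᵥ ψ := by
  rw [dotProduct_mulVec, ← mulVec_transpose, diag, diagonal_transpose]

theorem opD_mulVec (A : Matrix ι ι 𝒜) (v : ι → 𝒜) :
    J.opD (A *ᵥ v) = matD J.D A *ᵥ v + A *ᵥ J.opD v := by
  have := congrArg (fun f => f v) (opM_matD J A)
  simp only [LinearMap.sub_apply, Module.End.mul_apply, opM_apply] at this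
  rw [this]; abel

theorem prV_mulVec (K : ι → 𝒜) (A : Matrix ι ι 𝒜) (v : ι → 𝒜) :
    J.prV K (A *ᵥ v) = matD (J.pr K) A *ᵥ v + A *ᵥ J.prV K v := by
  funext i
  simp only [prV, mulVec, dotProduct, matD, map_apply, map_sum, Derivation.leibniz, smul_eq_mul,
    Pi.add_apply, ← Finset.sum_add_distrib]
  exact Finset.sum_congr rfl fun j _ => by ring

theorem prV_opD (K v : ι → 𝒜) : J.prV K (J.opD v) = J.opD (J.prV K v) :=
  funext fun _ => J.pr_D _ _

/-- Because the structure constants have a potential, multiplication by `t_X` is `∂_X Φ`, and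
prolongations commute with `D`. -/
theorem matD_pr_tan_x (K : ι → 𝒜) :
    matD (J.pr K) (S.tan (J.x 1)) = matD J.D (S.tan K) := by
  rw [← S.matD_D_Φ, ← S.matD_pr_Φ]
  ext α β
  exact J.pr_D _ _

/-- The symmetric part of the operator is governed by `∂_X g - (N C + C N)`, which `Compat` makes
zero; what remains is the total derivative of `φ · g ψ`. -/
theorem bracket_skew {W : ι → 𝒜} {n : ι → 𝕜} (h : S.Compat W n) :
    J.SkewOp (S.bracket W n) := fun φ ψ => by
  have h1 := J.int_D (φ ⬝ᵥ S.tan W *ᵥ ψ)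
  rw [J.D_dotProduct, opD_mulVec, h.matD_D, S.dotProduct_mulVec_tan W (J.opD φ), add_mulVec,
    dotProduct_add, dotProduct_add, ← mulVec_mulVec, ← mulVec_mulVec, dotProduct_mulVec_diag,
    S.dotProduct_mulVec_tan _ _ ψ] at h1
  rw [bracket_apply, bracket_apply, dotProduct_add, dotProduct_add]
  simp only [map_add] at h1 ⊢
  rw [← sub_eq_zero, ← h1]
  abel

theorem prOp_bracket {W : ι → 𝒜} {n : ι → 𝕜} (h : S.Compat W n) (K χ : ι → 𝒜) :
    J.prOp K (S.bracket W n) χ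
      = (diag n * S.tan K + S.tan K * diag n) *ᵥ J.opD χ
        + matD J.D (S.tan K) *ᵥ (diag n *ᵥ χ) := by
  rw [prOp, bracket_apply, bracket_apply, prV_add, prV_mulVec, prV_mulVec, prV_mulVec,
    h.matD_pr, matD_pr_tan_x, prV_opD, matD_diag, zero_mulVec, zero_add]
  abel

/-- The symmetric trilinear form `⟨x y z, V⟩`. -/
def tri (V x y z : ι → 𝒜) : 𝒜 := x ⬝ᵥ (S.cot y * S.tan V) *ᵥ z

/-- Associativity exchanges the outer arguments. With `tri_swap'`, which is commutativity of the
product, it yields symmetry under all permutations. -/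
theorem tri_swap (V x y z : ι → 𝒜) : S.tri V x y z = S.tri V z y x := by
  rw [tri, tri, dotProduct_mulVec, ← mulVec_transpose, transpose_mul, tan_transpose,
    ← cot_mul_tan, dotProduct_comm]

theorem vecMul_cot (x y : ι → 𝒜) : x ᵥ* S.cot y = y ᵥ* S.cot x := by
  funext ρ
  simp only [vecMul, dotProduct, cot, of_apply, Finset.mul_sum]
  rw [Finset.sum_comm]
  refine Finset.sum_congr rfl fun σ _ => Finset.sum_congr rfl fun α _ => ?_
  rw [S.c_symm]; ring

theorem tri_swap' (V x y z : ι → 𝒜) : S.tri V x y z = S.tri V y x z := by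
  rw [tri, tri, dotProduct_mulVec, dotProduct_mulVec, ← vecMul_vecMul, ← vecMul_vecMul,
    vecMul_cot]

theorem dotProduct_tan_tan (V x y z : ι → 𝒜) :
    x ⬝ᵥ S.tan (S.tan V *ᵥ z) *ᵥ y = S.tri V x y z := by
  have h : S.tan (S.tan V *ᵥ z) *ᵥ y = S.cot y *ᵥ (S.tan V *ᵥ z) := by
    funext α
    simp only [tan, cot, mulVec, dotProduct, of_apply, Finset.sum_mul]
    rw [Finset.sum_comm]
    refine Finset.sum_congr rfl fun σ _ => Finset.sum_congr rfl fun ρ _ => ?_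
    simp only [Finset.mul_sum]
    exact Finset.sum_congr rfl fun μ _ => Finset.sum_congr rfl fun μ _ => by ring
  rw [h, mulVec_mulVec, tri]

theorem tan_add (V V' : ι → 𝒜) : S.tan (V + V') = S.tan V + S.tan V' := by
  ext α β
  simp [tan, add_mul, Finset.sum_add_distrib]

/-- One integration by parts removes the derivative from the matrix of multiplication by `K`. The
two terms of the bracket in `K` then turn each remaining expression into values of `tri`. -/
theorem int_jac_bracket {W : ι → 𝒜} {n : ι → 𝕜} (h : S.Compat W n) (φ ψ χ : ι → 𝒜) :
    J.int (J.jac (S.bracket W n) (S.bracket W n) φ ψ χ)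
      = J.int (S.tri W (diag n *ᵥ φ) (J.opD χ) (J.opD ψ)
          + S.tri (J.x 1) (diag n *ᵥ φ) (J.opD χ) (diag n *ᵥ ψ)
          - S.tri W (J.opD φ) (diag n *ᵥ χ) (J.opD ψ)
          - S.tri (J.x 1) (J.opD φ) (diag n *ᵥ χ) (diag n *ᵥ ψ)) := by
  rw [jac, S.prOp_bracket h]
  set K := S.bracket W n ψ with hK
  have hKtan : ∀ x y, x ⬝ᵥ S.tan K *ᵥ y
      = S.tri W x y (J.opD ψ) + S.tri (J.x 1) x y (diag n *ᵥ ψ) := fun x y => by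
    rw [hK, bracket_apply, tan_add, add_mulVec, dotProduct_add, dotProduct_tan_tan,
      dotProduct_tan_tan]
  have h1 := J.int_D (φ ⬝ᵥ S.tan K *ᵥ (diag n *ᵥ χ))
  rw [J.D_dotProduct, opD_mulVec, opD_mulVec, matD_diag, zero_mulVec, zero_add] at h1
  rw [sub_sub, ← hKtan, ← hKtan, ← sub_eq_zero, ← map_sub, ← h1, add_mulVec, ← mulVec_mulVec,
    ← mulVec_mulVec]
  refine congrArg J.int ?_
  simp only [dotProduct_add, dotProduct_mulVec_diag n φ]
  abel

/-- Up to permuting arguments of the symmetric form, the twelve terms of the cyclic sum cancel in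
pairs. Beyond `Compat`, nothing about `W` and `n` enters, so whole pencils are covered. -/
theorem bracket_jacobi {W : ι → 𝒜} {n : ι → 𝕜} (h : S.Compat W n) (φ ψ χ : ι → 𝒜) :
    J.cycJac (S.bracket W n) (S.bracket W n) φ ψ χ = 0 := by
  rw [cycJac, S.int_jac_bracket h, S.int_jac_bracket h, S.int_jac_bracket h, ← map_add,
    ← map_add]
  convert map_zero J.int using 2
  have r : ∀ V x y z, S.tri V x y z = S.tri V y z x := fun V x y z => by
    rw [S.tri_swap', S.tri_swap, S.tri_swap', S.tri_swap]
  rw [r W (J.opD ψ) (diag n *ᵥ φ), r W (J.opD φ) (diag n *ᵥ χ), r W (diag n *ᵥ χ) (J.opD ψ),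
    r W (J.opD χ) (diag n *ᵥ ψ), r _ (diag n *ᵥ φ) (J.opD χ), r _ (J.opD φ) (diag n *ᵥ χ),
    r _ (diag n *ᵥ χ) (diag n *ᵥ ψ), r _ (J.opD ψ) (diag n *ᵥ φ),
    r _ (diag n *ᵥ φ) (diag n *ᵥ χ), r _ (J.opD χ) (diag n *ᵥ ψ), r _ (diag n *ᵥ ψ) (diag n *ᵥ φ)]
  abel

/-- The coefficients `q^{αβ}` of the deformation of a bracket of hydrodynamic type. -/
def defQ (n : ι → 𝕜) (G : 𝒜) : Matrix ι ι 𝒜 :=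
  (S.tan (J.x 1) * (Matrix.of fun σ ρ => J.pd 0 σ (J.pd 0 ρ G)) * S.tan (J.x 1)
    - S.cot (fun σ => J.D (J.pd 0 σ G)) * S.tan (J.x 1)
    + Matrix.of fun α β => ∑ ρ, J.D (S.c α β ρ)
        * (S.tan (J.x 1) *ᵥ fun σ => J.pd 0 σ G) ρ) * diag n

/-- The coefficients `a^{αβ}` of the deformation of a bracket of hydrodynamic type. -/
def defA (W : ι → 𝒜) (G : 𝒜) : Matrix ι ι 𝒜 := 2 * (S.cot (fun σ => J.pd 0 σ G) * S.tan W)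

/-- The skew part of the coefficients `b^{αβ}`. -/
def defS (W : ι → 𝒜) (n : ι → 𝕜) (G : 𝒜) : Matrix ι ι 𝒜 :=
  S.tan (J.x 1) * (Matrix.of fun σ ρ => J.pd 0 σ (J.pd 0 ρ G)) * S.tan W
    - S.tan W * (S.tan (J.x 1) * (Matrix.of fun σ ρ => J.pd 0 σ (J.pd 0 ρ G)))ᵀ
    + (S.cot (fun σ => J.pd 0 σ G) * S.tan (J.x 1) * diag n
      - diag n * (S.cot (fun σ => J.pd 0 σ G) * S.tan (J.x 1)))

/-- The tuple `h` with `u = ∂_X h`. -/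
def gen (G : 𝒜) : ι → 𝒜 := S.tan (J.x 1) *ᵥ fun σ => J.pd 0 σ G

/-- The zeroth order part of the linearization of `gen`. -/
def lin₀ (G : 𝒜) : Matrix ι ι 𝒜 :=
  matD J.D (S.cot fun σ => J.pd 0 σ G) - S.cot (fun σ => J.D (J.pd 0 σ G))
    + S.tan (J.x 1) * (Matrix.of fun σ ρ => J.pd 0 σ (J.pd 0 ρ G))

/-- Varying `t_X` inside the product gives `∂_X` of multiplication by `χ`, whence the first-order
term; varying the gradient of `G` gives the Hessian term of `lin₀`. -/
theorem prV_gen {G : 𝒜} (hG : J.IsPoint G) (χ : ι → 𝒜) :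
    J.prV χ (S.gen G)
      = S.cot (fun σ => J.pd 0 σ G) *ᵥ J.opD χ + S.lin₀ G *ᵥ χ := by
  rw [gen, prV_mulVec, matD_pr_tan_x]
  funext α
  simp only [lin₀, prV, (hG.pd _).pr, Pi.add_apply, mulVec, dotProduct, matD, tan, cot,
    map_apply, of_apply, map_sum, Derivation.leibniz, Matrix.add_apply, Matrix.sub_apply,
    Matrix.mul_apply, smul_eq_mul, add_mul, sub_mul, Finset.sum_add_distrib,
    Finset.sum_sub_distrib, Finset.sum_mul, Finset.mul_sum, J.opD_apply]
  have e1 : ∑ x, ∑ i, χ i * J.D (S.c α x i) * J.pd 0 x G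
      = ∑ x, ∑ i, J.pd 0 i G * J.D (S.c α i x) * χ x := by
    rw [Finset.sum_comm]
    exact Finset.sum_congr rfl fun _ _ => Finset.sum_congr rfl fun _ _ => by ring
  have e2 : ∑ x, ∑ i, S.c α x i * J.D (χ i) * J.pd 0 x G
      = ∑ x, ∑ i, J.pd 0 i G * S.c α i x * J.D (χ x) := by
    rw [Finset.sum_comm]
    exact Finset.sum_congr rfl fun _ _ => Finset.sum_congr rfl fun _ _ => by ring
  have e3 : ∑ i, ∑ x, ∑ k, J.x 1 k * S.c α i k * (χ x * J.pd 0 x (J.pd 0 i G))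
      = ∑ x, ∑ i, ∑ k, J.x 1 k * S.c α i k * J.pd 0 i (J.pd 0 x G) * χ x := by
    rw [Finset.sum_comm]
    refine Finset.sum_congr rfl fun x _ => Finset.sum_congr rfl fun i _ =>
      Finset.sum_congr rfl fun _ _ => ?_
    rw [J.pd_comm 0 x 0 i]; ring
  have e4 : ∑ x, ∑ i, S.c α i x * J.D (J.pd 0 i G) * χ x
      = ∑ x, ∑ i, J.D (J.pd 0 i G) * S.c α i x * χ x :=
    Finset.sum_congr rfl fun _ _ => Finset.sum_congr rfl fun _ _ => by ring
  rw [e1, e2, e3, e4]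
  ring

theorem prV_D_gen {G : 𝒜} (hG : J.IsPoint G) (χ : ι → 𝒜) :
    J.prV χ (J.opD (S.gen G))
      = J.opD (S.cot (fun σ => J.pd 0 σ G) *ᵥ J.opD χ + S.lin₀ G *ᵥ χ) := by
  rw [prV_opD, S.prV_gen hG]

/-- The adjoint is found by integrating the linearization by parts against a test field, not from
its defining alternating sum. -/
theorem adjLin_D_gen [CharZero 𝕜] {G : 𝒜} (hG : J.IsPoint G) (φ : ι → 𝒜) :
    J.adjLin (J.opD (S.gen G)) φ
      = J.opD ((S.cot fun σ => J.pd 0 σ G)ᵀ *ᵥ J.opD φ) - (S.lin₀ G)ᵀ *ᵥ J.opD φ := by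
  refine J.eq_of_int_dotProduct fun χ => ?_
  have h : (fun α => J.pr χ (J.opD (S.gen G) α)) = J.prV χ (J.opD (S.gen G)) := rfl
  rw [J.int_adjLin, h, S.prV_D_gen hG, J.int_dotProduct_opD, dotProduct_sub, map_sub,
    J.int_dotProduct_opD, dotProduct_add, map_add, dotProduct_mulVec, ← mulVec_transpose,
    dotProduct_mulVec _ (S.lin₀ G), ← mulVec_transpose (S.lin₀ G),
    dotProduct_comm _ (J.opD χ), dotProduct_comm _ χ]
  abel

/-- Passes from the explicit coefficients `q` to the form in which the operator identity produces
them. The difference between the two contains `∂_X` of multiplication by `h`, to be evaluated by the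
product rule. -/
theorem defQ_eq (n : ι → 𝕜) (G : 𝒜) :
    S.defQ n G = (S.cot (fun σ => J.pd 0 σ G) * matD J.D (S.tan (J.x 1))
      + S.lin₀ G * S.tan (J.x 1) - S.tan (J.opD (S.gen G))) * diag n := by
  rw [defQ]
  congr 1
  have h1 : S.tan (J.opD (S.gen G)) = matD J.D (S.tan (S.gen G))
      - Matrix.of fun α β => ∑ ρ, J.D (S.c α β ρ) * S.gen G ρ := by
    ext α β
    simp only [tan, matD, map_apply, of_apply, Matrix.sub_apply, map_sum, Derivation.leibniz,
      Finset.sum_add_distrib, smul_eq_mul, J.opD_apply]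
    rw [eq_sub_iff_add_eq, add_comm]
    exact congrArg₂ _ (Finset.sum_congr rfl fun _ _ => mul_comm _ _)
      (Finset.sum_congr rfl fun _ _ => mul_comm _ _)
  -- Multiplication by the product `h` is the composite of the two multiplications: associativity
  -- again.
  have h2 : S.tan (S.gen G) = S.cot (fun σ => J.pd 0 σ G) * S.tan (J.x 1) := by
    ext α β
    rw [cot_mul_tan_apply]
    simp only [gen, tan, mulVec, dotProduct, of_apply, Finset.sum_mul]
    rw [Finset.sum_comm]
    refine Finset.sum_congr rfl fun σ _ => ?_
    rw [Finset.sum_comm]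
    refine Finset.sum_congr rfl fun μ _ => ?_
    have h : ∑ ρ, S.c α σ ρ * S.c ρ β μ = ∑ ρ, S.c α β ρ * S.c ρ σ μ := by
      simpa only [c, S.symm.apply] using (S.assoc α β σ μ).symm
    rw [h, Finset.mul_sum]
    exact Finset.sum_congr rfl fun _ _ => by ring
  rw [h1, h2, matD_mul, lin₀]
  simp only [add_mul, sub_mul]
  rw [gen]
  abel

theorem opM_two : opM 𝕜 (2 : Matrix ι ι 𝒜) = 2 := by
  have h : opM 𝕜 (1 : Matrix ι ι 𝒜) = 1 := LinearMap.ext fun v => one_mulVec v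
  rw [← one_add_one_eq_two, opM_add, h, one_add_one_eq_two]

theorem opD_mul_diag (n : ι → 𝕜) :
    J.opD * opM 𝕜 (diag n : Matrix ι ι 𝒜) = opM 𝕜 (diag n : Matrix ι ι 𝒜) * J.opD := by
  have h := opM_matD J (diag n : Matrix ι ι 𝒜)
  rw [matD_diag] at h
  have h0 : opM 𝕜 (0 : Matrix ι ι 𝒜) = 0 := LinearMap.ext fun v => zero_mulVec v
  rw [h0] at h
  exact sub_eq_zero.1 h.symm

theorem deform_bracket_eq_op [CharZero 𝕜] {W : ι → 𝒜} {n : ι → 𝕜} (h : S.Compat W n) {G : 𝒜}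
    (hG : J.IsPoint G) (ψ : ι → 𝒜) :
    J.deform (J.opD (S.gen G)) (S.bracket W n) ψ
      = (J.opD * (opM 𝕜 (S.cot fun σ => J.pd 0 σ G) * J.opD + opM 𝕜 (S.lin₀ G)) * S.bracket W n
        - S.bracket W n * (-(J.opD * opM 𝕜 (S.cot fun σ => J.pd 0 σ G)ᵀ)
            + opM 𝕜 (S.lin₀ G)ᵀ) * J.opD
        - (opM 𝕜 (diag n * S.tan (J.opD (S.gen G)) + S.tan (J.opD (S.gen G)) * diag n) * J.opD
          + opM 𝕜 (matD J.D (S.tan (J.opD (S.gen G)))) * opM 𝕜 (diag n)) :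
          Module.End 𝕜 (ι → 𝒜)) ψ := by
  have h1 := S.prOp_bracket h (J.opD (S.gen G)) ψ
  rw [prOp] at h1
  have h2 : J.prV (S.bracket W n ψ) (J.opD (S.gen G)) = (J.opD * (opM 𝕜 (S.cot fun σ =>
      J.pd 0 σ G) * J.opD + opM 𝕜 (S.lin₀ G)) * S.bracket W n) ψ := S.prV_D_gen hG _
  have h3 : J.adjLin (J.opD (S.gen G)) ψ
      = -((-(J.opD * opM 𝕜 (S.cot fun σ => J.pd 0 σ G)ᵀ) + opM 𝕜 (S.lin₀ G)ᵀ) * J.opD) ψ := by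
    rw [S.adjLin_D_gen hG]
    simp only [Module.End.mul_apply, LinearMap.add_apply, LinearMap.neg_apply, opM_apply]
    abel
  rw [JetAlgebra.deform, lieCov, lieVec, h2, h3, map_add, map_neg]
  simp only [LinearMap.sub_apply]
  rw [mul_assoc (S.bracket W n), Module.End.mul_apply (S.bracket W n)]
  simp only [LinearMap.add_apply, Module.End.mul_apply, opM_apply]
  rw [← h1]
  abel

/-- The coefficients `b^{αβ}` of the deformation of a bracket of hydrodynamic type. -/
def defB (W : ι → 𝒜) (n : ι → 𝕜) (G : 𝒜) : Matrix ι ι 𝒜 :=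
  (3 / 2 : 𝕜) • matD J.D (S.defA W G) + S.defS W n G

/-- The coefficients `e^{αβ}` of the deformation of a bracket of hydrodynamic type. -/
def defE (W : ι → 𝒜) (n : ι → 𝕜) (G : 𝒜) : Matrix ι ι 𝒜 :=
  S.defQ n G + (S.defQ n G)ᵀ + matD J.D (S.defB W n G) - matD J.D (matD J.D (S.defA W G))

/-- Accounts for the factor `3/2`: writing `a = 2 A`, one has `(3/2) ∂_X a = ∂_X a + ∂_X A`, and the
two summands arise separately in the normal ordering. -/
theorem defB_eq [CharZero 𝕜] (W : ι → 𝒜) (n : ι → 𝕜) (G : 𝒜) :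
    S.defB W n G = matD J.D (S.defA W G)
      + (matD J.D (S.cot (fun σ => J.pd 0 σ G) * S.tan W) + S.defS W n G) := by
  rw [defB, defA, two_mul, matD_add]
  module

theorem defE_eq [CharZero 𝕜] (W : ι → 𝒜) (n : ι → 𝕜) (G : 𝒜) :
    S.defE W n G = S.defQ n G + (S.defQ n G)ᵀ
      + matD J.D (matD J.D (S.cot (fun σ => J.pd 0 σ G) * S.tan W) + S.defS W n G) := by
  rw [defE, defB_eq, matD_add]
  abel

theorem deform_bracket [CharZero 𝕜] {W : ι → 𝒜} {n : ι → 𝕜} (h : S.Compat W n) {G : 𝒜}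
    (hG : J.IsPoint G) (ψ : ι → 𝒜) :
    J.deform (J.opD (S.gen G)) (S.bracket W n) ψ
      = S.defA W G *ᵥ J.opD (J.opD (J.opD ψ)) + S.defB W n G *ᵥ J.opD (J.opD ψ)
        + S.defE W n G *ᵥ J.opD ψ + matD J.D (S.defQ n G) *ᵥ ψ := by
  have hg := congrArg (opM 𝕜) h.matD_D
  have hC := congrArg (opM 𝕜) (S.cot_mul_tan (fun σ => J.pd 0 σ G) (J.x 1))
  have hA := congrArg (opM 𝕜) (S.cot_mul_tan (fun σ => J.pd 0 σ G) W)
  have hdG := congrArg (opM 𝕜) (S.cot_mul_tan (fun σ => J.D (J.pd 0 σ G)) W)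
  have hdt : (diag n : Matrix ι ι 𝒜)ᵀ = diag n := diagonal_transpose _
  simp only [opM_matD, opM_mul, opM_add] at hg hC hA hdG
  -- Multiplication by `W` plays `g`; `tan_transpose` and the symmetry of diagonal matrices account
  -- for the transposed factors.
  have key := deformation_operator_identity (Y := opM 𝕜 (S.tan (J.opD (S.gen G))))
    (X := opM 𝕜 (S.tan (J.x 1)) * opM 𝕜 (Matrix.of fun σ ρ => J.pd 0 σ (J.pd 0 ρ G)))
    (Xt := opM 𝕜 (Matrix.of fun σ ρ => J.pd 0 σ (J.pd 0 ρ G))ᵀ * opM 𝕜 (S.tan (J.x 1)))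
    (opD_mul_diag (J := J) n) (sub_eq_iff_eq_add'.1 hg) hC hA hdG
  have goal : J.deform (J.opD (S.gen G)) (S.bracket W n) ψ
      = (opM 𝕜 (S.defA W G) * J.opD * J.opD * J.opD + opM 𝕜 (S.defB W n G) * J.opD * J.opD
        + opM 𝕜 (S.defE W n G) * J.opD + opM 𝕜 (matD J.D (S.defQ n G)) :
          Module.End 𝕜 (ι → 𝒜)) ψ := by
    rw [S.deform_bracket_eq_op h hG]
    refine LinearMap.congr_fun ?_ ψ
    simp only [defB_eq, defE_eq, defQ_eq, defA, defS, lin₀, opM_matD, opM_mul, opM_add, opM_sub,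
      opM_two, transpose_add, transpose_sub, transpose_mul, hdt, tan_transpose,
      ← matD_transpose, bracket]
    exact key
  exact goal

end ProductData
end JetAlgebra
end OneLoop
-- Smooth differential functions on an open set of jets as a jet algebra
namespace OneLoop

section DiffFun

variable {𝕜 : Type*} [RCLike 𝕜] {n : ℕ} {Ω : Set (Jet 𝕜 n)}

/-- `Ω` is an open condition on first order jets. -/
def IsJetOpen (Ω : Set (Jet 𝕜 n)) : Prop :=
  ∃ V : Set (Fin 2 → Fin n → 𝕜), IsOpen V ∧ Ω = truncate 1 ⁻¹' V

/-- The restriction of jets of order `N'` to order `N`. -/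
def restr {N N' : ℕ} (h : N ≤ N') :
    (Fin (N' + 1) → Fin n → 𝕜) →L[𝕜] (Fin (N + 1) → Fin n → 𝕜) :=
  ContinuousLinearMap.pi fun s => ContinuousLinearMap.proj (Fin.castLE (by omega) s)

theorem exists_truncate_eq (N : ℕ) (y : Fin (N + 1) → Fin n → 𝕜) :
    ∃ j : Jet 𝕜 n, truncate N j = y :=
  ⟨fun s => if h : s < N + 1 then y ⟨s, h⟩ else 0, funext fun s => by simp [truncate, s.2]⟩

/-- Membership in `Ω` depends only on the first-order jet, so the image is the preimage of an open
set under restriction. Working in order at least 1 makes the finite-dimensional calculus of open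
sets available. -/
theorem IsJetOpen.isOpen_image (hΩ : IsJetOpen Ω) {N : ℕ} (hN : 1 ≤ N) :
    IsOpen (truncate N '' Ω) := by
  obtain ⟨V, hV, rfl⟩ := hΩ
  have : truncate N '' (truncate 1 ⁻¹' V) = (restr (𝕜 := 𝕜) (n := n) hN) ⁻¹' V := by
    ext y
    constructor
    · rintro ⟨j, hj, rfl⟩
      exact hj
    · intro hy
      obtain ⟨j, rfl⟩ := exists_truncate_eq N y
      exact ⟨j, hy, rfl⟩
  rw [this]
  exact hV.preimage (restr hN).continuous

/-- The function `g` of jets of order `N` represents `f` on `Ω`. -/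
def Represents (Ω : Set (Jet 𝕜 n)) (N : ℕ) (g : (Fin (N + 1) → Fin n → 𝕜) → 𝕜)
    (f : Jet 𝕜 n → 𝕜) : Prop :=
  ContDiffOn 𝕜 ∞ g (truncate N '' Ω) ∧ ∀ j ∈ Ω, f j = g (truncate N j)

theorem Represents.mono {N N' : ℕ} {g : (Fin (N + 1) → Fin n → 𝕜) → 𝕜} {f : Jet 𝕜 n → 𝕜}
    (h : Represents Ω N g f) (hN : N ≤ N') : Represents Ω N' (g ∘ restr hN) f := by
  refine ⟨h.1.comp (restr (𝕜 := 𝕜) (n := n) hN).contDiff.contDiffOn ?_, fun j hj => h.2 j hj⟩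
  rintro _ ⟨j, hj, rfl⟩
  exact ⟨j, hj, rfl⟩

theorem IsDiffFun.exists_represents {f : Jet 𝕜 n → 𝕜} (h : IsDiffFun Ω f) :
    ∃ N, 1 ≤ N ∧ ∃ g, Represents Ω N g f := by
  obtain ⟨N, g, hg⟩ := h
  exact ⟨N + 1, by omega, _, Represents.mono (N := N) (g := g) hg (Nat.le_succ N)⟩

theorem IsDiffFun.exists_represents₂ {f f' : Jet 𝕜 n → 𝕜} (h : IsDiffFun Ω f)
    (h' : IsDiffFun Ω f') : ∃ N, (∃ g, Represents Ω N g f) ∧ ∃ g, Represents Ω N g f' := by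
  obtain ⟨N, g, hg⟩ := h
  obtain ⟨N', g', hg'⟩ := h'
  exact ⟨max N N', ⟨_, Represents.mono (g := g) hg (le_max_left _ _)⟩,
    ⟨_, Represents.mono (g := g') hg' (le_max_right _ _)⟩⟩

theorem IsDiffFun.add {f f' : Jet 𝕜 n → 𝕜} (h : IsDiffFun Ω f) (h' : IsDiffFun Ω f') :
    IsDiffFun Ω fun j => f j + f' j := by
  obtain ⟨N, ⟨g, hg⟩, g', hg'⟩ := h.exists_represents₂ h'
  exact ⟨N, _, hg.1.add hg'.1, fun j hj =>
    by simp [hg.2 j hj, hg'.2 j hj]⟩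

theorem IsDiffFun.mul {f f' : Jet 𝕜 n → 𝕜} (h : IsDiffFun Ω f) (h' : IsDiffFun Ω f') :
    IsDiffFun Ω fun j => f j * f' j := by
  obtain ⟨N, ⟨g, hg⟩, g', hg'⟩ := h.exists_represents₂ h'
  exact ⟨N, _, hg.1.mul hg'.1, fun j hj =>
    by simp [hg.2 j hj, hg'.2 j hj]⟩

theorem IsDiffFun.const (c : 𝕜) : IsDiffFun Ω fun _ => c :=
  ⟨0, fun _ => c, contDiffOn_const, fun _ _ => rfl⟩

theorem IsDiffFun.inv {f : Jet 𝕜 n → 𝕜} (h : IsDiffFun Ω f) (h0 : ∀ j ∈ Ω, f j ≠ 0) :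
    IsDiffFun Ω fun j => (f j)⁻¹ := by
  obtain ⟨N, g, hg⟩ := h
  refine ⟨N, _, hg.1.inv ?_, fun j hj => by simp [hg.2 j hj]⟩
  rintro _ ⟨j, hj, rfl⟩
  rw [← hg.2 j hj]
  exact h0 j hj

theorem isDiffFun_coord (s : ℕ) (γ : Fin n) : IsDiffFun Ω fun j => j s γ := by
  refine ⟨s, fun y => y (Fin.last s) γ, ?_, fun j _ => rfl⟩
  exact ContDiff.contDiffOn (by fun_prop)

theorem isDiffFun_comp_zero {U : Set (Fin n → 𝕜)} (hU : ∀ j ∈ Ω, j 0 ∈ U)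
    {a : (Fin n → 𝕜) → 𝕜} (ha : ContDiffOn 𝕜 ∞ a U) : IsDiffFun Ω fun j => a (j 0) := by
  refine ⟨0, fun y => a (y 0), ?_, fun j _ => rfl⟩
  refine ha.comp (t := U) (ContDiff.contDiffOn (by fun_prop)) ?_
  rintro _ ⟨j, hj, rfl⟩
  exact hU j hj

theorem IsDiffFun.congr {f f' : Jet 𝕜 n → 𝕜} (h : IsDiffFun Ω f) (hf : ∀ j ∈ Ω, f' j = f j) :
    IsDiffFun Ω f' := by
  obtain ⟨N, g, hg⟩ := h
  exact ⟨N, g, hg.1, fun j hj => by rw [hf j hj, hg.2 j hj]⟩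

theorem IsJetOpen.eventually_mem (hΩ : IsJetOpen Ω) {j : Jet 𝕜 n} (hj : j ∈ Ω)
    (v : Jet 𝕜 n) : ∀ᶠ t : 𝕜 in nhds 0, j + t • v ∈ Ω := by
  obtain ⟨V, hV, rfl⟩ := hΩ
  have hc : Continuous fun t : 𝕜 => truncate 1 j + t • truncate 1 v := by fun_prop
  have : (fun t : 𝕜 => truncate 1 j + t • truncate 1 v) ⁻¹' V ∈ nhds (0 : 𝕜) :=
    (hV.preimage hc).mem_nhds (by simpa using hj)
  exact this

theorem IsJetOpen.lineDeriv_congr (hΩ : IsJetOpen Ω) {f f' : Jet 𝕜 n → 𝕜}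
    (hf : ∀ j ∈ Ω, f j = f' j) {j : Jet 𝕜 n} (hj : j ∈ Ω) (v : Jet 𝕜 n) :
    lineDeriv 𝕜 f j v = lineDeriv 𝕜 f' j v :=
  Filter.EventuallyEq.deriv_eq ((hΩ.eventually_mem hj v).mono fun _ ht => hf _ ht)

/-- Along a line starting in `Ω`, nearby points stay in `Ω`; there the function depends on finitely
many jet coordinates, so the directional derivative is an ordinary Fréchet derivative. -/
theorem Represents.lineDeriv (hΩ : IsJetOpen Ω) {N : ℕ} (hN : 1 ≤ N)
    {g : (Fin (N + 1) → Fin n → 𝕜) → 𝕜} {f : Jet 𝕜 n → 𝕜} (h : Represents Ω N g f)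
    {j : Jet 𝕜 n} (hj : j ∈ Ω) (v : Jet 𝕜 n) :
    lineDeriv 𝕜 f j v = fderiv 𝕜 g (truncate N j) (truncate N v) := by
  rw [hΩ.lineDeriv_congr h.2 hj]
  have hd : DifferentiableAt 𝕜 g (truncate N j) :=
    (h.1.contDiffAt ((hΩ.isOpen_image hN).mem_nhds ⟨j, hj, rfl⟩)).differentiableAt (by simp)
  exact (hd.hasFDerivAt.hasLineDerivAt (truncate N v)).lineDeriv

theorem IsDiffFun.lineDeriv_mul (hΩ : IsJetOpen Ω) {f f' : Jet 𝕜 n → 𝕜} (h : IsDiffFun Ω f)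
    (h' : IsDiffFun Ω f') {j : Jet 𝕜 n} (hj : j ∈ Ω) (v : Jet 𝕜 n) :
    lineDeriv 𝕜 (fun j => f j * f' j) j v
      = f j * lineDeriv 𝕜 f' j v + f' j * lineDeriv 𝕜 f j v := by
  have key : ∀ {f : Jet 𝕜 n → 𝕜}, IsDiffFun Ω f → HasLineDerivAt 𝕜 f (lineDeriv 𝕜 f j v) j v := by
    intro f h
    obtain ⟨N, hN, g, hg⟩ := h.exists_represents
    have hd : DifferentiableAt 𝕜 g (truncate N j) :=
      (hg.1.contDiffAt ((hΩ.isOpen_image hN).mem_nhds ⟨j, hj, rfl⟩)).differentiableAt (by simp)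
    rw [hg.lineDeriv hΩ hN hj]
    have := hd.hasFDerivAt.hasLineDerivAt (truncate N v)
    exact HasDerivAt.congr_of_eventuallyEq this
      ((hΩ.eventually_mem hj v).mono fun _ ht => hg.2 _ ht)
  have := HasDerivAt.mul (key h) (key h')
  refine (HasDerivAt.deriv this).trans ?_
  simp only [zero_smul, add_zero]
  ring

theorem IsDiffFun.lineDeriv_add (hΩ : IsJetOpen Ω) {f f' : Jet 𝕜 n → 𝕜} (h : IsDiffFun Ω f)
    (h' : IsDiffFun Ω f') {j : Jet 𝕜 n} (hj : j ∈ Ω) (v : Jet 𝕜 n) :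
    lineDeriv 𝕜 (fun j => f j + f' j) j v = lineDeriv 𝕜 f j v + lineDeriv 𝕜 f' j v := by
  obtain ⟨N, ⟨g, hg⟩, g', hg'⟩ := h.exists_represents₂ h'
  have hN : N ≤ N + 1 := by omega
  have hN1 : 1 ≤ N + 1 := by omega
  replace hg := hg.mono hN
  replace hg' := hg'.mono hN
  have ho := (hΩ.isOpen_image hN1).mem_nhds ⟨j, hj, rfl⟩
  have hgg : Represents Ω (N + 1) (g ∘ restr hN + g' ∘ restr hN) fun j => f j + f' j :=
    ⟨hg.1.add hg'.1, fun j hj => by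
      rw [Pi.add_apply, ← hg.2 j hj, ← hg'.2 j hj]⟩
  rw [hg.lineDeriv hΩ hN1 hj, hg'.lineDeriv hΩ hN1 hj, hgg.lineDeriv hΩ hN1 hj,
    fderiv_add ((hg.1.contDiffAt ho).differentiableAt (by simp))
      ((hg'.1.contDiffAt ho).differentiableAt (by simp))]
  rfl

theorem Represents.pd (hΩ : IsJetOpen Ω) {N : ℕ} (hN : 1 ≤ N)
    {g : (Fin (N + 1) → Fin n → 𝕜) → 𝕜} {f : Jet 𝕜 n → 𝕜} (h : Represents Ω N g f)
    (s : ℕ) (γ : Fin n) : Represents Ω N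
      (fun y => fderiv 𝕜 g y (truncate N (Pi.single s (Pi.single γ 1)))) (pd s γ f) :=
  ⟨(h.1.fderiv_of_isOpen (hΩ.isOpen_image hN) (by simp)).clm_apply contDiffOn_const,
    fun _ hj => h.lineDeriv hΩ hN hj _⟩

theorem truncate_single_of_lt {N s : ℕ} (hs : N < s) (v : Fin n → 𝕜) :
    truncate N (Pi.single s v) = 0 := by
  funext t
  have : (t : ℕ) ≠ s := by omega
  simp [truncate, this]

theorem truncate_eq_sum (N : ℕ) (v : Jet 𝕜 n) : truncate N v
    = ∑ s ∈ Finset.range (N + 1), ∑ γ, v s γ • truncate N (Pi.single s (Pi.single γ 1)) := by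
  funext t δ
  simp only [Finset.sum_apply, truncate, Pi.smul_apply, smul_eq_mul]
  rw [Finset.sum_eq_single (t : ℕ), Finset.sum_eq_single δ]
  · simp
  · intro γ _ hγ
    simp [hγ.symm]
  · simp
  · intro s _ hs
    simp [hs.symm]
  · intro h
    exact absurd (Finset.mem_range.2 t.2) h

theorem Represents.pd_eq_zero (hΩ : IsJetOpen Ω) {N : ℕ} (hN : 1 ≤ N)
    {g : (Fin (N + 1) → Fin n → 𝕜) → 𝕜} {f : Jet 𝕜 n → 𝕜} (h : Represents Ω N g f)
    {s : ℕ} (hs : N < s) (γ : Fin n) {j : Jet 𝕜 n} (hj : j ∈ Ω) : OneLoop.pd s γ f j = 0 := by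
  rw [(h.pd hΩ hN s γ).2 j hj, truncate_single_of_lt hs]
  exact map_zero _

theorem Represents.lineDeriv_eq_sum (hΩ : IsJetOpen Ω) {N : ℕ} (hN : 1 ≤ N)
    {g : (Fin (N + 1) → Fin n → 𝕜) → 𝕜} {f : Jet 𝕜 n → 𝕜} (h : Represents Ω N g f)
    {j : Jet 𝕜 n} (hj : j ∈ Ω) (v : Jet 𝕜 n) :
    _root_.lineDeriv 𝕜 f j v
      = ∑ s ∈ Finset.range (N + 1), ∑ γ, v s γ * OneLoop.pd s γ f j := by
  rw [h.lineDeriv hΩ hN hj, truncate_eq_sum N v]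
  simp only [map_sum, map_smul, smul_eq_mul]
  exact Finset.sum_congr rfl fun s _ => Finset.sum_congr rfl fun γ _ => by
    rw [(h.pd hΩ hN s γ).2 j hj]

theorem IsDiffFun.pd (hΩ : IsJetOpen Ω) {f : Jet 𝕜 n → 𝕜} (h : IsDiffFun Ω f) (s : ℕ)
    (γ : Fin n) : IsDiffFun Ω (OneLoop.pd s γ f) := by
  obtain ⟨N, hN, g, hg⟩ := h.exists_represents
  exact ⟨N, _, hg.pd hΩ hN s γ⟩

theorem IsDiffFun.pd_comm (hΩ : IsJetOpen Ω) {f : Jet 𝕜 n → 𝕜} (h : IsDiffFun Ω f) (s : ℕ)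
    (γ : Fin n) (t : ℕ) (δ : Fin n) {j : Jet 𝕜 n} (hj : j ∈ Ω) :
    OneLoop.pd s γ (OneLoop.pd t δ f) j = OneLoop.pd t δ (OneLoop.pd s γ f) j := by
  obtain ⟨N, hN, g, hg⟩ := h.exists_represents
  have ho := (hΩ.isOpen_image hN).mem_nhds ⟨j, hj, rfl⟩
  have hc := hg.1.contDiffAt ho
  have hd : DifferentiableAt 𝕜 (fderiv 𝕜 g) (truncate N j) :=
    (hc.fderiv_right (m := 1) (by norm_cast)).differentiableAt (by simp)
  have hs : IsSymmSndFDerivAt 𝕜 g (truncate N j) :=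
    hc.isSymmSndFDerivAt (by
      rw [minSmoothness_of_isRCLikeNormedField]; exact WithTop.coe_le_coe.2 (le_top : (2 : ℕ∞) ≤ ⊤))
  rw [((hg.pd hΩ hN t δ).pd hΩ hN s γ).2 j hj, ((hg.pd hΩ hN s γ).pd hΩ hN t δ).2 j hj]
  beta_reduce
  rw [fderiv_clm_apply hd (differentiableAt_const _), fderiv_clm_apply hd (differentiableAt_const _)]
  simpa using hs _ _

/-- The algebra of differential functions on `Ω`. -/
def DF (Ω : Set (Jet 𝕜 n)) : Subalgebra 𝕜 (Ω → 𝕜) where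
  carrier := {a | ∃ f, IsDiffFun Ω f ∧ ∀ j : Ω, a j = f j}
  mul_mem' := by
    rintro a b ⟨f, hf, ha⟩ ⟨f', hf', hb⟩
    exact ⟨_, hf.mul hf', fun j => by rw [Pi.mul_apply, ha, hb]⟩
  add_mem' := by
    rintro a b ⟨f, hf, ha⟩ ⟨f', hf', hb⟩
    exact ⟨_, hf.add hf', fun j => by rw [Pi.add_apply, ha, hb]⟩
  algebraMap_mem' c := ⟨_, IsDiffFun.const c, fun _ => rfl⟩

/-- The function `f` on jets restricts to `a` on `Ω`. -/
def Rep (f : Jet 𝕜 n → 𝕜) (a : DF Ω) : Prop := ∀ j : Ω, f j = a.1 j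

theorem Rep.isDiffFun {f : Jet 𝕜 n → 𝕜} {a : DF Ω} (h : Rep f a) : IsDiffFun Ω f := by
  obtain ⟨f', hf', ha⟩ := a.2
  exact hf'.congr fun j hj => (h ⟨j, hj⟩).trans (ha ⟨j, hj⟩)

theorem IsDiffFun.exists_rep {f : Jet 𝕜 n → 𝕜} (h : IsDiffFun Ω f) : ∃ a : DF Ω, Rep f a :=
  ⟨⟨fun j => f j, f, h, fun _ => rfl⟩, fun _ => rfl⟩

/-- A function on jets restricting to `a`. -/
def lift (a : DF Ω) : Jet 𝕜 n → 𝕜 := a.2.choose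

theorem rep_lift (a : DF Ω) : Rep (lift a) a := fun j => (a.2.choose_spec.2 j).symm

theorem Rep.ext {f : Jet 𝕜 n → 𝕜} {a b : DF Ω} (h : Rep f a) (h' : Rep f b) : a = b :=
  Subtype.ext (funext fun j => (h j).symm.trans (h' j))

theorem Rep.eq {f f' : Jet 𝕜 n → 𝕜} {a : DF Ω} (h : Rep f a) (h' : Rep f' a) {j : Jet 𝕜 n}
    (hj : j ∈ Ω) : f j = f' j := (h ⟨j, hj⟩).trans (h' ⟨j, hj⟩).symm

/-- The partial derivative as a derivation of the algebra of differential functions. -/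
def pdDer (hΩ : IsJetOpen Ω) (s : ℕ) (γ : Fin n) : Derivation 𝕜 (DF Ω) (DF Ω) :=
  Derivation.mk'
    { toFun := fun a => ⟨fun j => pd s γ (lift a) j, _,
        (rep_lift a).isDiffFun.pd hΩ s γ, fun _ => rfl⟩
      map_add' := fun a b => Subtype.ext <| funext fun j => by
        refine Eq.trans ?_ ((rep_lift a).isDiffFun.lineDeriv_add hΩ (rep_lift b).isDiffFun j.2 _)
        refine hΩ.lineDeriv_congr (fun i hi => ?_) j.2 _
        rw [rep_lift (a + b) ⟨i, hi⟩, rep_lift a ⟨i, hi⟩, rep_lift b ⟨i, hi⟩]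
        rfl
      map_smul' := fun c a => Subtype.ext <| funext fun j => by
        have h := (IsDiffFun.const c).lineDeriv_mul hΩ (rep_lift a).isDiffFun j.2
          (Pi.single s (Pi.single γ 1))
        have h0 : lineDeriv 𝕜 (fun _ : Jet 𝕜 n => c) j.1 (Pi.single s (Pi.single γ 1)) = 0 := by
          simp [lineDeriv]
        rw [h0, mul_zero, add_zero] at h
        refine Eq.trans ?_ h
        refine hΩ.lineDeriv_congr (fun i hi => ?_) j.2 _
        rw [rep_lift (c • a) ⟨i, hi⟩, rep_lift a ⟨i, hi⟩]
        rfl }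
    fun a b => Subtype.ext <| funext fun j => by
      have h := (rep_lift a).isDiffFun.lineDeriv_mul hΩ (rep_lift b).isDiffFun j.2
          (Pi.single s (Pi.single γ 1))
      rw [rep_lift a j, rep_lift b j] at h
      refine Eq.trans ?_ h
      refine hΩ.lineDeriv_congr (fun i hi => ?_) j.2 _
      rw [rep_lift (a * b) ⟨i, hi⟩, rep_lift a ⟨i, hi⟩, rep_lift b ⟨i, hi⟩]
      rfl

theorem Rep.pdDer (hΩ : IsJetOpen Ω) {f : Jet 𝕜 n → 𝕜} {a : DF Ω} (h : Rep f a) (s : ℕ)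
    (γ : Fin n) : Rep (pd s γ f) (pdDer hΩ s γ a) := fun j =>
  hΩ.lineDeriv_congr (fun _ hi => h.eq (rep_lift a) hi) j.2 _

/-- The coordinate functions and partial derivatives on the algebra of differential functions. -/
def jetAlgebra (hΩ : IsJetOpen Ω) : JetAlgebra 𝕜 (Fin n) (DF Ω) where
  x s γ := ⟨fun j => j.1 s γ, _, isDiffFun_coord s γ, fun _ => rfl⟩
  pd := pdDer hΩ
  pd_comm s γ t δ a := by
    have h := rep_lift a
    refine Rep.ext ((h.pdDer hΩ t δ).pdDer hΩ s γ) fun j => ?_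
    rw [h.isDiffFun.pd_comm hΩ s γ t δ j.2]
    exact (h.pdDer hΩ s γ).pdDer hΩ t δ j
  pd_x s γ t δ := by
    refine Rep.ext (Rep.pdDer hΩ (f := fun j => j t δ) (fun _ => rfl) s γ) fun j => ?_
    have : HasLineDerivAt 𝕜 (fun j : Jet 𝕜 n => j t δ)
        ((Pi.single s (Pi.single γ 1) : Jet 𝕜 n) t δ) j.1 (Pi.single s (Pi.single γ 1)) := by
      have := ((hasDerivAt_id (0 : 𝕜)).mul_const
        ((Pi.single s (Pi.single γ 1) : Jet 𝕜 n) t δ)).const_add (j.1 t δ)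
      rwa [one_mul] at this
    refine this.lineDeriv.trans ?_
    by_cases ht : t = s
    · subst ht
      by_cases hδ : δ = γ
      · subst hδ; simp
      · simp [hδ]
    · simp [ht]
  exists_bound a := by
    obtain ⟨N, hN, g, hg⟩ := (rep_lift a).isDiffFun.exists_represents
    exact ⟨N + 1, fun s hs γ => Subtype.ext <| funext fun j => hg.pd_eq_zero hΩ hN (by omega) γ j.2⟩

variable (hΩ : IsJetOpen Ω)

theorem Rep.pd {f : Jet 𝕜 n → 𝕜} {a : DF Ω} (h : Rep f a) (s : ℕ) (γ : Fin n) :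
    Rep (pd s γ f) ((jetAlgebra hΩ).pd s γ a) := h.pdDer hΩ s γ

theorem rep_x (s : ℕ) (γ : Fin n) : Rep (fun j => j s γ) ((jetAlgebra hΩ).x s γ) := fun _ => rfl

theorem rep_const (c : 𝕜) : Rep (fun _ : Jet 𝕜 n => c) (algebraMap 𝕜 (DF Ω) c) := fun _ => rfl

section closure
variable {f g : Jet 𝕜 n → 𝕜} {a b : DF Ω}

theorem Rep.add (h : Rep f a) (h' : Rep g b) : Rep (fun j => f j + g j) (a + b) := fun j =>
  congrArg₂ (· + ·) (h j) (h' j)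

theorem Rep.sub (h : Rep f a) (h' : Rep g b) : Rep (fun j => f j - g j) (a - b) := fun j =>
  congrArg₂ (· - ·) (h j) (h' j)

theorem Rep.mul (h : Rep f a) (h' : Rep g b) : Rep (fun j => f j * g j) (a * b) := fun j =>
  congrArg₂ (· * ·) (h j) (h' j)

theorem Rep.neg (h : Rep f a) : Rep (fun j => - f j) (-a) := fun j => congrArg (- ·) (h j)

theorem Rep.const_mul (c : 𝕜) (h : Rep f a) : Rep (fun j => c * f j) (c • a) := fun j =>
  congrArg (c * ·) (h j)

theorem rep_zero : Rep (fun _ : Jet 𝕜 n => (0 : 𝕜)) (0 : DF Ω) := fun _ => rfl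

theorem Rep.sum {κ : Type*} {s : Finset κ} {f : κ → Jet 𝕜 n → 𝕜} {a : κ → DF Ω}
    (h : ∀ k ∈ s, Rep (f k) (a k)) : Rep (fun j => ∑ k ∈ s, f k j) (∑ k ∈ s, a k) := by
  classical
  induction s using Finset.induction_on with
  | empty => simpa using rep_zero
  | insert k s hk ih =>
    simp only [Finset.sum_insert hk]
    exact (h k (Finset.mem_insert_self _ _)).add
      (ih fun k' hk' => h k' (Finset.mem_insert_of_mem hk'))

theorem Rep.congr (h : Rep f a) (hfg : ∀ j ∈ Ω, g j = f j) : Rep g a := fun j =>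
  (hfg j j.2).trans (h j)

theorem Rep.dotProduct {f g : Fin n → Jet 𝕜 n → 𝕜} {a b : Fin n → DF Ω}
    (h : ∀ k, Rep (f k) (a k)) (h' : ∀ k, Rep (g k) (b k)) :
    Rep (fun j => ∑ k, f k j * g k j) (a ⬝ᵥ b) := Rep.sum fun k _ => (h k).mul (h' k)

end closure

/-- A single transfer principle for `DX` and `pr`, both being line derivatives in a direction that
depends on the jet. -/
theorem Rep.vf {f : Jet 𝕜 n → 𝕜} {a : DF Ω} (h : Rep f a) {V : Jet 𝕜 n → Jet 𝕜 n}
    {b : ℕ → Fin n → DF Ω} (hV : ∀ s γ, Rep (fun j => V j s γ) (b s γ)) :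
    Rep (fun j => lineDeriv 𝕜 f j (V j)) ((jetAlgebra hΩ).vf b a) := by
  obtain ⟨N, hN, g, hg⟩ := h.isDiffFun.exists_represents
  have hb : (jetAlgebra hΩ).Bounds (N + 1) a := fun s hs γ => Rep.ext (h.pd hΩ s γ) fun j =>
    hg.pd_eq_zero hΩ hN (by omega) γ j.2
  rw [(jetAlgebra hΩ).vf_eq b hb]
  refine Rep.congr (Rep.sum fun s _ => Rep.sum fun γ _ => (hV s γ).mul (h.pd hΩ s γ))
    fun j hj => hg.lineDeriv_eq_sum hΩ hN hj _

theorem Rep.DX {f : Jet 𝕜 n → 𝕜} {a : DF Ω} (h : Rep f a) : Rep (DX f) ((jetAlgebra hΩ).D a) :=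
  h.vf hΩ fun s γ => rep_x hΩ (s + 1) γ

theorem Rep.iterate_DX {f : Jet 𝕜 n → 𝕜} {a : DF Ω} (h : Rep f a) (s : ℕ) :
    Rep (OneLoop.DX^[s] f) ((jetAlgebra hΩ).D^[s] a) := by
  induction s generalizing f a with
  | zero => exact h
  | succ s ih => exact ih (h.DX hΩ)

theorem Rep.pr {f : Jet 𝕜 n → 𝕜} {a : DF Ω} (h : Rep f a) {K : Fin n → Jet 𝕜 n → 𝕜}
    {k : Fin n → DF Ω} (hK : ∀ γ, Rep (K γ) (k γ)) : Rep (pr K f) ((jetAlgebra hΩ).pr k a) :=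
  h.vf hΩ fun s γ => (hK γ).iterate_DX hΩ s

theorem rep_finsum {f : ℕ → Jet 𝕜 n → 𝕜} {a : ℕ → DF Ω} (h : ∀ s, Rep (f s) (a s)) {N : ℕ}
    (ha : ∀ s, N ≤ s → a s = 0) :
    Rep (fun j => ∑ᶠ s, f s j) (∑ s ∈ Finset.range N, a s) := by
  refine Rep.congr (Rep.sum fun s _ => h s) fun j hj => ?_
  -- The `finsum` is not its default value: at each jet of `Ω` the support lies below `N`.
  refine finsum_eq_sum_of_support_subset _ fun s hs => ?_
  by_contra hN
  refine hs ?_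
  beta_reduce
  rw [h s ⟨j, hj⟩, ha s (by simpa using hN)]
  rfl

theorem algebraMap_neg_one_pow (s : ℕ) : algebraMap 𝕜 (DF Ω) ((-1) ^ s) = (-1) ^ s := by simp

theorem Rep.euler {f : Jet 𝕜 n → 𝕜} {a : DF Ω} (h : Rep f a) (γ : Fin n) :
    Rep (euler f γ) ((jetAlgebra hΩ).euler a γ) := by
  refine rep_finsum (a := fun s => (-1) ^ s * (jetAlgebra hΩ).D^[s] ((jetAlgebra hΩ).pd s γ a))
    (fun s => ?_) fun s hs => ?_
  · rw [← algebraMap_neg_one_pow]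
    exact (rep_const _).mul ((h.pd hΩ s γ).iterate_DX hΩ s)
  · simp only [(jetAlgebra hΩ).bounds_ord a s hs, JetAlgebra.iterate_D_zero, mul_zero]

theorem Rep.adjLin {w φ : Fin n → Jet 𝕜 n → 𝕜} {w' φ' : Fin n → DF Ω}
    (hw : ∀ α, Rep (w α) (w' α)) (hφ : ∀ α, Rep (φ α) (φ' α)) (γ : Fin n) :
    Rep (adjLin w φ γ) ((jetAlgebra hΩ).adjLin w' φ' γ) := by
  refine Rep.sum fun α _ => rep_finsum (a := fun s => (-1) ^ s * (jetAlgebra hΩ).D^[s]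
    ((jetAlgebra hΩ).pd s γ (w' α) * φ' α)) (fun s => ?_) fun s hs => ?_
  · rw [← algebraMap_neg_one_pow]
    exact (rep_const _).mul ((((hw α).pd hΩ s γ).mul (hφ α)).iterate_DX hΩ s)
  · simp only [(jetAlgebra hΩ).bounds_ord (w' α) s hs, JetAlgebra.iterate_D_zero, mul_zero,
      zero_mul]

theorem Rep.isTotalDeriv_iff {f : Jet 𝕜 n → 𝕜} {a : DF Ω} (h : Rep f a) :
    IsTotalDeriv Ω f ↔ (jetAlgebra hΩ).int a = 0 := by
  rw [JetAlgebra.int_eq_zero]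
  constructor
  · rintro ⟨ρ, hρ, hf⟩
    obtain ⟨r, hr⟩ := hρ.exists_rep
    exact ⟨r, (h.ext ((hr.DX hΩ).congr hf))⟩
  · rintro ⟨r, rfl⟩
    exact ⟨_, (rep_lift r).isDiffFun, fun j hj => h.eq ((rep_lift r).DX hΩ) hj⟩

/-- The operator `P` acts on covectors of differential functions as `P'`. -/
def RepOp (P : Op 𝕜 n) (P' : (Fin n → DF Ω) → Fin n → DF Ω) : Prop :=
  ∀ ψ ψ', (∀ β, Rep (ψ β) (ψ' β)) → ∀ α, Rep (P ψ α) (P' ψ' α)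

section RepOp
variable {P Q : Op 𝕜 n} {P' Q' : (Fin n → DF Ω) → Fin n → DF Ω}

theorem RepOp.prOp (h : RepOp P P') {K : Fin n → Jet 𝕜 n → 𝕜} {k : Fin n → DF Ω}
    (hK : ∀ γ, Rep (K γ) (k γ)) : RepOp (prOp K P) ((jetAlgebra hΩ).prOp k P') :=
  fun ψ ψ' hψ α => ((h ψ ψ' hψ α).pr hΩ hK).sub
    (h _ _ (fun β => (hψ β).pr hΩ hK) α)

theorem RepOp.bracketTransform (h : RepOp P P') {w : Fin n → Jet 𝕜 n → 𝕜} {w' : Fin n → DF Ω}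
    (hw : ∀ γ, Rep (w γ) (w' γ)) (hP : ∀ φ ψ, P' (φ + ψ) = P' φ + P' ψ) :
    RepOp (bracketTransform w P) ((jetAlgebra hΩ).deform w' P') := fun ψ ψ' hψ α => by
  have e : (jetAlgebra hΩ).deform w' P' ψ' α
      = (jetAlgebra hΩ).pr (P' ψ') (w' α) + P' ((jetAlgebra hΩ).adjLin w' ψ') α
        - (jetAlgebra hΩ).prOp w' P' ψ' α := by
    simp only [JetAlgebra.deform, JetAlgebra.lieCov, JetAlgebra.lieVec, JetAlgebra.prOp,
      JetAlgebra.prV, Pi.sub_apply, Pi.add_apply, hP]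
    abel
  rw [e]
  exact (((hw α).pr hΩ (h ψ ψ' hψ)).add (h _ _ (Rep.adjLin hΩ hw hψ) α)).sub
    (h.prOp hΩ hw ψ ψ' hψ α)

theorem RepOp.jacTerm (h : RepOp P P') (h' : RepOp Q Q') {φ ψ χ : Fin n → Jet 𝕜 n → 𝕜}
    {φ' ψ' χ' : Fin n → DF Ω} (hφ : ∀ γ, Rep (φ γ) (φ' γ)) (hψ : ∀ γ, Rep (ψ γ) (ψ' γ))
    (hχ : ∀ γ, Rep (χ γ) (χ' γ)) :
    Rep (jacTerm P Q φ ψ χ) ((jetAlgebra hΩ).jac P' Q' φ' ψ' χ') :=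
  Rep.dotProduct hφ (h.prOp hΩ (h' ψ ψ' hψ) χ χ' hχ)

theorem RepOp.isSkew (h : RepOp P P') (hP : (jetAlgebra hΩ).SkewOp P') : IsSkew Ω P :=
  fun φ ψ hφ hψ => by
    choose φ' hφ' using fun β => (hφ β).exists_rep
    choose ψ' hψ' using fun β => (hψ β).exists_rep
    have h1 : Rep (fun j => ∑ α, (φ α j * P ψ α j + ψ α j * P φ α j))
        (φ' ⬝ᵥ P' ψ' + ψ' ⬝ᵥ P' φ') :=
      ((Rep.dotProduct hφ' (h ψ ψ' hψ')).add (Rep.dotProduct hψ' (h φ φ' hφ'))).congr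
        fun j _ => Finset.sum_add_distrib
    rw [h1.isTotalDeriv_iff hΩ, map_add, hP φ' ψ', neg_add_cancel]

theorem RepOp.isJacobiMod (h : RepOp P P') (h' : RepOp Q Q')
    (h0 : ∀ φ ψ χ, (jetAlgebra hΩ).cycJac P' P' φ ψ χ = 0)
    (h1 : ∀ φ ψ χ, (jetAlgebra hΩ).cycJac Q' P' φ ψ χ + (jetAlgebra hΩ).cycJac P' Q' φ ψ χ = 0) :
    IsJacobiMod Ω P Q := fun φ ψ χ hφ hψ hχ => by
  choose φ' hφ using fun β => (hφ β).exists_rep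
  choose ψ' hψ using fun β => (hψ β).exists_rep
  choose χ' hχ using fun β => (hχ β).exists_rep
  have key : ∀ {P Q : Op 𝕜 n} {P' Q' : (Fin n → DF Ω) → Fin n → DF Ω}, RepOp P P' →
      RepOp Q Q' → Rep (fun j => OneLoop.jacTerm P Q φ ψ χ j
          + OneLoop.jacTerm P Q ψ χ φ j + OneLoop.jacTerm P Q χ φ ψ j)
        ((jetAlgebra hΩ).jac P' Q' φ' ψ' χ' + (jetAlgebra hΩ).jac P' Q' ψ' χ' φ'
          + (jetAlgebra hΩ).jac P' Q' χ' φ' ψ') := fun h h' =>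
    ((h.jacTerm hΩ h' hφ hψ hχ).add (h.jacTerm hΩ h' hψ hχ hφ)).add (h.jacTerm hΩ h' hχ hφ hψ)
  constructor
  · rw [(key h h).isTotalDeriv_iff hΩ, map_add, map_add]
    exact h0 φ' ψ' χ'
  · rw [((key h' h).add (key h h')).isTotalDeriv_iff hΩ, map_add, map_add, map_add, map_add,
      map_add]
    exact h1 φ' ψ' χ'

theorem RepOp.opEq {P' : (Fin n → DF Ω) → Fin n → DF Ω} (h : RepOp P P') (h' : RepOp Q P') :
    OpEq Ω P Q := fun ψ hψ α j hj => by
  choose ψ' hψ' using fun β => (hψ β).exists_rep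
  exact (h ψ ψ' hψ' α).eq (h' ψ ψ' hψ' α) hj

end RepOp

end DiffFun
end OneLoop
-- The product of a Frobenius manifold
namespace OneLoop
open Matrix

section closure

variable {𝕜 ι 𝒜 : Type*} [Field 𝕜] [DecidableEq ι] [CommRing 𝒜] [Algebra 𝕜 𝒜]
  {J : JetAlgebra 𝕜 ι 𝒜} {f g : 𝒜}

theorem isPoint_algebraMap (J : JetAlgebra 𝕜 ι 𝒜) (c : 𝕜) : J.IsPoint (algebraMap 𝕜 𝒜 c) :=
  fun _ _ => by simp

theorem JetAlgebra.IsPoint.add (hf : J.IsPoint f) (hg : J.IsPoint g) : J.IsPoint (f + g) :=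
  fun s γ => by rw [map_add, hf, hg, add_zero]

theorem JetAlgebra.IsPoint.mul (hf : J.IsPoint f) (hg : J.IsPoint g) : J.IsPoint (f * g) :=
  fun s γ => by rw [Derivation.leibniz, hf, hg, smul_zero, smul_zero, add_zero]

theorem JetAlgebra.IsPoint.sum {κ : Type*} {s : Finset κ} {f : κ → 𝒜}
    (hf : ∀ k ∈ s, J.IsPoint (f k)) : J.IsPoint (∑ k ∈ s, f k) :=
  fun t γ => by rw [map_sum]; exact Finset.sum_eq_zero fun k hk => hf k hk t γ

end closure

section Point

variable {𝕜 : Type*} [RCLike 𝕜] {n : ℕ} {r : WithTop ℕ∞}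

/-- The class is either `∞` or `ω`, and neither loses regularity under differentiation. -/
theorem add_one_le_of_infty_le (hr : ∞ ≤ r) : r + 1 ≤ r := by
  induction r with
  | top => exact le_top
  | coe r =>
    have : r = ⊤ := top_le_iff.1 (WithTop.coe_le_coe.1 hr)
    subst this
    exact le_rfl

theorem contDiffOn_partialD (hr : ∞ ≤ r) {U : Set (Fin n → 𝕜)} (hU : IsOpen U)
    {a : (Fin n → 𝕜) → 𝕜} (ha : ContDiffOn 𝕜 r a U) (γ : Fin n) :
    ContDiffOn 𝕜 r (partialD γ a) U :=
  (ha.fderiv_of_isOpen hU (add_one_le_of_infty_le hr)).clm_apply contDiffOn_const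


end Point

namespace FrobeniusManifold

variable {𝕜 : Type*} [RCLike 𝕜] {n : ℕ} [NeZero n] {r : WithTop ℕ∞}
  (M : FrobeniusManifold 𝕜 n r)

theorem contDiffOn_partialD₃ (hr : ∞ ≤ r) (α β γ : Fin n) :
    ContDiffOn 𝕜 r (M.c₀ α β γ) M.U :=
  contDiffOn_partialD hr M.isOpen_U (contDiffOn_partialD hr M.isOpen_U
    (contDiffOn_partialD hr M.isOpen_U M.contDiffOn_F γ) β) α

theorem isJetOpen (hr : ∞ ≤ r) : IsJetOpen M.Ω := by
  refine ⟨((fun y : Fin 2 → Fin n → 𝕜 => y 0) ⁻¹' M.U) ∩ ((fun y : Fin 2 → Fin n → 𝕜 =>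
    (Matrix.of fun α β => ∑ γ, M.c₀ α β γ (y 0) * y 1 γ).det) ⁻¹' {0}ᶜ), ?_, rfl⟩
  refine ContinuousOn.isOpen_inter_preimage ?_ (M.isOpen_U.preimage (by fun_prop))
    isOpen_compl_singleton
  have hc : ∀ α β γ, ContinuousOn (fun y : Fin 2 → Fin n → 𝕜 => M.c₀ α β γ (y 0))
      ((fun y : Fin 2 → Fin n → 𝕜 => y 0) ⁻¹' M.U) := fun α β γ =>
    (M.contDiffOn_partialD₃ hr α β γ).continuousOn.comp (Continuous.continuousOn (by fun_prop))
      fun y hy => hy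
  have hm : ContinuousOn (fun y : Fin 2 → Fin n → 𝕜 =>
      (Matrix.of fun α β => ∑ γ, M.c₀ α β γ (y 0) * y 1 γ))
      ((fun y : Fin 2 → Fin n → 𝕜 => y 0) ⁻¹' M.U) := by
    refine continuousOn_pi.2 fun α => continuousOn_pi.2 fun β => ?_
    change ContinuousOn (fun y : Fin 2 → Fin n → 𝕜 => ∑ γ, M.c₀ α β γ (y 0) * y 1 γ) _
    refine continuousOn_finsetSum _ fun γ _ => (hc α β γ).mul (Continuous.continuousOn ?_)
    exact (continuous_apply γ).comp (continuous_apply (1 : Fin 2))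
  exact (Continuous.matrix_det continuous_id).comp_continuousOn hm

variable {M} (hr : ∞ ≤ r)

/-- The algebra of differential functions on `M.Ω` with its jet coordinates. -/
abbrev J (M : FrobeniusManifold 𝕜 n r) (hr : ∞ ≤ r) : JetAlgebra 𝕜 (Fin n) (DF M.Ω) :=
  jetAlgebra (M.isJetOpen hr)

/-- A function of `t` as a differential function. -/
def pt {a : (Fin n → 𝕜) → 𝕜} (ha : ContDiffOn 𝕜 r a M.U) : DF M.Ω :=
  ⟨fun j => a (j.1 0), _, isDiffFun_comp_zero (fun _ hj => hj.1) (ha.of_le hr), fun _ => rfl⟩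

theorem rep_pt {a : (Fin n → 𝕜) → 𝕜} (ha : ContDiffOn 𝕜 r a M.U) :
    Rep (fun j => a (j 0)) (pt hr ha) := fun _ => rfl

theorem lineDeriv_comp_zero (hr : ∞ ≤ r) {a : (Fin n → 𝕜) → 𝕜} (ha : ContDiffOn 𝕜 r a M.U) {j : Jet 𝕜 n}
    (hj : j ∈ M.Ω) (v : Jet 𝕜 n) :
    lineDeriv 𝕜 (fun j => a (j 0)) j v = fderiv 𝕜 a (j 0) (v 0) := by
  have hd : DifferentiableAt 𝕜 a (j 0) :=
    (ha.contDiffAt (M.isOpen_U.mem_nhds hj.1)).differentiableAt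
      (fun h => by rw [h] at hr; exact absurd hr (by decide))
  exact HasDerivAt.deriv (hd.hasFDerivAt.hasLineDerivAt (v 0))

theorem pd_pt {a : (Fin n → 𝕜) → 𝕜} (ha : ContDiffOn 𝕜 r a M.U) (γ : Fin n) :
    (M.J hr).pd 0 γ (pt hr ha) = pt hr (contDiffOn_partialD hr M.isOpen_U ha γ) := by
  refine Rep.ext ((rep_pt hr ha).pd (M.isJetOpen hr) 0 γ) fun j => ?_
  refine (lineDeriv_comp_zero hr ha j.2 _).trans ?_
  rw [Pi.single_eq_same]
  rfl

theorem isPoint_pt {a : (Fin n → 𝕜) → 𝕜} (ha : ContDiffOn 𝕜 r a M.U) :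
    (M.J hr).IsPoint (pt hr ha) := fun s γ => by
  refine Rep.ext ((rep_pt hr ha).pd (M.isJetOpen hr) (s + 1) γ) fun j => ?_
  refine (lineDeriv_comp_zero hr ha j.2 _).trans ?_
  simp

theorem rep_partialD {a : (Fin n → 𝕜) → 𝕜} (ha : ContDiffOn 𝕜 r a M.U) (γ : Fin n) :
    Rep (fun j => partialD γ a (j 0)) ((M.J hr).pd 0 γ (pt hr ha)) := by
  rw [pd_pt]; exact rep_pt hr _

variable (M)

/-- The free energy as a differential function. -/
def Fp : DF M.Ω := pt hr M.contDiffOn_F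

/-- The matrix `η^{αβ}` over the algebra of differential functions. -/
def H : Matrix (Fin n) (Fin n) (DF M.Ω) := M.η.map (algebraMap 𝕜 (DF M.Ω))

/-- The matrix `η_{αβ}` over the algebra of differential functions. -/
def Hi : Matrix (Fin n) (Fin n) (DF M.Ω) := M.η⁻¹.map (algebraMap 𝕜 (DF M.Ω))

theorem H_transpose : M.Hᵀ = M.H := by
  rw [H, ← transpose_map, M.η_symm]

theorem H_mul_Hi : M.H * M.Hi = 1 := by
  rw [H, Hi, ← Matrix.map_mul, Matrix.mul_nonsing_inv _ M.η_nondeg]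
  exact Matrix.map_one _ (map_zero _) (map_one _)

theorem Hi_mul_H : M.Hi * M.H = 1 := by
  rw [H, Hi, ← Matrix.map_mul, Matrix.nonsing_inv_mul _ M.η_nondeg]
  exact Matrix.map_one _ (map_zero _) (map_one _)

theorem matD_H (d : Derivation 𝕜 (DF M.Ω) (DF M.Ω)) : matD d M.H = 0 := by
  ext α β; simp [matD, H]

/-- The matrix of second derivatives of the free energy. -/
def L : Matrix (Fin n) (Fin n) (DF M.Ω) :=
  Matrix.of fun α β => (M.J hr).pd 0 α ((M.J hr).pd 0 β (M.Fp hr))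

/-- The third derivatives of the free energy. -/
def cF (α β γ : Fin n) : DF M.Ω :=
  (M.J hr).pd 0 α ((M.J hr).pd 0 β ((M.J hr).pd 0 γ (M.Fp hr)))

theorem rep_c₀ (α β γ : Fin n) : Rep (fun j => M.c₀ α β γ (j 0)) (M.cF hr α β γ) := by
  rw [cF, Fp, pd_pt, pd_pt, pd_pt]
  exact rep_pt hr _

theorem cF_comm₁ (α β γ : Fin n) : M.cF hr α β γ = M.cF hr β α γ := (M.J hr).pd_comm _ _ _ _ _

theorem cF_comm₂ (α β γ : Fin n) : M.cF hr α β γ = M.cF hr α γ β :=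
  congrArg _ ((M.J hr).pd_comm _ _ _ _ _)

theorem cF_assoc (α β γ δ : Fin n) :
    ∑ l, ∑ m, M.cF hr α β l * M.H l m * M.cF hr m γ δ
      = ∑ l, ∑ m, M.cF hr δ β l * M.H l m * M.cF hr m γ α := by
  have h : ∀ α δ, Rep (fun j => ∑ l, ∑ m, M.c₀ α β l (j 0) * M.η l m * M.c₀ m γ δ (j 0))
      (∑ l, ∑ m, M.cF hr α β l * M.H l m * M.cF hr m γ δ) := fun α δ =>
    Rep.sum fun l _ => Rep.sum fun m _ =>
      ((M.rep_c₀ hr α β l).mul (rep_const _)).mul (M.rep_c₀ hr m γ δ)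
  exact Rep.ext (h α δ) ((h δ α).congr fun j hj => M.assoc _ hj.1 α β γ δ)

theorem cF_unit (α β : Fin n) : M.cF hr 0 α β = M.Hi α β :=
  Rep.ext (M.rep_c₀ hr 0 α β) fun j => M.unit _ j.2.1 α β

theorem matD_L (γ : Fin n) : matD ((M.J hr).pd 0 γ) (M.L hr) = Matrix.of (M.cF hr γ) := rfl

theorem L_transpose : (M.L hr)ᵀ = M.L hr := by
  exact Matrix.ext fun α β => (M.J hr).pd_comm _ _ _ _ _

theorem H_mul_mul_H_apply (A : Matrix (Fin n) (Fin n) (DF M.Ω)) (α β : Fin n) :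
    (M.H * A * M.H) α β = ∑ α', ∑ β', M.H α α' * M.H β β' * A α' β' := by
  simp only [Matrix.mul_apply, Finset.sum_mul]
  rw [Finset.sum_comm]
  refine Finset.sum_congr rfl fun α' _ => Finset.sum_congr rfl fun β' _ => ?_
  have : M.H β' β = M.H β β' := congrFun (congrFun M.H_transpose β) β'
  rw [this]; ring

theorem matD_HLH (γ : Fin n) : matD ((M.J hr).pd 0 γ) (M.H * M.L hr * M.H)
    = M.H * Matrix.of (M.cF hr γ) * M.H := by
  rw [matD_mul, matD_mul, matD_H, matD_L, zero_mul, zero_add, mul_zero, add_zero]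

theorem isPoint_Fp : (M.J hr).IsPoint (M.Fp hr) := isPoint_pt hr _

/-- The multiplication of the Frobenius manifold, with potential `η^{αα'} η^{ββ'} ∂_α' ∂_β' F`. -/
def S : (M.J hr).ProductData where
  Φ := M.H * M.L hr * M.H
  symm := by
    rw [Matrix.IsSymm, transpose_mul, transpose_mul, M.H_transpose, M.L_transpose, mul_assoc]
  point α β := by
    rw [H_mul_mul_H_apply]
    exact .sum fun α' _ => .sum fun β' _ => .mul (.mul (isPoint_algebraMap _ _)
      (isPoint_algebraMap _ _)) (((M.isPoint_Fp hr).pd β').pd α')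
  assoc σ α β μ := by
    -- For fixed `σ`, the numbers `c^{ασ}_ρ` form the matrix `H * Kσ`. The required identity says
    -- that `H * (Kσ * H * c_μ) * H` is symmetric, and WDVV is the symmetry of the inner factor.
    set Kσ : Matrix (Fin n) (Fin n) (DF M.Ω) :=
      Matrix.of fun α ρ => ∑ σ', M.H σ σ' * M.cF hr α σ' ρ with hK
    have h1 : ∀ α ρ, (M.J hr).pd 0 ρ ((M.H * M.L hr * M.H) α σ) = (M.H * Kσ) α ρ :=
      fun α ρ => by
        have := congrFun (congrFun (M.matD_HLH hr ρ) α) σ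
        refine this.trans ?_
        rw [H_mul_mul_H_apply]
        simp only [Matrix.mul_apply, hK, of_apply, Finset.mul_sum]
        refine Finset.sum_congr rfl fun α' _ => Finset.sum_congr rfl fun σ' _ => ?_
        rw [M.cF_comm₁ hr ρ, M.cF_comm₂ hr α' ρ, mul_assoc]
    have h2 : ∀ ρ β, (M.J hr).pd 0 μ ((M.H * M.L hr * M.H) ρ β)
        = (M.H * Matrix.of (M.cF hr μ) * M.H) ρ β := fun ρ β =>
      congrFun (congrFun (M.matD_HLH hr μ) ρ) β
    have h3 : (Kσ * M.H * Matrix.of (M.cF hr μ))ᵀ = Kσ * M.H * Matrix.of (M.cF hr μ) := by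
      have h4 : ∀ α β, (Kσ * M.H * Matrix.of (M.cF hr μ)) α β
          = ∑ σ', M.H σ σ' * ∑ l, ∑ m, M.cF hr α σ' l * M.H l m * M.cF hr m μ β := fun α β => by
        simp only [Matrix.mul_apply, hK, of_apply, Finset.sum_mul, Finset.mul_sum]
        refine Finset.sum_comm.trans (Eq.trans ?_ Finset.sum_comm)
        refine Finset.sum_congr rfl fun l _ => Finset.sum_comm.trans ?_
        refine Finset.sum_congr rfl fun σ' _ => Finset.sum_congr rfl fun m _ => ?_
        rw [M.cF_comm₁ hr m]; ring
      refine Matrix.ext fun α β => ?_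
      rw [transpose_apply, h4, h4]
      exact Finset.sum_congr rfl fun σ' _ => congrArg _ (M.cF_assoc hr _ _ _ _)
    have h5 : ∀ α β, ∑ ρ, (M.H * Kσ) α ρ * (M.H * Matrix.of (M.cF hr μ) * M.H) ρ β
        = (M.H * (Kσ * M.H * Matrix.of (M.cF hr μ)) * M.H) α β := fun α β => by
      rw [← Matrix.mul_apply]
      simp only [Matrix.mul_assoc]
    simp only [h1, h2, h5]
    have h6 : (M.H * (Kσ * M.H * Matrix.of (M.cF hr μ)) * M.H)ᵀ
        = M.H * (Kσ * M.H * Matrix.of (M.cF hr μ)) * M.H := by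
      rw [transpose_mul, transpose_mul, M.H_transpose, h3, ← Matrix.mul_assoc M.H _ M.H]
    exact congrFun (congrFun h6 β) α

end FrobeniusManifold
end OneLoop
-- The unit and Euler fields; the two undeformed brackets
namespace OneLoop
open Matrix

namespace JetAlgebra.ProductData

variable {𝕜 ι 𝒜 : Type*} [Field 𝕜] [DecidableEq ι] [CommRing 𝒜] [Algebra 𝕜 𝒜] [Fintype ι]
  {J : JetAlgebra 𝕜 ι 𝒜} (S : J.ProductData)

theorem tan_smul (a : 𝕜) (V : ι → 𝒜) : S.tan (a • V) = a • S.tan V :=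
  Matrix.ext fun α β => by simp [tan, Finset.smul_sum]

variable {S} in
theorem Compat.add {W W' : ι → 𝒜} {n n' : ι → 𝕜} (h : S.Compat W n) (h' : S.Compat W' n') :
    S.Compat (W + W') (n + n') where
  point α β := by
    rw [tan_add]; exact IsPoint.add (h.point α β) (h'.point α β)
  pd α β γ := by
    rw [tan_add, Matrix.add_apply, map_add, h.pd, h'.pd, ← add_smul, Pi.add_apply, Pi.add_apply]
    congr 1; ring

variable {S} in
theorem Compat.smul {W : ι → 𝒜} {n : ι → 𝕜} (h : S.Compat W n) (a : 𝕜) :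
    S.Compat (a • W) (a • n) where
  point α β s γ := by
    rw [tan_smul, Matrix.smul_apply, Derivation.map_smul, h.point, smul_zero]
  pd α β γ := by
    rw [tan_smul, Matrix.smul_apply, Derivation.map_smul, h.pd, smul_smul, Pi.smul_apply,
      Pi.smul_apply, smul_eq_mul, smul_eq_mul, mul_add]

omit [Fintype ι] in
theorem diag_add (n n' : ι → 𝕜) : (diag (n + n') : Matrix ι ι 𝒜) = diag n + diag n' := by
  rw [diag, diag, diag, diagonal_add]
  exact congrArg _ (funext fun α => map_add _ _ _)

omit [Fintype ι] in
theorem diag_smul (a : 𝕜) (n : ι → 𝕜) : (diag (a • n) : Matrix ι ι 𝒜) = a • diag n := by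
  rw [diag, diag, ← diagonal_smul]
  exact congrArg _ (funext fun α => by simp [Algebra.smul_def])

theorem bracket_add (W W' : ι → 𝒜) (n n' : ι → 𝕜) (ψ : ι → 𝒜) :
    S.bracket (W + W') (n + n') ψ = S.bracket W n ψ + S.bracket W' n' ψ := by
  simp only [bracket_apply, tan_add, diag_add, add_mulVec, mulVec_add]
  abel

theorem bracket_smul (a : 𝕜) (W : ι → 𝒜) (n : ι → 𝕜) (ψ : ι → 𝒜) :
    S.bracket (a • W) (a • n) ψ = a • S.bracket W n ψ := by
  simp only [bracket_apply, tan_smul, diag_smul, smul_mulVec, mulVec_smul, smul_add]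

end JetAlgebra.ProductData

namespace FrobeniusManifold
open JetAlgebra JetAlgebra.ProductData

variable {𝕜 : Type*} [RCLike 𝕜] {n : ℕ} [NeZero n] {r : WithTop ℕ∞}
  (M : FrobeniusManifold 𝕜 n r) (hr : ∞ ≤ r)

theorem S_c (α β γ : Fin n) : (M.S hr).c α β γ
    = ∑ α', ∑ β', M.H α α' * M.H β β' * M.cF hr α' β' γ := by
  have := congrFun (congrFun (M.matD_HLH hr γ) α) β
  refine this.trans ?_
  rw [H_mul_mul_H_apply]
  refine Finset.sum_congr rfl fun α' _ => Finset.sum_congr rfl fun β' _ => ?_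
  rw [of_apply, M.cF_comm₁ hr γ, M.cF_comm₂ hr α' γ]

theorem rep_c₂ (α β γ : Fin n) : Rep (fun j => M.c₂ α β γ (j 0)) ((M.S hr).c α β γ) := by
  rw [S_c]
  exact Rep.sum fun α' _ => Rep.sum fun β' _ =>
    ((rep_const _).mul (rep_const _)).mul (M.rep_c₀ hr _ _ _)

/-- The unit vector field. -/
def unitW : Fin n → DF M.Ω := Pi.single 0 1

/-- The Euler vector field as a vector of differential functions. -/
def eulerW (α : Fin n) : DF M.Ω :=
  algebraMap 𝕜 _ (1 - M.q α) * (M.J hr).x 0 α + algebraMap 𝕜 _ (M.rr α)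

/-- The exponents `1/2 - μ_α`. -/
def expo (α : Fin n) : 𝕜 := 1 / 2 - M.mu α

theorem rep_eulerW (ε : Fin n) : Rep (fun j => M.E ε (j 0)) (M.eulerW hr ε) :=
  ((rep_const _).mul (rep_x _ 0 ε)).add (rep_const _)

theorem tan_unitW : (M.S hr).tan M.unitW = M.H := by
  have h : (M.S hr).tan M.unitW = M.H * M.Hi * M.H := Matrix.ext fun α β => by
    rw [H_mul_mul_H_apply, tan, of_apply]
    simp only [unitW, Pi.single_apply, ite_mul, one_mul, zero_mul, Finset.sum_ite_eq',
      Finset.mem_univ, if_true, S_c]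
    refine Finset.sum_congr rfl fun α' _ => Finset.sum_congr rfl fun β' _ => ?_
    rw [← M.cF_unit hr, M.cF_comm₂ hr α', M.cF_comm₁ hr α']
  rw [h, H_mul_Hi, one_mul]

theorem compat_unitW : (M.S hr).Compat M.unitW 0 where
  point α β := by
    rw [tan_unitW]; exact isPoint_algebraMap _ _
  pd α β γ := by
    rw [tan_unitW, H, map_apply, Derivation.map_algebraMap]
    simp

/-- The derivative along the Euler vector field. -/
def eulerD (f : DF M.Ω) : DF M.Ω := ∑ α, M.eulerW hr α * (M.J hr).pd 0 α f

theorem pd_eulerW (γ α : Fin n) : (M.J hr).pd 0 γ (M.eulerW hr α)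
    = if α = γ then algebraMap 𝕜 _ (1 - M.q α) else 0 := by
  rw [eulerW, map_add, Derivation.leibniz, Derivation.map_algebraMap, Derivation.map_algebraMap,
    (M.J hr).pd_x]
  simp

theorem eulerD_pd (γ : Fin n) (f : DF M.Ω) : M.eulerD hr ((M.J hr).pd 0 γ f)
    = (M.J hr).pd 0 γ (M.eulerD hr f) - (1 - M.q γ) • (M.J hr).pd 0 γ f := by
  have h : (M.J hr).pd 0 γ (M.eulerD hr f)
      = ∑ α, (M.J hr).pd 0 α f * (if α = γ then algebraMap 𝕜 _ (1 - M.q α) else 0)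
        + M.eulerD hr ((M.J hr).pd 0 γ f) := by
    simp only [eulerD, map_sum, Derivation.leibniz, pd_eulerW, smul_eq_mul, Finset.sum_add_distrib]
    rw [add_comm]
    refine congrArg₂ (· + ·) rfl (Finset.sum_congr rfl fun α _ => ?_)
    rw [(M.J hr).pd_comm]
  rw [h]
  simp [Algebra.smul_def, mul_comm]

theorem eulerD_Fp : M.eulerD hr (M.Fp hr) = (3 - M.d) • M.Fp hr
    + ((1 / 2 : 𝕜) • ∑ α, ∑ β, algebraMap 𝕜 _ (M.A α β) * (M.J hr).x 0 α * (M.J hr).x 0 β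
      + ∑ α, algebraMap 𝕜 _ (M.B α) * (M.J hr).x 0 α + algebraMap 𝕜 _ M.C) := by
  refine Rep.ext (Rep.sum fun α _ => (M.rep_eulerW hr α).mul (rep_partialD hr M.contDiffOn_F α))
    (((rep_pt hr M.contDiffOn_F).const_mul _).add ((((Rep.sum fun α _ => Rep.sum fun β _ =>
      ((rep_const (M.A α β)).mul (rep_x _ 0 α)).mul (rep_x _ 0 β)).const_mul _).add
        (Rep.sum fun α _ => (rep_const (M.B α)).mul (rep_x _ 0 α))).add
          (rep_const M.C)) |>.congr fun j hj => ?_)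
  have := M.quasihom _ hj.1
  simp only [E]
  rw [this]; ring

/-- Two differentiations of the quasihomogeneity of `F` remove the linear and constant terms, and
the weight becomes `3 - d - (1 - q_β) - (1 - q_γ) = 1 + μ_β + μ_γ`. -/
theorem eulerD_L (β γ : Fin n) : M.eulerD hr (M.L hr β γ)
    = (1 + M.mu β + M.mu γ) • M.L hr β γ + algebraMap 𝕜 _ (M.A β γ) := by
  have hA : M.A γ β = M.A β γ := M.A_symm.apply β γ
  rw [L, of_apply, eulerD_pd, eulerD_pd, eulerD_Fp]
  simp only [map_add, map_sub, Derivation.map_smul, map_sum, Derivation.leibniz,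
    Derivation.map_algebraMap, (M.J hr).pd_x, smul_eq_mul]
  simp [Finset.sum_add_distrib, apply_ite ((M.J hr).pd 0 β), hA]
  simp only [mu]
  module

/-- Differentiating `eulerD_L` once more, along the unit coordinate, where `q_1 = 0` and the third
derivatives of `F` are the constants `η_{βγ}`. The duality of the exponents is thus a consequence of
the axioms. -/
theorem eulerD_cF_zero (hr : ∞ ≤ r) (β γ : Fin n) : (M.mu β + M.mu γ) • M.Hi β γ = 0 := by
  have h := M.eulerD_pd hr 0 (M.L hr β γ)
  have h0 : (M.J hr).pd 0 0 (M.L hr β γ) = M.Hi β γ := M.cF_unit hr β γ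
  have h1 : M.eulerD hr (M.Hi β γ) = 0 := by simp [eulerD, Hi]
  rw [h0, h1, eulerD_L, map_add, Derivation.map_smul, h0, Derivation.map_algebraMap, M.q_zero] at h
  rw [h]; module

/-- Lowered indices give an anticommutation of the diagonal of `μ` with the inverse of `η`;
conjugating by `η` transfers it to raised indices. -/
theorem H_mu (hr : ∞ ≤ r) (α β : Fin n) : (M.mu α + M.mu β) • M.H α β = 0 := by
  have h1 : ProductData.diag M.mu * M.Hi + M.Hi * ProductData.diag M.mu = 0 := Matrix.ext fun β γ => by
    have := M.eulerD_cF_zero hr β γ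
    rw [Algebra.smul_def, map_add] at this
    simp only [ProductData.diag, Matrix.add_apply, diagonal_mul, mul_diagonal, Matrix.zero_apply]
    rw [← this]; ring
  have h2 : M.H * (ProductData.diag M.mu * M.Hi + M.Hi * ProductData.diag M.mu) * M.H = M.H * ProductData.diag M.mu + ProductData.diag M.mu * M.H := by
    rw [mul_add, add_mul, ← mul_assoc, mul_assoc _ M.Hi, ← mul_assoc M.H M.Hi, Hi_mul_H, H_mul_Hi,
      mul_one, one_mul]
  rw [h1, mul_zero, zero_mul] at h2
  have h3 := congrFun (congrFun h2 α) β
  simp only [ProductData.diag, Matrix.add_apply, diagonal_mul, mul_diagonal, Matrix.zero_apply] at h3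
  rw [Algebra.smul_def, map_add, h3]; ring

/-- Raising the indices of `eulerD_L` changes the sign of each `μ` by `H_mu`, so the weight becomes
`1 - μ_α - μ_β`, the sum of the two exponents. The intersection form is then a multiple of the
potential plus a constant, which makes `compat_eulerW` immediate. -/
theorem tan_eulerW (α β : Fin n) : (M.S hr).tan (M.eulerW hr) α β
    = (M.expo α + M.expo β) • (M.S hr).Φ α β
      + algebraMap 𝕜 _ (∑ α', ∑ β', M.η α α' * M.η β β' * M.A α' β') := by
  have h1 : (M.S hr).tan (M.eulerW hr) α β
      = ∑ α', ∑ β', M.H α α' * M.H β β' * M.eulerD hr (M.L hr α' β') := by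
    simp only [tan, of_apply, S_c, eulerD, Finset.mul_sum]
    rw [Finset.sum_comm]
    refine Finset.sum_congr rfl fun α' _ => Finset.sum_comm.trans ?_
    refine Finset.sum_congr rfl fun β' _ => Finset.sum_congr rfl fun μ _ => ?_
    have : M.cF hr α' β' μ = (M.J hr).pd 0 μ (M.L hr α' β') := by
      rw [M.cF_comm₂ hr, M.cF_comm₁ hr]; rfl
    rw [this]; ring
  have h2 : (M.S hr).Φ α β = ∑ α', ∑ β', M.H α α' * M.H β β' * M.L hr α' β' :=
    M.H_mul_mul_H_apply _ _ _
  rw [h1, h2, map_sum, Finset.smul_sum, ← Finset.sum_add_distrib]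
  refine Finset.sum_congr rfl fun α' _ => ?_
  rw [map_sum, Finset.smul_sum, ← Finset.sum_add_distrib]
  refine Finset.sum_congr rfl fun β' _ => ?_
  have ha := M.H_mu hr α α'
  have hb := M.H_mu hr β β'
  rw [eulerD_L]
  simp only [map_mul, Algebra.smul_def, map_add, map_sub, expo, map_one] at ha hb ⊢
  change _ = _ + M.H α α' * M.H β β' * _
  have h12 : algebraMap 𝕜 (DF M.Ω) (1 / 2) + algebraMap 𝕜 (DF M.Ω) (1 / 2) = 1 := by
    rw [← map_add, add_halves, map_one]
  linear_combination (M.H β β' * M.L hr α' β') * ha + (M.H α α' * M.L hr α' β') * hb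
    - (M.H α α' * M.H β β' * M.L hr α' β') * h12

theorem compat_eulerW : (M.S hr).Compat (M.eulerW hr) M.expo where
  point α β s γ := by
    rw [tan_eulerW, map_add, Derivation.map_algebraMap, Derivation.map_smul,
      (M.S hr).point α β s γ, smul_zero, add_zero]
  pd α β γ := by
    rw [tan_eulerW, map_add, Derivation.map_algebraMap, Derivation.map_smul, add_zero]
    rfl

/-- The first bracket on differential functions. -/
def P₁ : Module.End 𝕜 (Fin n → DF M.Ω) := (M.S hr).bracket M.unitW 0

/-- The second bracket on differential functions. -/
def P₂ : Module.End 𝕜 (Fin n → DF M.Ω) := (M.S hr).bracket (M.eulerW hr) M.expo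

theorem diag_zero : (ProductData.diag (0 : Fin n → 𝕜) : Matrix (Fin n) (Fin n) (DF M.Ω)) = 0 := by
  simp [ProductData.diag]

theorem P₁_apply (ψ : Fin n → DF M.Ω) : M.P₁ hr ψ = M.H *ᵥ (M.J hr).opD ψ := by
  rw [P₁, bracket_apply, diag_zero, zero_mulVec, mulVec_zero, add_zero, tan_unitW]

theorem repOp_bracket₁ : RepOp M.bracket₁ (M.P₁ hr) := fun ψ ψ' h α => by
  rw [P₁_apply]
  exact Rep.dotProduct (fun β => rep_const _) fun β => (h β).DX (M.isJetOpen hr)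

theorem rep_tan {V : Fin n → Jet 𝕜 n → 𝕜} {V' : Fin n → DF M.Ω} (h : ∀ ε, Rep (V ε) (V' ε))
    (α β : Fin n) : Rep (fun j => ∑ ε, V ε j * M.c₂ α β ε (j 0)) ((M.S hr).tan V' α β) :=
  Rep.sum fun ε _ => (h ε).mul (M.rep_c₂ hr α β ε)

theorem rep_g (α β : Fin n) :
    Rep (fun j => M.g α β (j 0)) ((M.S hr).tan (M.eulerW hr) α β) :=
  M.rep_tan hr (M.rep_eulerW hr) α β

/-- Since `(1 + d)/2 - q_β = 1/2 - μ_β`, the Christoffel term is multiplication by `t_X` after the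
diagonal matrix of exponents. -/
theorem repOp_bracket₂ : RepOp M.bracket₂ (M.P₂ hr) := fun ψ ψ' h α => by
  rw [P₂, bracket_apply]
  refine ((Rep.dotProduct (fun β => M.rep_g hr α β) fun β => (h β).DX (M.isJetOpen hr)).add
    (Rep.dotProduct (fun β => M.rep_tan hr (rep_x (M.isJetOpen hr) 1) α β)
      (g := fun β j => M.expo β * ψ β j) fun β => ?_)).congr fun j _ => ?_
  · rw [ProductData.diag, mulVec_diagonal]
    exact (rep_const _).mul (h β)
  · rw [bracket₂, ← Finset.sum_add_distrib]
    refine Finset.sum_congr rfl fun β _ => congrArg _ ?_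
    simp only [Finset.sum_mul, Γ, expo, mu]
    exact Finset.sum_congr rfl fun γ _ => by ring

end FrobeniusManifold
end OneLoop
-- Index formulas for the coefficients of the bracket corrections
namespace OneLoop
open Matrix

section RepM

variable {𝕜 : Type*} [RCLike 𝕜] {n : ℕ} {Ω : Set (Jet 𝕜 n)}

/-- A matrix of functions on jets restricts to `A` on `Ω`. -/
def RepM (f : Fin n → Fin n → Jet 𝕜 n → 𝕜) (A : Matrix (Fin n) (Fin n) (DF Ω)) : Prop :=
  ∀ α β, Rep (f α β) (A α β)

variable {f g : Fin n → Fin n → Jet 𝕜 n → 𝕜} {A B : Matrix (Fin n) (Fin n) (DF Ω)}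

theorem RepM.mul (h : RepM f A) (h' : RepM g B) :
    RepM (fun α β j => ∑ γ, f α γ j * g γ β j) (A * B) := fun α β =>
  Rep.dotProduct (h α) fun γ => h' γ β

theorem RepM.add (h : RepM f A) (h' : RepM g B) :
    RepM (fun α β j => f α β j + g α β j) (A + B) := fun α β => (h α β).add (h' α β)

theorem RepM.sub (h : RepM f A) (h' : RepM g B) :
    RepM (fun α β j => f α β j - g α β j) (A - B) := fun α β => (h α β).sub (h' α β)

theorem RepM.smul (c : 𝕜) (h : RepM f A) : RepM (fun α β j => c * f α β j) (c • A) :=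
  fun α β => (h α β).const_mul c

theorem RepM.two_mul (h : RepM f A) : RepM (fun α β j => 2 * f α β j) (2 * A) := by
  rw [_root_.two_mul]
  exact fun α β => ((h.add h) α β).congr fun j _ => _root_.two_mul _

theorem RepM.transpose (h : RepM f A) : RepM (fun α β => f β α) Aᵀ := fun α β => h β α

theorem RepM.matD_D (hΩ : IsJetOpen Ω) (h : RepM f A) :
    RepM (fun α β => DX (f α β)) (matD (jetAlgebra hΩ).D A) := fun α β => (h α β).DX hΩ

theorem RepM.mul_diag (h : RepM f A) (m : Fin n → 𝕜) :
    RepM (fun α β j => m β * f α β j) (A * JetAlgebra.ProductData.diag m) := fun α β => by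
  rw [JetAlgebra.ProductData.diag, mul_diagonal, mul_comm]
  exact (rep_const (m β)).mul (h α β)

theorem RepM.diag_mul (h : RepM f A) (m : Fin n → 𝕜) :
    RepM (fun α β j => m α * f α β j) (JetAlgebra.ProductData.diag m * A) := fun α β => by
  rw [JetAlgebra.ProductData.diag, diagonal_mul]
  exact (rep_const (m α)).mul (h α β)

theorem RepM.congr (h : RepM f A) (e : ∀ α β, ∀ j ∈ Ω, g α β j = f α β j) : RepM g A :=
  fun α β => (h α β).congr (e α β)

end RepM

namespace FrobeniusManifold
open JetAlgebra JetAlgebra.ProductData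

variable {𝕜 : Type*} [RCLike 𝕜] {n : ℕ} [NeZero n] {r : WithTop ℕ∞}
  (M : FrobeniusManifold 𝕜 n r) (hr : ∞ ≤ r) {G : (Fin n → 𝕜) → 𝕜} (hG : ContDiffOn 𝕜 r G M.U)

theorem rep_hess (σ ρ : Fin n) : Rep (fun j => partialD σ (partialD ρ G) (j 0))
    ((M.J hr).pd 0 σ ((M.J hr).pd 0 ρ (pt hr hG))) := by
  rw [pd_pt hr hG]; exact rep_partialD hr _ σ

theorem repM_cot : RepM (fun α ρ j => ∑ σ, partialD σ G (j 0) * M.c₂ α σ ρ (j 0))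
    ((M.S hr).cot fun σ => (M.J hr).pd 0 σ (pt hr hG)) := fun α ρ =>
  Rep.sum fun σ _ => (rep_partialD hr hG σ).mul (M.rep_c₂ hr α σ ρ)

theorem repM_tan_x : RepM (fun α β j => ∑ μ, j 1 μ * M.c₂ α β μ (j 0))
    ((M.S hr).tan ((M.J hr).x 1)) := M.rep_tan hr (rep_x (M.isJetOpen hr) 1)

theorem repM_g : RepM (fun α β j => M.g α β (j 0)) ((M.S hr).tan (M.eulerW hr)) := M.rep_g hr

theorem repM_unit : RepM (fun α β _ => M.η α β) ((M.S hr).tan M.unitW) := by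
  rw [tan_unitW]; exact fun α β => rep_const _

theorem g_symm (α β : Fin n) {j : Jet 𝕜 n} (hr : ∞ ≤ r) (hj : j ∈ M.Ω) :
    M.g α β (j 0) = M.g β α (j 0) := by
  refine (M.rep_g hr α β).eq (f' := fun j => M.g β α (j 0)) ?_ hj
  have := congrFun (congrFun ((M.S hr).tan_transpose (M.eulerW hr)) α) β
  rw [← this]
  exact M.rep_g hr β α

theorem repM_hess : RepM (fun σ ρ j => partialD σ (partialD ρ G) (j 0))
    (Matrix.of fun σ ρ => (M.J hr).pd 0 σ ((M.J hr).pd 0 ρ (pt hr hG))) := M.rep_hess hr hG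

theorem c₂_symm (α β : Fin n) {γ : Fin n} {j : Jet 𝕜 n} (hr : ∞ ≤ r) (hj : j ∈ M.Ω) :
    M.c₂ α β γ (j 0) = M.c₂ β α γ (j 0) := by
  refine (M.rep_c₂ hr α β γ).eq (f' := fun j => M.c₂ β α γ (j 0)) ?_ hj
  rw [c_symm]
  exact M.rep_c₂ hr β α γ

theorem hess_symm (hr : ∞ ≤ r) (hG : ContDiffOn 𝕜 r G M.U) (σ ρ : Fin n) {j : Jet 𝕜 n}
    (hj : j ∈ M.Ω) : partialD σ (partialD ρ G) (j 0) = partialD ρ (partialD σ G) (j 0) := by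
  refine (M.rep_hess hr hG σ ρ).eq (f' := fun j => partialD ρ (partialD σ G) (j 0)) ?_ hj
  rw [(M.J hr).pd_comm]
  exact M.rep_hess hr hG ρ σ

theorem rep_a₂ : RepM (M.a₂ G) ((M.S hr).defA (M.eulerW hr) (pt hr hG)) := by
  refine ((M.repM_cot hr hG).mul (M.repM_g hr)).two_mul.congr fun α β j _ => ?_
  simp only [a₂, Finset.sum_mul]
  rw [Finset.sum_comm]
  exact congrArg _ (Finset.sum_congr rfl fun γ _ => Finset.sum_congr rfl fun μ _ => by ring)

theorem rep_b₂ : RepM (M.b₂ G) ((M.S hr).defB (M.eulerW hr) M.expo (pt hr hG)) := by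
  have hCH := (M.repM_tan_x hr).mul (M.repM_hess hr hG)
  have hcC := (M.repM_cot hr hG).mul (M.repM_tan_x hr)
  refine ((((M.rep_a₂ hr hG).matD_D (M.isJetOpen hr)).smul (3 / 2)).add
    (((hCH.mul (M.repM_g hr)).sub ((M.repM_g hr).mul hCH.transpose)).add
      ((hcC.mul_diag _).sub (hcC.diag_mul _)))).congr fun α β j hj => ?_
  simp only [b₂]
  rw [add_assoc]
  refine congrArg _ (congrArg₂ (· + ·) ?_ ?_)
  · simp only [sub_mul, Finset.sum_sub_distrib, Finset.sum_mul, Finset.mul_sum]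
    refine congrArg₂ (· - ·) ?_ ?_
    · rw [Finset.sum_comm]
      refine Finset.sum_congr rfl fun γ _ => Finset.sum_congr rfl fun ρ _ =>
        Finset.sum_congr rfl fun μ _ => ?_
      rw [M.hess_symm hr hG γ ρ hj]; ring
    · rw [Finset.sum_comm]
      refine Finset.sum_congr rfl fun γ _ => Finset.sum_congr rfl fun ρ _ =>
        Finset.sum_congr rfl fun μ _ => ?_
      rw [M.hess_symm hr hG γ ρ hj, M.g_symm γ α hr hj]; ring
  · rw [← sub_mul]
    -- The commutator with the diagonal matrix contributes the difference of exponents at `β` and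
    -- `α`, which is `μ_α - μ_β`.
    refine congrArg₂ (· * ·) (by simp only [expo]; ring) ?_
    simp only [Finset.sum_mul, Finset.mul_sum]
    rw [Finset.sum_comm]
    refine Finset.sum_congr rfl fun γ _ => Finset.sum_comm.trans ?_
    refine Finset.sum_congr rfl fun μ _ => Finset.sum_congr rfl fun ρ _ => ?_
    ring

theorem rep_c₂₂ (α β ρ μ : Fin n) : Rep (fun j => M.c₂₂ α β ρ μ (j 0))
    ((M.J hr).pd 0 μ ((M.S hr).c α β ρ)) := by
  have h : (M.J hr).pd 0 μ ((M.S hr).c α β ρ)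
      = ∑ α', ∑ β', M.H α α' * M.H β β' * (M.J hr).pd 0 μ (M.cF hr α' β' ρ) := by
    simp only [S_c, map_sum, Derivation.leibniz, H, map_apply, Derivation.map_algebraMap,
      smul_eq_mul, mul_zero, add_zero]
  rw [h]
  refine Rep.sum fun α' _ => Rep.sum fun β' _ => ((rep_const _).mul (rep_const _)).mul ?_
  have h' : (M.J hr).pd 0 μ (M.cF hr α' β' ρ) = (M.J hr).pd 0 α' ((M.J hr).pd 0 β'
      ((M.J hr).pd 0 ρ ((M.J hr).pd 0 μ (M.Fp hr)))) := by
    rw [cF, (M.J hr).pd_comm 0 μ, (M.J hr).pd_comm 0 μ 0 β', (M.J hr).pd_comm 0 μ 0 ρ]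
  rw [h', Fp, pd_pt, pd_pt, pd_pt]
  exact rep_partialD hr _ α'

theorem rep_D_pd (σ : Fin n) : Rep (fun j => ∑ ν, j 1 ν * partialD σ (partialD ν G) (j 0))
    ((M.J hr).D ((M.J hr).pd 0 σ (pt hr hG))) := by
  rw [((isPoint_pt hr hG).pd σ).D]
  refine Rep.sum fun ν _ => (rep_x (M.isJetOpen hr) 1 ν).mul ?_
  rw [(M.J hr).pd_comm]
  exact M.rep_hess hr hG σ ν

theorem rep_q₂ : RepM (M.q₂ G) ((M.S hr).defQ M.expo (pt hr hG)) := by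
  have h1 := ((M.repM_tan_x hr).mul (M.repM_hess hr hG)).mul (M.repM_tan_x hr)
  have h2 : RepM (fun α β j => ∑ ρ, (∑ σ, (∑ ν, j 1 ν * partialD σ (partialD ν G) (j 0))
        * M.c₂ β σ ρ (j 0)) * ∑ μ, j 1 μ * M.c₂ ρ α μ (j 0))
      ((M.S hr).cot (fun σ => (M.J hr).D ((M.J hr).pd 0 σ (pt hr hG)))
        * (M.S hr).tan ((M.J hr).x 1)) := by
    -- The index formula has `α` and `β` in the opposite places. By associativity this matrix
    -- product is symmetric, so its transpose may be represented instead.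
    have e := (M.S hr).cot_mul_tan (fun σ => (M.J hr).D ((M.J hr).pd 0 σ (pt hr hG)))
      ((M.J hr).x 1)
    have e' := transpose_mul ((M.S hr).cot fun σ => (M.J hr).D ((M.J hr).pd 0 σ (pt hr hG)))
      ((M.S hr).tan ((M.J hr).x 1))
    rw [tan_transpose, ← e] at e'
    rw [← e']
    have hc : RepM (fun α ρ j => ∑ σ, (∑ ν, j 1 ν * partialD σ (partialD ν G) (j 0))
        * M.c₂ α σ ρ (j 0)) ((M.S hr).cot fun σ => (M.J hr).D ((M.J hr).pd 0 σ (pt hr hG))) :=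
      fun α ρ => Rep.sum fun σ _ => (M.rep_D_pd hr hG σ).mul (M.rep_c₂ hr α σ ρ)
    exact fun α β => hc.mul (M.repM_tan_x hr) β α
  have h3 : RepM (fun α β j => ∑ ρ, (∑ μ, j 1 μ * M.c₂₂ α β ρ μ (j 0))
        * ∑ σ, (∑ ν, j 1 ν * M.c₂ ρ σ ν (j 0)) * partialD σ G (j 0))
      (Matrix.of fun α β => ∑ ρ, (M.J hr).D ((M.S hr).c α β ρ)
        * ((M.S hr).tan ((M.J hr).x 1) *ᵥ fun σ => (M.J hr).pd 0 σ (pt hr hG)) ρ) :=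
    fun α β => Rep.sum fun ρ _ => by
      have e : (M.J hr).D ((M.S hr).c α β ρ)
          = ∑ μ, (M.J hr).x 1 μ * (M.J hr).pd 0 μ ((M.S hr).c α β ρ) :=
        (((M.S hr).point α β).pd ρ).D
      rw [e]
      exact (Rep.sum fun μ _ => (rep_x _ 1 μ).mul (M.rep_c₂₂ hr α β ρ μ)).mul
        (Rep.dotProduct (M.repM_tan_x hr ρ) fun σ => rep_partialD hr hG σ)
  refine (((h1.sub h2).add h3).mul_diag _).congr fun α β j hj => ?_
  rw [q₂, expo]
  refine congrArg _ ?_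
  simp only [sub_mul, add_mul, Finset.sum_sub_distrib, Finset.sum_add_distrib, Finset.sum_mul,
    Finset.mul_sum]
  refine congrArg₂ (· + ·) (congrArg₂ (· - ·) ?_ ?_) ?_
  · refine Finset.sum_comm.trans (Finset.sum_congr rfl fun ρ _ => ?_)
    refine (Finset.sum_congr rfl fun σ _ => Finset.sum_comm).trans (Finset.sum_comm.trans ?_)
    refine Finset.sum_congr rfl fun ν _ => Finset.sum_congr rfl fun σ _ =>
      Finset.sum_congr rfl fun μ _ => ?_
    rw [M.c₂_symm β ρ hr hj]; ring
  · refine Finset.sum_comm.trans (Finset.sum_congr rfl fun ρ _ => Finset.sum_comm.trans ?_)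
    refine Finset.sum_congr rfl fun μ _ => Finset.sum_congr rfl fun σ _ =>
      Finset.sum_congr rfl fun ν _ => ?_
    ring
  · refine Finset.sum_comm.trans (Finset.sum_congr rfl fun ρ _ => ?_)
    refine Finset.sum_congr rfl fun σ _ => Finset.sum_comm.trans ?_
    refine Finset.sum_congr rfl fun ν _ => Finset.sum_congr rfl fun μ _ => ?_
    ring

theorem rep_e₂ : RepM (M.e₂ G) ((M.S hr).defE (M.eulerW hr) M.expo (pt hr hG)) :=
  (((M.rep_q₂ hr hG).add (M.rep_q₂ hr hG).transpose).add
    ((M.rep_b₂ hr hG).matD_D (M.isJetOpen hr))).sub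
      (((M.rep_a₂ hr hG).matD_D (M.isJetOpen hr)).matD_D (M.isJetOpen hr))

theorem rep_a₁ : RepM (M.a₁ G) ((M.S hr).defA M.unitW (pt hr hG)) := by
  refine ((M.repM_cot hr hG).mul (M.repM_unit hr)).two_mul.congr fun α β j hj => ?_
  simp only [a₁, Finset.sum_mul, c₂, c₃, Finset.mul_sum]
  refine (Finset.sum_congr rfl fun μ _ => Finset.sum_comm).trans (Finset.sum_comm.trans ?_)
  refine Finset.sum_congr rfl fun β' _ => Finset.sum_congr rfl fun μ _ =>
    Finset.sum_congr rfl fun α' _ => Finset.sum_congr rfl fun γ' _ => ?_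
  rw [(M.rep_c₀ hr α' β' γ').eq (f' := fun j => M.c₀ α' γ' β' (j 0))
      (by rw [M.cF_comm₂ hr]; exact M.rep_c₀ hr α' γ' β') hj, M.η_symm.apply β β']
  ring

theorem defQ_zero (G : DF M.Ω) : (M.S hr).defQ 0 G = 0 := by
  rw [defQ, diag_zero, mul_zero]

theorem rep_b₁ : RepM (M.b₁ G) ((M.S hr).defB M.unitW 0 (pt hr hG)) := by
  have hCH := (M.repM_tan_x hr).mul (M.repM_hess hr hG)
  have hcC := (M.repM_cot hr hG).mul (M.repM_tan_x hr)
  refine ((((M.rep_a₁ hr hG).matD_D (M.isJetOpen hr)).smul (3 / 2)).add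
    (((hCH.mul (M.repM_unit hr)).sub ((M.repM_unit hr).mul hCH.transpose)).add
      ((hcC.mul_diag _).sub (hcC.diag_mul _)))).congr fun α β j hj => ?_
  simp only [b₁]
  refine congrArg _ ?_
  simp only [Pi.zero_apply, zero_mul, sub_self, add_zero, sub_mul, mul_sub, Finset.sum_sub_distrib, Finset.sum_mul,
    Finset.mul_sum]
  refine congrArg₂ (· - ·) ?_ ?_
  · rw [Finset.sum_comm]
    refine Finset.sum_congr rfl fun ρ _ => Finset.sum_congr rfl fun σ _ =>
      Finset.sum_congr rfl fun μ _ => ?_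
    rw [M.η_symm.apply β ρ]; ring
  · rw [Finset.sum_comm]
    refine Finset.sum_congr rfl fun ρ _ => Finset.sum_congr rfl fun σ _ =>
      Finset.sum_congr rfl fun μ _ => ?_
    ring

theorem rep_e₁ : RepM (M.e₁ G) ((M.S hr).defE M.unitW 0 (pt hr hG)) := by
  rw [defE, defQ_zero, transpose_zero, add_zero, zero_add]
  exact ((M.rep_b₁ hr hG).matD_D (M.isJetOpen hr)).sub
      (((M.rep_a₁ hr hG).matD_D (M.isJetOpen hr)).matD_D (M.isJetOpen hr))

theorem repOp_coeffs {P₀ P₁ P₂ P₃ : Fin n → Fin n → Jet 𝕜 n → 𝕜}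
    {A₀ A₁ A₂ A₃ : Matrix (Fin n) (Fin n) (DF M.Ω)} (h₀ : RepM P₀ A₀) (h₁ : RepM P₁ A₁)
    (h₂ : RepM P₂ A₂) (h₃ : RepM P₃ A₃) :
    RepOp (Coeffs.op ![P₀, P₁, P₂, P₃]) fun ψ => A₃ *ᵥ (M.J hr).opD ((M.J hr).opD ((M.J hr).opD ψ))
      + A₂ *ᵥ (M.J hr).opD ((M.J hr).opD ψ) + A₁ *ᵥ (M.J hr).opD ψ + A₀ *ᵥ ψ := fun ψ ψ' h α => by
  have hd := fun s β => (h β).iterate_DX (M.isJetOpen hr) s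
  refine ((((Rep.dotProduct (h₃ α) (hd 3)).add (Rep.dotProduct (h₂ α) (hd 2))).add
    (Rep.dotProduct (h₁ α) (hd 1))).add (Rep.dotProduct (h₀ α) (hd 0))).congr fun j _ => ?_
  rw [Coeffs.op, Fin.sum_univ_four]
  change (∑ β, P₀ α β j * DX^[0] (ψ β) j) + (∑ β, P₁ α β j * DX^[1] (ψ β) j)
    + (∑ β, P₂ α β j * DX^[2] (ψ β) j) + (∑ β, P₃ α β j * DX^[3] (ψ β) j) = _
  ring

theorem repOp_bracket₁'' : RepOp (M.bracket₁'' G).op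
    ((M.J hr).deform ((M.J hr).opD ((M.S hr).gen (pt hr hG))) (M.P₁ hr)) := by
  have h := M.repOp_coeffs hr (A₀ := 0) (fun _ _ => rep_zero) (M.rep_e₁ hr hG) (M.rep_b₁ hr hG)
    (M.rep_a₁ hr hG)
  intro ψ ψ' hψ α
  have e := deform_bracket (M.S hr) (M.compat_unitW hr) (isPoint_pt hr hG) ψ'
  rw [defQ_zero] at e
  have z : matD (M.J hr).D (0 : Matrix (Fin n) (Fin n) (DF M.Ω)) = 0 :=
    Matrix.ext fun _ _ => map_zero (M.J hr).D
  rw [P₁, e, z]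
  exact h ψ ψ' hψ α

theorem repOp_bracket₂'' : RepOp (M.bracket₂'' G).op
    ((M.J hr).deform ((M.J hr).opD ((M.S hr).gen (pt hr hG))) (M.P₂ hr)) := by
  have h := M.repOp_coeffs hr ((M.rep_q₂ hr hG).matD_D (M.isJetOpen hr)) (M.rep_e₂ hr hG)
    (M.rep_b₂ hr hG) (M.rep_a₂ hr hG)
  intro ψ ψ' hψ α
  rw [P₂, deform_bracket (M.S hr) (M.compat_eulerW hr) (isPoint_pt hr hG) ψ']
  exact h ψ ψ' hψ α

end FrobeniusManifold
end OneLoop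
-- Additivity of the deformation and the splitting of the transform
namespace OneLoop
open Matrix

namespace JetAlgebra

variable {𝕜 ι 𝒜 : Type*} [Field 𝕜] [DecidableEq ι] [CommRing 𝒜] [Algebra 𝕜 𝒜] [Fintype ι]
  (J : JetAlgebra 𝕜 ι 𝒜)

/-- The defining sums for `w`, `u` and `w + u` have unrelated ranges; integrating against a test
field avoids comparing them. -/
theorem add_adjLin [CharZero 𝕜] (w u φ : ι → 𝒜) :
    J.adjLin (w + u) φ = J.adjLin w φ + J.adjLin u φ := by
  refine J.eq_of_int_dotProduct fun χ => ?_
  rw [dotProduct_add, map_add, J.int_adjLin, J.int_adjLin, J.int_adjLin, ← map_add,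
    ← dotProduct_add]
  exact congrArg (fun v => J.int (φ ⬝ᵥ v)) (J.prV_add χ w u)

theorem add_deform [CharZero 𝕜] (P : (ι → 𝒜) →ₗ[𝕜] ι → 𝒜) (w u ψ : ι → 𝒜) :
    J.deform (w + u) P ψ = J.deform w P ψ + J.deform u P ψ := by
  simp only [deform, lieCov, lieVec, add_prV, prV_add, add_adjLin, map_add]
  abel

theorem prV_smul (K X : ι → 𝒜) (a : 𝕜) : J.prV K (a • X) = a • J.prV K X :=
  funext fun _ => Derivation.map_smul _ _ _

theorem smul_prV (K X : ι → 𝒜) (a : 𝕜) : J.prV (a • K) X = a • J.prV K X :=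
  funext fun _ => J.pr_smul _ _ _

theorem deform_add (w : ι → 𝒜) (P Q : (ι → 𝒜) →ₗ[𝕜] ι → 𝒜) (ψ : ι → 𝒜) :
    J.deform w ⇑(P + Q) ψ = J.deform w P ψ + J.deform w Q ψ := by
  simp only [deform, lieVec, add_prV, prV_add, LinearMap.add_apply]
  abel

theorem deform_smul (w : ι → 𝒜) (a : 𝕜) (P : (ι → 𝒜) →ₗ[𝕜] ι → 𝒜) (ψ : ι → 𝒜) :
    J.deform w ⇑(a • P) ψ = a • J.deform w P ψ := by
  simp only [deform, lieVec, smul_prV, prV_smul, LinearMap.smul_apply, smul_sub]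

end JetAlgebra

namespace FrobeniusManifold
open JetAlgebra JetAlgebra.ProductData

variable {𝕜 : Type*} [RCLike 𝕜] {n : ℕ} [NeZero n] {r : WithTop ℕ∞}
  (M : FrobeniusManifold 𝕜 n r) (hr : ∞ ≤ r) {G : (Fin n → 𝕜) → 𝕜} (hG : ContDiffOn 𝕜 r G M.U)
  {θ : Fin n → ℕ → (Fin n → 𝕜) → 𝕜} (hθ : M.IsDeformedFlat θ)

variable {M} in
/-- The functions `θ_{β,p}` as differential functions. -/
def θp (β : Fin n) (p : ℕ) : DF M.Ω := pt hr (hθ.contDiffOn β p)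

variable {M} in
theorem pd_pd_θp (γ : Fin n) (p : ℕ) (α β : Fin n) :
    (M.J hr).pd 0 α ((M.J hr).pd 0 β (θp hr hθ γ (p + 1)))
      = ∑ ρ, (∑ α', M.H ρ α' * M.cF hr α' α β) * (M.J hr).pd 0 ρ (θp hr hθ γ p) := by
  refine Rep.ext (M.rep_hess hr (hθ.contDiffOn γ (p + 1)) α β)
    (Rep.congr (Rep.sum fun ρ _ => (Rep.sum fun α' _ => (rep_const _).mul
      (M.rep_c₀ hr α' α β)).mul (rep_partialD hr (hθ.contDiffOn γ p) ρ)) fun j hj => ?_)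
  exact hθ.succ γ p α β _ hj.1

variable {M} in
theorem pd_θp_zero (γ α : Fin n) : (M.J hr).pd 0 α (θp hr hθ γ 0) = M.Hi γ α := by
  have h : θp hr hθ γ 0 = ∑ ε, algebraMap 𝕜 (DF M.Ω) (M.η⁻¹ γ ε) * (M.J hr).x 0 ε :=
    Rep.ext (rep_pt hr (hθ.contDiffOn γ 0)) ((Rep.sum fun ε _ => (rep_const _).mul
      (rep_x _ 0 ε)).congr fun j hj => hθ.zero γ _ hj.1)
  rw [h]
  simp [(M.J hr).pd_x, Hi]

variable {M} in
/-- The flows of the genus zero hierarchy on differential functions. -/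
def Kp (β : Fin n) (p : ℕ) : Fin n → DF M.Ω :=
  M.P₁ hr fun γ => (M.J hr).pd 0 γ (θp hr hθ β (p + 1))

theorem rep_K₀ (β : Fin n) (p : ℕ) (α : Fin n) : Rep (M.K₀ θ β p α) (Kp hr hθ β p α) := by
  have e : Kp hr hθ β p α
      = (M.J hr).D (∑ γ, M.H α γ * (M.J hr).pd 0 γ (θp hr hθ β (p + 1))) := by
    rw [Kp, P₁_apply, mulVec, dotProduct, map_sum]
    refine Finset.sum_congr rfl fun γ _ => ?_
    simp [H, opD_apply]
  rw [e]
  exact (Rep.sum fun γ _ => (rep_const _).mul (rep_partialD hr _ γ)).DX _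

variable {M} in
-- The recursion for `θ` trades second derivatives at level `p + 1` for first derivatives at level
-- `p`. Each genus zero flow is therefore multiplication by `t_X` applied to `dθ_{β,p}`, the same
-- construction `gen` that is applied to `G`.
theorem P₁_grad_succ (β : Fin n) (p : ℕ) :
    M.P₁ hr (fun γ => (M.J hr).pd 0 γ (θp hr hθ β (p + 1))) = (M.S hr).gen (θp hr hθ β p) := by
  funext α
  simp only [P₁_apply, gen, mulVec, dotProduct, opD_apply, tan, of_apply,
    ((isPoint_pt hr (hθ.contDiffOn β (p + 1))).pd _).D, θp]
  change ∑ γ, M.H α γ * ∑ δ, (M.J hr).x 1 δ * (M.J hr).pd 0 δ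
    ((M.J hr).pd 0 γ (θp hr hθ β (p + 1))) = _
  simp only [pd_pd_θp, S_c, Finset.sum_mul, Finset.mul_sum]
  refine Finset.sum_comm.trans ((Finset.sum_congr rfl fun δ _ => Finset.sum_comm).trans
    (Finset.sum_comm.trans ?_))
  refine Finset.sum_congr rfl fun ρ _ => Finset.sum_congr rfl fun δ _ =>
    Finset.sum_congr rfl fun γ _ => Finset.sum_congr rfl fun α' _ => ?_
  rw [M.cF_comm₁ hr γ, M.cF_comm₂ hr α' γ]
  simp only [θp]; ring

theorem rep_detM : Rep M.detM
    (Matrix.of fun α β => ∑ γ, M.cF hr α β γ * (M.J hr).x 1 γ).det := by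
  have h : ∀ α β, Rep (fun j : Jet 𝕜 n => ∑ γ, M.c₀ α β γ (j 0) * j 1 γ)
      (∑ γ, M.cF hr α β γ * (M.J hr).x 1 γ) := fun α β =>
    Rep.sum fun γ _ => (M.rep_c₀ hr α β γ).mul (rep_x _ 1 γ)
  intro j
  refine Eq.trans ?_ (RingHom.map_det
    ((Pi.evalRingHom (fun _ : M.Ω => 𝕜) j).comp (DF M.Ω).val.toRingHom) _).symm
  exact congrArg Matrix.det (Matrix.ext fun α β => h α β j)

/-- The gradient of `θ_{β,0}` is constant, so `∂G/∂T^{β,0}` is `η⁻¹` applied to `gen` of `G`;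
raising the index leaves `∂_X` of `gen`. The first summand is chosen before `G`, which is all that
is needed of the logarithmic term. -/
theorem exists_rep_w (hθ : M.IsDeformedFlat θ) : ∃ wb : Fin n → DF M.Ω, ∀ {G : (Fin n → 𝕜) → 𝕜}
    (hG : ContDiffOn 𝕜 r G M.U) (α : Fin n),
    Rep (M.w θ G α) (wb α + (M.J hr).opD ((M.S hr).gen (pt hr hG)) α) := by
  obtain ⟨i, hi⟩ := ((M.rep_detM hr).isDiffFun.inv fun j hj => hj.2).exists_rep
  refine ⟨fun α => ∑ β, M.H α β * (M.J hr).D ((1 / 24 : 𝕜) • ((M.J hr).pr (Kp hr hθ β 0)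
    (Matrix.of fun α β => ∑ γ, M.cF hr α β γ * (M.J hr).x 1 γ).det * i)), fun {G} hG α => ?_⟩
  have h : (∑ β, M.H α β * (M.J hr).D ((1 / 24 : 𝕜) • ((M.J hr).pr (Kp hr hθ β 0)
        (Matrix.of fun α β => ∑ γ, M.cF hr α β γ * (M.J hr).x 1 γ).det * i)))
        + (M.J hr).opD ((M.S hr).gen (pt hr hG)) α
      = ∑ β, M.H α β * (M.J hr).D ((1 / 24 : 𝕜) • ((M.J hr).pr (Kp hr hθ β 0)
        (Matrix.of fun α β => ∑ γ, M.cF hr α β γ * (M.J hr).x 1 γ).det * i)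
        + (M.J hr).pr (Kp hr hθ β 0) (pt hr hG)) := by
    simp only [map_add, mul_add, Finset.sum_add_distrib]
    refine congrArg _ ?_
    have hf : (fun β => (M.J hr).pr (Kp hr hθ β 0) (pt hr hG))
        = (M.Hi * (M.S hr).tan ((M.J hr).x 1)) *ᵥ fun γ => (M.J hr).pd 0 γ (pt hr hG) := by
      funext β
      rw [(isPoint_pt hr hG).pr, mulVec, dotProduct]
      refine Finset.sum_congr rfl fun γ _ => congrArg (· * _) ?_
      rw [Kp, P₁_grad_succ, gen, Matrix.mul_apply, mulVec, dotProduct]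
      refine Finset.sum_congr rfl fun ρ _ => ?_
      have ht := congrFun (congrFun ((M.S hr).tan_transpose ((M.J hr).x 1)) γ) ρ
      rw [pd_θp_zero, ← ht, transpose_apply, mul_comm]
    have hH : (M.J hr).opD ((M.S hr).gen (pt hr hG)) = M.H *ᵥ (M.J hr).opD
        (fun β => (M.J hr).pr (Kp hr hθ β 0) (pt hr hG)) := by
      have e := opD_mulVec (J := M.J hr) M.H fun β => (M.J hr).pr (Kp hr hθ β 0) (pt hr hG)
      rw [matD_H, zero_mulVec, zero_add] at e
      rw [← e, hf, mulVec_mulVec, ← Matrix.mul_assoc, H_mul_Hi, Matrix.one_mul, gen]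
    rw [hH]
    rfl
  rw [h]
  refine Rep.sum fun β _ => (rep_const _).mul (Rep.DX _ ?_)
  have h1 := ((M.rep_detM hr).pr (M.isJetOpen hr) (M.rep_K₀ hr hθ β 0)).mul hi
  exact ((h1.const_mul (1 / 24)).congr fun j _ => by simp only [div_eq_mul_inv]).add
    ((rep_pt hr hG).pr (M.isJetOpen hr) (M.rep_K₀ hr hθ β 0))

end FrobeniusManifold
end OneLoop
-- Homogeneous differential polynomials
namespace OneLoop
open Matrix

section IsDiffPoly

variable {𝕜 : Type*} [RCLike 𝕜] {n : ℕ} {r : WithTop ℕ∞} {U : Set (Fin n → 𝕜)}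
  {Ω : Set (Jet 𝕜 n)} {f g : Jet 𝕜 n → 𝕜}

theorem IsDiffPoly.congr : ∀ {k : ℕ}, IsDiffPoly r U Ω k f → (∀ j ∈ Ω, g j = f j) →
    IsDiffPoly r U Ω k g
  | 0, ⟨a, ha, h⟩, e => ⟨a, ha, fun j hj => (e j hj).trans (h j hj)⟩
  | 1, ⟨a, ha, h⟩, e => ⟨a, ha, fun j hj => (e j hj).trans (h j hj)⟩
  | 2, ⟨a, b, ha, hb, h⟩, e => ⟨a, b, ha, hb, fun j hj => (e j hj).trans (h j hj)⟩
  | 3, ⟨a, b, c, ha, hb, hc, h⟩, e =>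
    ⟨a, b, c, ha, hb, hc, fun j hj => (e j hj).trans (h j hj)⟩

theorem IsDiffPoly.add : ∀ {k : ℕ}, IsDiffPoly r U Ω k f → IsDiffPoly r U Ω k g →
    IsDiffPoly r U Ω k (fun j => f j + g j)
  | 0, ⟨a, ha, h⟩, ⟨a', ha', h'⟩ => ⟨fun t => a t + a' t, ha.add ha', fun j hj => by
      beta_reduce
      rw [h j hj, h' j hj]⟩
  | 1, ⟨a, ha, h⟩, ⟨a', ha', h'⟩ => ⟨fun l t => a l t + a' l t, fun l => (ha l).add (ha' l),
      fun j hj => by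
        beta_reduce
        rw [h j hj, h' j hj]
        simp only [add_mul, Finset.sum_add_distrib]⟩
  | 2, ⟨a, b, ha, hb, h⟩, ⟨a', b', ha', hb', h'⟩ =>
    ⟨fun l t => a l t + a' l t, fun l m t => b l m t + b' l m t, fun l => (ha l).add (ha' l),
      fun l m => (hb l m).add (hb' l m), fun j hj => by
        beta_reduce
        rw [h j hj, h' j hj]
        simp only [add_mul, Finset.sum_add_distrib]
        ring⟩
  | 3, ⟨a, b, c, ha, hb, hc, h⟩, ⟨a', b', c', ha', hb', hc', h'⟩ =>
    ⟨fun l t => a l t + a' l t, fun l m t => b l m t + b' l m t,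
      fun l m k t => c l m k t + c' l m k t, fun l => (ha l).add (ha' l),
      fun l m => (hb l m).add (hb' l m), fun l m k => (hc l m k).add (hc' l m k), fun j hj => by
        beta_reduce
        rw [h j hj, h' j hj]
        simp only [add_mul, Finset.sum_add_distrib]
        ring⟩

theorem IsDiffPoly.zero_mul : ∀ {k : ℕ}, IsDiffPoly r U Ω 0 f → IsDiffPoly r U Ω k g →
    IsDiffPoly r U Ω k (fun j => f j * g j)
  | 0, ⟨a, ha, h⟩, ⟨a', ha', h'⟩ => ⟨fun t => a t * a' t, ha.mul ha', fun j hj => by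
      beta_reduce
      rw [h j hj, h' j hj]⟩
  | 1, ⟨a, ha, h⟩, ⟨a', ha', h'⟩ => ⟨fun l t => a t * a' l t, fun l => ha.mul (ha' l),
      fun j hj => by
        beta_reduce
        rw [h j hj, h' j hj]
        simp only [Finset.mul_sum, mul_assoc]⟩
  | 2, ⟨a, ha, h⟩, ⟨a', b', ha', hb', h'⟩ =>
    ⟨fun l t => a t * a' l t, fun l m t => a t * b' l m t, fun l => ha.mul (ha' l),
      fun l m => ha.mul (hb' l m), fun j hj => by
        beta_reduce
        rw [h j hj, h' j hj]
        simp only [mul_add, Finset.mul_sum, mul_assoc]⟩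
  | 3, ⟨a, ha, h⟩, ⟨a', b', c', ha', hb', hc', h'⟩ =>
    ⟨fun l t => a t * a' l t, fun l m t => a t * b' l m t, fun l m k t => a t * c' l m k t,
      fun l => ha.mul (ha' l), fun l m => ha.mul (hb' l m), fun l m k => ha.mul (hc' l m k),
      fun j hj => by
        beta_reduce
        rw [h j hj, h' j hj]
        simp only [mul_add, Finset.mul_sum, mul_assoc]⟩

theorem IsDiffPoly.one_mul_one : IsDiffPoly r U Ω 1 f → IsDiffPoly r U Ω 1 g →
    IsDiffPoly r U Ω 2 (fun j => f j * g j)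
  | ⟨a, ha, h⟩, ⟨a', ha', h'⟩ => ⟨fun _ _ => 0, fun l m t => a l t * a' m t,
      fun _ => contDiffOn_const, fun l m => (ha l).mul (ha' m), fun j hj => by
        beta_reduce
        rw [h j hj, h' j hj, Finset.sum_mul_sum]
        simp only [MulZeroClass.zero_mul, Finset.sum_const_zero, zero_add]
        exact Finset.sum_congr rfl fun l _ => Finset.sum_congr rfl fun m _ => by ring⟩

theorem IsDiffPoly.two_mul_one : IsDiffPoly r U Ω 2 f → IsDiffPoly r U Ω 1 g →
    IsDiffPoly r U Ω 3 (fun j => f j * g j)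
  | ⟨a, b, ha, hb, h⟩, ⟨a', ha', h'⟩ => ⟨fun _ _ => 0, fun l m t => a l t * a' m t,
      fun l m k t => b l m t * a' k t,
      fun _ => contDiffOn_const, fun l m => (ha l).mul (ha' m),
      fun l m k => (hb l m).mul (ha' k), fun j hj => by
        beta_reduce
        rw [h j hj, h' j hj, add_mul, Finset.sum_mul_sum]
        simp only [MulZeroClass.zero_mul, Finset.sum_const_zero, zero_add, Finset.sum_mul,
          Finset.mul_sum]
        refine congrArg₂ (· + ·) ?_ ?_
        · exact Finset.sum_congr rfl fun l _ => Finset.sum_congr rfl fun m _ => by ring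
        · refine Finset.sum_comm.trans (Finset.sum_congr rfl fun l _ => Finset.sum_comm.trans ?_)
          exact Finset.sum_congr rfl fun m _ => Finset.sum_congr rfl fun k _ => by ring⟩

theorem IsDiffPoly.mul {k l : ℕ} (hkl : k + l ≤ 3) (h : IsDiffPoly r U Ω k f)
    (h' : IsDiffPoly r U Ω l g) : IsDiffPoly r U Ω (k + l) (fun j => f j * g j) := by
  have hc : ∀ j ∈ Ω, f j * g j = g j * f j := fun j _ => mul_comm _ _
  have h4 : ∀ k l, k + l ≤ 3 → k = 0 ∨ l = 0 ∨ (k = 1 ∧ l = 1) ∨ (k = 2 ∧ l = 1)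
    ∨ (k = 1 ∧ l = 2) := by omega
  rcases h4 k l hkl with rfl | rfl | ⟨rfl, rfl⟩ | ⟨rfl, rfl⟩ | ⟨rfl, rfl⟩
  · rw [zero_add]; exact h.zero_mul h'
  · exact (h'.zero_mul h).congr hc
  · exact h.one_mul_one h'
  · exact h.two_mul_one h'
  · exact (h'.two_mul_one h).congr hc

theorem isDiffPoly_zero : ∀ {k : ℕ}, k ≤ 3 → IsDiffPoly r U Ω k fun _ => 0
  | 0, _ => ⟨fun _ => 0, contDiffOn_const, fun _ _ => rfl⟩
  | 1, _ => ⟨fun _ _ => 0, fun _ => contDiffOn_const, fun _ _ => by simp⟩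
  | 2, _ => ⟨fun _ _ => 0, fun _ _ _ => 0, fun _ => contDiffOn_const, fun _ _ => contDiffOn_const,
      fun _ _ => by simp⟩
  | 3, _ => ⟨fun _ _ => 0, fun _ _ _ => 0, fun _ _ _ _ => 0, fun _ => contDiffOn_const,
      fun _ _ => contDiffOn_const, fun _ _ _ => contDiffOn_const, fun _ _ => by simp⟩

theorem isDiffPoly_coord : ∀ {s : ℕ}, s + 1 ≤ 3 → ∀ γ : Fin n,
    IsDiffPoly r U Ω (s + 1) fun j => j (s + 1) γ
  | 0, _, γ => ⟨Pi.single γ fun _ => 1, fun l => by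
      by_cases h : l = γ <;> simp [h, contDiffOn_const, Pi.zero_def], fun j _ => by
      simp [Pi.single_apply, ite_apply]⟩
  | 1, _, γ => ⟨Pi.single γ fun _ => 1, fun _ _ _ => 0, fun l => by
      by_cases h : l = γ <;> simp [h, contDiffOn_const, Pi.zero_def],
      fun _ _ => contDiffOn_const, fun j _ => by
      simp [Pi.single_apply, ite_apply]⟩
  | 2, _, γ => ⟨Pi.single γ fun _ => 1, fun _ _ _ => 0, fun _ _ _ _ => 0, fun l => by
      by_cases h : l = γ <;> simp [h, contDiffOn_const, Pi.zero_def],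
      fun _ _ => contDiffOn_const, fun _ _ _ => contDiffOn_const, fun j _ => by
      simp [Pi.single_apply, ite_apply]⟩

theorem isDiffPoly_const (c : 𝕜) : IsDiffPoly r U Ω 0 fun _ => c :=
  ⟨fun _ => c, contDiffOn_const, fun _ _ => rfl⟩

theorem IsDiffPoly.const_mul {k : ℕ} (c : 𝕜) (h : IsDiffPoly r U Ω k f) :
    IsDiffPoly r U Ω k fun j => c * f j := (isDiffPoly_const c).zero_mul h

theorem IsDiffPoly.sub {k : ℕ} (h : IsDiffPoly r U Ω k f) (h' : IsDiffPoly r U Ω k g) :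
    IsDiffPoly r U Ω k fun j => f j - g j :=
  (h.add (h'.const_mul (-1))).congr fun j _ => by ring

theorem isDiffPoly_iff_of_sub {k : ℕ} (h : IsDiffPoly r U Ω k fun j => f j - g j) :
    IsDiffPoly r U Ω k f ↔ IsDiffPoly r U Ω k g :=
  ⟨fun hf => (hf.sub h).congr fun j _ => by ring, fun hg => (hg.add h).congr fun j _ => by ring⟩

end IsDiffPoly

namespace FrobeniusManifold
open JetAlgebra JetAlgebra.ProductData

variable {𝕜 : Type*} [RCLike 𝕜] {n : ℕ} [NeZero n] {r : WithTop ℕ∞}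
  {M : FrobeniusManifold 𝕜 n r} (hr : ∞ ≤ r)

/-- Homogeneous differential polynomials in the algebra of differential functions. -/
inductive IsHomog : ℕ → DF M.Ω → Prop
  | pt {a : (Fin n → 𝕜) → 𝕜} (ha : ContDiffOn 𝕜 r a M.U) : IsHomog 0 (pt hr ha)
  | x (s : ℕ) (γ : Fin n) : IsHomog (s + 1) ((M.J hr).x (s + 1) γ)
  | zero (k : ℕ) : IsHomog k 0
  | add {k : ℕ} {f g : DF M.Ω} : IsHomog k f → IsHomog k g → IsHomog k (f + g)
  | mul {k l : ℕ} {f g : DF M.Ω} : IsHomog k f → IsHomog l g → IsHomog (k + l) (f * g)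

variable {hr} {f g : DF M.Ω}

theorem IsHomog.sum {κ : Type*} {s : Finset κ} {k : ℕ} {f : κ → DF M.Ω}
    (h : ∀ i ∈ s, IsHomog hr k (f i)) : IsHomog hr k (∑ i ∈ s, f i) := by
  classical
  induction s using Finset.induction_on with
  | empty => exact .zero _
  | insert i s hi ih =>
    rw [Finset.sum_insert hi]
    exact .add (h i (Finset.mem_insert_self _ _)) (ih fun i' hi' => h i' (Finset.mem_insert_of_mem hi'))

theorem IsHomog.mul' {k l m : ℕ} (h : IsHomog hr k f) (h' : IsHomog hr l g) (e : m = k + l) :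
    IsHomog hr m (f * g) := e ▸ h.mul h'

variable (hr) in
theorem isHomog_const (c : 𝕜) : IsHomog (M := M) hr 0 (algebraMap 𝕜 _ c) :=
  IsHomog.pt (a := fun _ => c) contDiffOn_const

theorem IsHomog.smul {k : ℕ} (c : 𝕜) (h : IsHomog hr k f) : IsHomog hr k (c • f) := by
  rw [Algebra.smul_def]; exact (isHomog_const hr c).mul' h (zero_add _).symm

theorem IsHomog.sub {k : ℕ} (h : IsHomog hr k f) (h' : IsHomog hr k g) :
    IsHomog hr k (f - g) := by
  have := h.add (h'.smul (-1))
  rwa [neg_one_smul, ← sub_eq_add_neg] at this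

theorem isHomog_pd_pt {a : (Fin n → 𝕜) → 𝕜} (ha : ContDiffOn 𝕜 r a M.U) (γ : Fin n) :
    IsHomog hr 0 ((M.J hr).pd 0 γ (FrobeniusManifold.pt hr ha)) := by
  rw [pd_pt]; exact .pt _

theorem IsHomog.D {k : ℕ} (h : IsHomog hr k f) : IsHomog hr (k + 1) ((M.J hr).D f) := by
  induction h with
  | pt ha =>
    rw [(isPoint_pt hr ha).D]
    exact .sum fun γ _ => (IsHomog.x 0 γ).mul' (isHomog_pd_pt ha γ) rfl
  | x s γ => rw [(M.J hr).D_x]; exact .x (s + 1) γ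
  | zero k => rw [map_zero]; exact .zero _
  | add _ _ h h' => rw [map_add]; exact h.add h'
  | mul h₁ h₁' h h' =>
    rw [Derivation.leibniz]
    exact (h₁.mul' h' (by ring)).add (h₁'.mul' h (by ring))

theorem IsHomog.iterate_D {k : ℕ} (h : IsHomog hr k f) (s : ℕ) :
    IsHomog hr (k + s) ((M.J hr).D^[s] f) := by
  induction s with
  | zero => exact h
  | succ s ih => rw [Function.iterate_succ_apply']; exact ih.D

/-- On a generator `x (s + 1) γ` the result is `D^[s + 1] (K γ)`, of degree `m + s + 1`; the other
cases follow from the Leibniz rule. -/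
theorem IsHomog.pr {k m : ℕ} (h : IsHomog hr k f) {K : Fin n → DF M.Ω}
    (hK : ∀ γ, IsHomog hr m (K γ)) : IsHomog hr (k + m) ((M.J hr).pr K f) := by
  induction h with
  | pt ha =>
    rw [(isPoint_pt hr ha).pr]
    exact .sum fun γ _ => (hK γ).mul' (isHomog_pd_pt ha γ) (by ring)
  | x s γ =>
    have e : (M.J hr).pr K ((M.J hr).x (s + 1) γ) = (M.J hr).D^[s + 1] (K γ) := (M.J hr).vf_x _ _ _
    rw [e, add_comm]
    exact (hK γ).iterate_D (s + 1)
  | zero k => rw [map_zero]; exact .zero _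
  | add _ _ h h' => rw [map_add]; exact h.add h'
  | mul h₁ h₁' h h' =>
    rw [Derivation.leibniz]
    exact (h₁.mul' h' (by ring)).add (h₁'.mul' h (by ring))

/-- The inductive predicate is closed under the needed operations in all degrees; the explicit
normal form exists only up to degree 3. The bound passes from a product to its factors, so the
induction can carry it as a hypothesis. -/
theorem IsHomog.isDiffPoly {k : ℕ} (h : IsHomog hr k f) :
    k ≤ 3 → ∀ {f' : Jet 𝕜 n → 𝕜}, Rep f' f → IsDiffPoly r M.U M.Ω k f' := by
  have key : k ≤ 3 → IsDiffPoly r M.U M.Ω k (lift f) := by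
    induction h with
    | pt ha => exact fun _ => ⟨_, ha, fun j hj => (rep_lift _).eq (rep_pt hr ha) hj⟩
    | x s γ => exact fun hs => (isDiffPoly_coord hs γ).congr fun j hj =>
        (rep_lift _).eq (rep_x (M.isJetOpen hr) (s + 1) γ) hj
    | zero k => exact fun hk => (isDiffPoly_zero hk).congr fun j hj => (rep_lift _).eq rep_zero hj
    | add _ _ h h' => exact fun hk => ((h hk).add (h' hk)).congr fun j hj =>
        (rep_lift _).eq ((rep_lift _).add (rep_lift _)) hj
    | mul _ _ h h' => exact fun hk => ((h (by omega)).mul hk (h' (by omega))).congr fun j hj =>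
        (rep_lift _).eq ((rep_lift _).mul (rep_lift _)) hj
  exact fun hk f' hf => (key hk).congr fun j hj => hf.eq (rep_lift _) hj

section matrices

variable (hr) in
/-- All entries are homogeneous differential polynomials. -/
def IsHomogM (k : ℕ) (A : Matrix (Fin n) (Fin n) (DF M.Ω)) : Prop := ∀ α β, IsHomog hr k (A α β)

variable {A B : Matrix (Fin n) (Fin n) (DF M.Ω)} {k l : ℕ}

theorem IsHomogM.mul (h : IsHomogM hr k A) (h' : IsHomogM hr l B) :
    IsHomogM hr (k + l) (A * B) := fun α β =>
  IsHomog.sum (s := Finset.univ) fun γ _ => (h α γ).mul (h' γ β)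

theorem IsHomogM.add (h : IsHomogM hr k A) (h' : IsHomogM hr k B) :
    IsHomogM hr k (A + B) := fun α β => (h α β).add (h' α β)

theorem IsHomogM.sub (h : IsHomogM hr k A) (h' : IsHomogM hr k B) :
    IsHomogM hr k (A - B) := fun α β => (h α β).sub (h' α β)

theorem IsHomogM.smul (c : 𝕜) (h : IsHomogM hr k A) : IsHomogM hr k (c • A) :=
  fun α β => (h α β).smul c

theorem IsHomogM.transpose (h : IsHomogM hr k A) : IsHomogM hr k Aᵀ := fun α β => h β α

theorem IsHomogM.matD_D (h : IsHomogM hr k A) : IsHomogM hr (k + 1) (matD (M.J hr).D A) :=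
  fun α β => (h α β).D

variable (hr) in
theorem isHomogM_diag (m : Fin n → 𝕜) :
    IsHomogM (M := M) hr 0 (ProductData.diag m) := fun α β => by
  rw [ProductData.diag, diagonal_apply]
  split_ifs
  · exact isHomog_const hr _
  · exact .zero _

theorem IsHomogM.mulVec (h : IsHomogM hr k A) {v : Fin n → DF M.Ω} (hv : ∀ γ, IsHomog hr l (v γ))
    (α : Fin n) : IsHomog hr (k + l) ((A *ᵥ v) α) := IsHomog.sum (s := Finset.univ) fun γ _ => (h α γ).mul (hv γ)

end matrices

theorem isHomog_cF (α β γ : Fin n) : IsHomog hr 0 (M.cF hr α β γ) := by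
  rw [cF, Fp, pd_pt, pd_pt]; exact isHomog_pd_pt _ _

theorem isHomog_c (α β γ : Fin n) : IsHomog hr 0 ((M.S hr).c α β γ) := by
  rw [S_c]
  exact .sum fun _ _ => .sum fun _ _ => ((isHomog_const hr _).mul (isHomog_const hr _)).mul
    (isHomog_cF _ _ _)

theorem isHomogM_tan {k : ℕ} {V : Fin n → DF M.Ω} (hV : ∀ γ, IsHomog hr k (V γ)) :
    IsHomogM hr k ((M.S hr).tan V) := fun α β =>
  IsHomog.sum (s := Finset.univ) fun γ _ => (hV γ).mul (isHomog_c α β γ)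

theorem isHomogM_cot {k : ℕ} {V : Fin n → DF M.Ω} (hV : ∀ γ, IsHomog hr k (V γ)) :
    IsHomogM hr k ((M.S hr).cot V) := fun α β =>
  IsHomog.sum (s := Finset.univ) fun γ _ => (hV γ).mul (isHomog_c α γ β)

theorem isHomogM_tan_x : IsHomogM hr 1 ((M.S hr).tan ((M.J hr).x 1)) :=
  isHomogM_tan fun γ => .x 0 γ

variable {G : (Fin n → 𝕜) → 𝕜} (hG : ContDiffOn 𝕜 r G M.U)
include hG

theorem isHomog_gen (α : Fin n) : IsHomog hr 1 ((M.S hr).gen (pt hr hG) α) :=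
  isHomogM_tan_x.mulVec (fun γ => isHomog_pd_pt hG γ) α

theorem isHomogM_hess : IsHomogM hr 0
    (Matrix.of fun σ ρ => (M.J hr).pd 0 σ ((M.J hr).pd 0 ρ (pt hr hG))) := fun σ ρ => by
  rw [of_apply, pd_pt]; exact isHomog_pd_pt _ _

theorem isHomogM_defQ (m : Fin n → 𝕜) : IsHomogM hr 2 ((M.S hr).defQ m (pt hr hG)) := by
  refine IsHomogM.mul (k := 2) (l := 0) (((isHomogM_tan_x.mul (isHomogM_hess hG)).mul
    isHomogM_tan_x).sub ((isHomogM_cot fun σ => (isHomog_pd_pt hG σ).D).mul isHomogM_tan_x)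
      |>.add ?_) (isHomogM_diag hr m)
  exact fun α β => IsHomog.sum (s := Finset.univ) fun ρ _ => (isHomog_c α β ρ).D.mul (isHomog_gen hG ρ)

theorem isHomogM_defA {W : Fin n → DF M.Ω} (hW : IsHomogM hr 0 ((M.S hr).tan W)) :
    IsHomogM hr 0 ((M.S hr).defA W (pt hr hG)) := by
  have h := (isHomogM_cot fun σ => isHomog_pd_pt hG σ).mul hW
  rw [defA, two_mul]
  exact h.add h

theorem isHomogM_defB {W : Fin n → DF M.Ω} (hW : IsHomogM hr 0 ((M.S hr).tan W))
    (m : Fin n → 𝕜) : IsHomogM hr 1 ((M.S hr).defB W m (pt hr hG)) := by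
  have h := (isHomogM_cot fun σ => isHomog_pd_pt hG σ).mul (isHomogM_tan_x (M := M) (hr := hr))
  have h' := (isHomogM_tan_x (M := M) (hr := hr)).mul (isHomogM_hess hG)
  exact ((isHomogM_defA hG hW).matD_D.smul _).add (((h'.mul hW).sub (IsHomogM.mul (k := 0) (l := 1) hW
    h'.transpose)).add ((h.mul (isHomogM_diag hr m)).sub
      (IsHomogM.mul (k := 0) (l := 1) (isHomogM_diag hr m) h)))

theorem isHomogM_defE {W : Fin n → DF M.Ω} (hW : IsHomogM hr 0 ((M.S hr).tan W))
    (m : Fin n → 𝕜) : IsHomogM hr 2 ((M.S hr).defE W m (pt hr hG)) :=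
  (((isHomogM_defQ hG m).add (isHomogM_defQ hG m).transpose).add
    (isHomogM_defB hG hW m).matD_D).sub (isHomogM_defA hG hW).matD_D.matD_D

omit hG

theorem isHomogM_unit : IsHomogM hr 0 ((M.S hr).tan M.unitW) := by
  rw [tan_unitW]; exact fun α β => isHomog_const hr _

theorem isHomogM_g : IsHomogM hr 0 ((M.S hr).tan (M.eulerW hr)) := isHomogM_tan fun γ => by
  refine ((isHomog_const hr _).mul' (k := 0) (l := 0) ?_ rfl).add (isHomog_const hr _)
  exact IsHomog.pt (a := fun t => t γ) (ContDiff.contDiffOn (by fun_prop))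

end FrobeniusManifold
end OneLoop
-- Corrections to the flows and the Hamiltonians
namespace OneLoop
open Matrix

namespace JetAlgebra

variable {𝕜 ι 𝒜 : Type*} [Field 𝕜] [DecidableEq ι] [CommRing 𝒜] [Algebra 𝕜 𝒜] [Fintype ι]
  {J : JetAlgebra 𝕜 ι 𝒜}

theorem IsPoint.euler {f : 𝒜} (h : J.IsPoint f) : J.euler f = fun γ => J.pd 0 γ f := by
  have hb : J.Bounds 1 f := fun s hs γ => by
    obtain ⟨s, rfl⟩ := Nat.exists_eq_add_of_le' hs
    exact h s γ
  funext γ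
  rw [J.euler_eq hb]
  simp

end JetAlgebra

section Calculus

variable {𝕜 : Type*} [RCLike 𝕜] {n : ℕ} {Ω : Set (Jet 𝕜 n)} {r : WithTop ℕ∞}
  {U : Set (Fin n → 𝕜)} {f g : Jet 𝕜 n → 𝕜}

theorem IsTotalDeriv.exists_rep (h : IsTotalDeriv Ω f) (hΩ : IsJetOpen Ω) :
    ∃ a : DF Ω, Rep f ((jetAlgebra hΩ).D a) := by
  obtain ⟨ρ, hρ, e⟩ := h
  obtain ⟨a, ha⟩ := hρ.exists_rep
  exact ⟨a, (ha.DX hΩ).congr e⟩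

theorem Rep.isTotalDeriv (hΩ : IsJetOpen Ω) {a : DF Ω} (h : Rep f ((jetAlgebra hΩ).D a)) :
    IsTotalDeriv Ω f := (h.isTotalDeriv_iff hΩ).2 ((jetAlgebra hΩ).int_D a)

theorem IsTotalDeriv.add (h : IsTotalDeriv Ω f) (h' : IsTotalDeriv Ω g) (hΩ : IsJetOpen Ω) :
    IsTotalDeriv Ω fun j => f j + g j := by
  obtain ⟨a, ha⟩ := h.exists_rep hΩ
  obtain ⟨b, hb⟩ := h'.exists_rep hΩ
  refine Rep.isTotalDeriv hΩ (a := a + b) ?_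
  rw [map_add]; exact ha.add hb

theorem IsTotalDeriv.sub (h : IsTotalDeriv Ω f) (h' : IsTotalDeriv Ω g) (hΩ : IsJetOpen Ω) :
    IsTotalDeriv Ω fun j => f j - g j := by
  obtain ⟨a, ha⟩ := h.exists_rep hΩ
  obtain ⟨b, hb⟩ := h'.exists_rep hΩ
  refine Rep.isTotalDeriv hΩ (a := a - b) ?_
  rw [map_sub]; exact ha.sub hb

theorem isQuadraticFunctional_iff (hΩ : IsJetOpen Ω) {δ : Jet 𝕜 n → 𝕜}
    (h : IsTotalDeriv Ω fun j => f j - (g j + δ j)) {X : Fin n → Fin n → (Fin n → 𝕜) → 𝕜}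
    (hX : ∀ μ ν, ContDiffOn 𝕜 r (X μ ν) U)
    (hδ : ∀ j, δ j = ∑ μ, ∑ ν, X μ ν (j 0) * j 1 μ * j 1 ν) :
    IsQuadraticFunctional r U Ω f ↔ IsQuadraticFunctional r U Ω g := by
  -- The given coefficients need not be symmetric, but the target form asks for a symmetric `χ`;
  -- symmetrizing does not change the quadratic form.
  have hY : ∀ μ ν, ContDiffOn 𝕜 r (fun t => 1 / 2 * (X μ ν t + X ν μ t)) U := fun μ ν =>
    contDiffOn_const.mul ((hX μ ν).add (hX ν μ))
  have hs : ∀ j : Jet 𝕜 n, ∑ μ, ∑ ν, 1 / 2 * (X μ ν (j 0) + X ν μ (j 0)) * j 1 μ * j 1 ν = δ j :=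
    fun j => by
    have h2 : δ j = ∑ μ, ∑ ν, X ν μ (j 0) * j 1 μ * j 1 ν := by
      rw [hδ, Finset.sum_comm]
      exact Finset.sum_congr rfl fun μ _ => Finset.sum_congr rfl fun ν _ => by ring
    have h3 : δ j = 1 / 2 * δ j + 1 / 2 * δ j := by ring
    rw [h3]
    nth_rw 1 [hδ]
    rw [h2, Finset.mul_sum, Finset.mul_sum, ← Finset.sum_add_distrib]
    refine Finset.sum_congr rfl fun μ _ => ?_
    rw [Finset.mul_sum, Finset.mul_sum, ← Finset.sum_add_distrib]
    exact Finset.sum_congr rfl fun ν _ => by ring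
  constructor
  · rintro ⟨χ, hχ, hsymm, ht⟩
    refine ⟨fun μ ν t => χ μ ν t - 1 / 2 * (X μ ν t + X ν μ t), fun μ ν => (hχ μ ν).sub (hY μ ν),
      fun μ ν => funext fun t => by beta_reduce; rw [hsymm, add_comm (X μ ν t)], ?_⟩
    convert ht.sub h hΩ using 2 with j
    rw [← hs]
    simp only [sub_mul, Finset.sum_sub_distrib]
    ring
  · rintro ⟨χ, hχ, hsymm, ht⟩
    refine ⟨fun μ ν t => χ μ ν t + 1 / 2 * (X μ ν t + X ν μ t), fun μ ν => (hχ μ ν).add (hY μ ν),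
      fun μ ν => funext fun t => by beta_reduce; rw [hsymm, add_comm (X μ ν t)], ?_⟩
    convert ht.add h hΩ using 2 with j
    rw [← hs]
    simp only [add_mul, Finset.sum_add_distrib]
    ring

theorem Coeffs.op_add (Q R : Coeffs 𝕜 n) (ψ : Fin n → Jet 𝕜 n → 𝕜) (α : Fin n) (j : Jet 𝕜 n) :
    (Q + R).op ψ α j = Q.op ψ α j + R.op ψ α j := by
  simp only [Coeffs.op, Pi.add_apply, add_mul, Finset.sum_add_distrib]

theorem Coeffs.op_sub (Q R : Coeffs 𝕜 n) (ψ : Fin n → Jet 𝕜 n → 𝕜) (α : Fin n) (j : Jet 𝕜 n) :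
    (Q - R).op ψ α j = Q.op ψ α j - R.op ψ α j := by
  simp only [Coeffs.op, Pi.sub_apply, sub_mul, Finset.sum_sub_distrib]

theorem isPolyBracket_iff {P P' : Op 𝕜 n} {R : Coeffs 𝕜 n}
    (h : OpEq Ω P fun ψ α j => P' ψ α j + R.op ψ α j)
    (hR : ∀ (s : Fin 4) α β, IsDiffPoly r U Ω (3 - (s : ℕ)) (R s α β)) :
    IsPolyBracket r U Ω P ↔ IsPolyBracket r U Ω P' := by
  constructor
  · rintro ⟨Q, hQ, hd⟩
    refine ⟨Q - R, fun ψ hψ α j hj => ?_, fun s α β => (hd s α β).sub (hR s α β)⟩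
    rw [Coeffs.op_sub, ← hQ ψ hψ α j hj, h ψ hψ α j hj]; ring
  · rintro ⟨Q, hQ, hd⟩
    refine ⟨Q + R, fun ψ hψ α j hj => ?_, fun s α β => (hd s α β).add (hR s α β)⟩
    rw [Coeffs.op_add, ← hQ ψ hψ α j hj, h ψ hψ α j hj]

theorem isPolyBracketNoDelta_iff {P P' : Op 𝕜 n} {R : Coeffs 𝕜 n}
    (h : OpEq Ω P fun ψ α j => P' ψ α j + R.op ψ α j) (h0 : R 0 = 0)
    (hR : ∀ (s : Fin 4) α β, IsDiffPoly r U Ω (3 - (s : ℕ)) (R s α β)) :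
    IsPolyBracketNoDelta r U Ω P ↔ IsPolyBracketNoDelta r U Ω P' := by
  constructor
  · rintro ⟨Q, hQ, hQ0, hd⟩
    refine ⟨Q - R, fun ψ hψ α j hj => ?_, by rw [Pi.sub_apply, hQ0, h0, sub_zero],
      fun s α β => (hd s α β).sub (hR s α β)⟩
    rw [Coeffs.op_sub, ← hQ ψ hψ α j hj, h ψ hψ α j hj]; ring
  · rintro ⟨Q, hQ, hQ0, hd⟩
    refine ⟨Q + R, fun ψ hψ α j hj => ?_, by rw [Pi.add_apply, hQ0, h0, add_zero],
      fun s α β => (hd s α β).add (hR s α β)⟩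
    rw [Coeffs.op_add, ← hQ ψ hψ α j hj, h ψ hψ α j hj]

end Calculus

namespace FrobeniusManifold
open JetAlgebra JetAlgebra.ProductData

variable {𝕜 : Type*} [RCLike 𝕜] {n : ℕ} [NeZero n] {r : WithTop ℕ∞}
  (M : FrobeniusManifold 𝕜 n r) (hr : ∞ ≤ r) {G : (Fin n → 𝕜) → 𝕜} (hG : ContDiffOn 𝕜 r G M.U)
  {θ : Fin n → ℕ → (Fin n → 𝕜) → 𝕜} (hθ : M.IsDeformedFlat θ)

/-- Putting `G = 0` in `exists_rep_w` identifies the common summand with the field `w` of the case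
`G = 0`. -/
theorem exists_rep_w_add (hθ : M.IsDeformedFlat θ) : ∃ w₀ : Fin n → DF M.Ω,
    (∀ α, Rep (M.w θ 0 α) (w₀ α)) ∧ ∀ {G : (Fin n → 𝕜) → 𝕜} (hG : ContDiffOn 𝕜 r G M.U),
      ∀ α, Rep (M.w θ G α) ((w₀ + (M.J hr).opD ((M.S hr).gen (pt hr hG))) α) := by
  obtain ⟨w₀, h⟩ := M.exists_rep_w hr hθ
  refine ⟨w₀, fun α => ?_, h⟩
  have h0 := h (G := 0) contDiffOn_const α
  have z : pt hr (M := M) (a := 0) contDiffOn_const = 0 := rfl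
  have z' : (M.S hr).gen 0 = 0 := by
    rw [gen, show (fun σ => (M.J hr).pd 0 σ (0 : DF M.Ω)) = 0 from funext fun _ => map_zero _,
      mulVec_zero]
  rwa [z, z', map_zero, Pi.zero_apply, add_zero] at h0

section transform

variable {M}
variable {w' : Fin n → DF M.Ω}

theorem rep_flowCorr (hθ : M.IsDeformedFlat θ) (hw : ∀ α, Rep (M.w θ G α) (w' α)) (β : Fin n)
    (p : ℕ) (α : Fin n) : Rep (M.flowCorr θ G β p α)
      (((M.J hr).prV (Kp hr hθ β p) w' - (M.J hr).prV w' (Kp hr hθ β p)) α) :=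
  ((hw α).pr (M.isJetOpen hr) (M.rep_K₀ hr hθ β p)).sub ((M.rep_K₀ hr hθ β p α).pr _ hw)

theorem rep_hamCorr (hθ : M.IsDeformedFlat θ) (hw : ∀ α, Rep (M.w θ G α) (w' α)) (β : Fin n)
    (m : ℕ) : Rep (M.hamCorr θ G β m) (-(M.J hr).pr w' (θp hr hθ β m)) :=
  ((rep_pt hr (hθ.contDiffOn β m)).pr (M.isJetOpen hr) hw).neg

theorem repOp_bracketCorr₁ (hw : ∀ α, Rep (M.w θ G α) (w' α)) :
    RepOp (M.bracketCorr₁ θ G) ((M.J hr).deform w' (M.P₁ hr)) :=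
  (M.repOp_bracket₁ hr).bracketTransform (M.isJetOpen hr) hw (map_add _)

theorem repOp_bracketCorr₂ (hw : ∀ α, Rep (M.w θ G α) (w' α)) :
    RepOp (M.bracketCorr₂ θ G) ((M.J hr).deform w' (M.P₂ hr)) :=
  (M.repOp_bracket₂ hr).bracketTransform (M.isJetOpen hr) hw (map_add _)

end transform

variable {M}

theorem isHomog_Kp (β : Fin n) (p : ℕ) (α : Fin n) : IsHomog hr 1 (Kp hr hθ β p α) := by
  rw [Kp, P₁_grad_succ]; exact isHomog_gen _ α

include hr hG hθ

/-- The contributions of the common part of `w` cancel, leaving the commutator of a flow of degree 1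
with `u` of degree 2. -/
theorem flowCorr_sub (β : Fin n) (p : ℕ) (α : Fin n) :
    IsDiffPoly r M.U M.Ω 3 (fun j => M.flowCorr θ G β p α j - M.flowCorr θ 0 β p α j) := by
  obtain ⟨w₀, h0, hw⟩ := M.exists_rep_w_add hr hθ
  have h := (rep_flowCorr hr hθ (hw hG) β p α).sub (rep_flowCorr hr hθ h0 β p α)
  refine IsHomog.isDiffPoly (hr := hr) ?_ le_rfl h
  rw [prV_add, add_prV]
  set u := (M.J hr).opD ((M.S hr).gen (pt hr hG))
  have hu : ∀ γ, IsHomog hr 2 (u γ) := fun γ => (isHomog_gen hG γ).D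
  have e : ((M.J hr).prV (Kp hr hθ β p) w₀ + (M.J hr).prV (Kp hr hθ β p) u
      - ((M.J hr).prV w₀ (Kp hr hθ β p) + (M.J hr).prV u (Kp hr hθ β p))) α
      - ((M.J hr).prV (Kp hr hθ β p) w₀ - (M.J hr).prV w₀ (Kp hr hθ β p)) α
      = (M.J hr).pr (Kp hr hθ β p) (u α) - (M.J hr).pr u (Kp hr hθ β p α) := by
    simp only [Pi.add_apply, Pi.sub_apply, prV]; ring
  rw [e]
  exact IsHomog.sub ((hu α).pr (isHomog_Kp hr hθ β p)) ((isHomog_Kp hr hθ β p α).pr hu)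

omit hG in
theorem opD_grad_θp_zero (β : Fin n) :
    (M.J hr).opD (fun γ => (M.J hr).pd 0 γ (θp hr hθ β 0)) = 0 := by
  funext γ
  rw [opD_apply, pd_θp_zero]
  exact Derivation.map_algebraMap _ _

/-- The density is `∂_X dθ_{β,m} · gen G`. The recursion evaluates the first factor for `m > 0`; for
`m = 0` it vanishes because `dθ_{β,0}` is constant, in agreement with `θ_{β,-1} = 0`. -/
theorem rep_δH'' (β : Fin n) (m : ℕ) : Rep (M.δH'' θ G β m)
    ((M.J hr).opD (fun γ => (M.J hr).pd 0 γ (θp hr hθ β m)) ⬝ᵥ (M.S hr).gen (pt hr hG)) := by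
  cases m with
  | zero => rw [opD_grad_θp_zero, zero_dotProduct]; exact rep_zero
  | succ p =>
    have h1 : ∀ ξ, Rep (fun j => ∑ ν, j 1 ν * ∑ γ, M.c₁ γ ν ξ (j 0) * partialD γ (θ β p) (j 0))
        ((M.J hr).opD (fun γ => (M.J hr).pd 0 γ (θp hr hθ β (p + 1))) ξ) := fun ξ => by
      have e : (M.J hr).D ((M.J hr).pd 0 ξ (θp hr hθ β (p + 1))) = ∑ ν, (M.J hr).x 1 ν
          * (M.J hr).pd 0 ν ((M.J hr).pd 0 ξ (θp hr hθ β (p + 1))) :=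
        ((isPoint_pt hr (hθ.contDiffOn β (p + 1))).pd ξ).D
      rw [opD_apply, e]
      refine Rep.sum fun ν _ => (rep_x (M.isJetOpen hr) 1 ν).mul ?_
      rw [pd_pd_θp]
      exact Rep.sum fun γ _ => (Rep.sum fun α' _ => (rep_const _).mul (M.rep_c₀ hr α' ν ξ)).mul
        (rep_partialD hr _ γ)
    have h2 : ∀ ξ, Rep (fun j => ∑ σ, (∑ μ, j 1 μ * M.c₂ ξ σ μ (j 0)) * partialD σ G (j 0))
        ((M.S hr).gen (pt hr hG) ξ) := fun ξ =>
      Rep.dotProduct (M.repM_tan_x hr ξ) fun σ => rep_partialD hr hG σ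
    refine (Rep.dotProduct h1 h2).congr fun j hj => ?_
    have hc : ∀ γ ν ξ, M.c₁ γ ν ξ (j 0) = M.c₁ γ ξ ν (j 0) := fun γ ν ξ =>
      Finset.sum_congr rfl fun α' _ => congrArg _ ((M.rep_c₀ hr α' ν ξ).eq
        (f' := fun j => M.c₀ α' ξ ν (j 0)) (by rw [M.cF_comm₂ hr]; exact M.rep_c₀ hr α' ξ ν) hj)
    simp only [δH'', Finset.sum_mul, Finset.mul_sum]
    refine Finset.sum_comm.trans (Finset.sum_congr rfl fun ξ _ => ?_)
    refine (Finset.sum_congr rfl fun γ _ => Finset.sum_comm).trans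
      (Finset.sum_comm.trans (Finset.sum_congr rfl fun σ _ => ?_))
    refine (Finset.sum_congr rfl fun γ _ => Finset.sum_comm).trans
      (Finset.sum_comm.trans (Finset.sum_congr rfl fun μ _ => Finset.sum_comm.trans ?_))
    refine Finset.sum_congr rfl fun ν _ => Finset.sum_congr rfl fun γ _ => ?_
    rw [hc γ ν ξ, M.c₂_symm ξ σ hr hj]; ring

/-- The extra density is `-dθ · ∂_X h`; moving `∂_X` onto `dθ` reverses the sign and gives `δH''`.
-/
theorem hamCorr_sub (β : Fin n) (m : ℕ) : IsTotalDeriv M.Ω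
    (fun j => M.hamCorr θ G β m j - (M.hamCorr θ 0 β m j + M.δH'' θ G β m j)) := by
  obtain ⟨w₀, h0, hw⟩ := M.exists_rep_w_add hr hθ
  have h := (rep_hamCorr hr hθ (hw hG) β m).sub
    ((rep_hamCorr hr hθ h0 β m).add (rep_δH'' hr hG hθ β m))
  rw [h.isTotalDeriv_iff (M.isJetOpen hr)]
  have e := (M.J hr).int_dotProduct_opD (fun γ => (M.J hr).pd 0 γ (θp hr hθ β m))
    ((M.S hr).gen (pt hr hG))
  have e' : (M.J hr).pr ((M.J hr).opD ((M.S hr).gen (pt hr hG))) (θp hr hθ β m)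
      = (fun γ => (M.J hr).pd 0 γ (θp hr hθ β m)) ⬝ᵥ (M.J hr).opD ((M.S hr).gen (pt hr hG)) := by
    rw [dotProduct_comm]; exact (isPoint_pt hr (hθ.contDiffOn β m)).pr _
  rw [pr_add, e', map_sub, map_add, map_neg, map_add, e, map_neg]
  abel

theorem hamCorr_isQuadraticFunctional_iff (β : Fin n) (m : ℕ) :
    IsQuadraticFunctional r M.U M.Ω (M.hamCorr θ G β m) ↔
      IsQuadraticFunctional r M.U M.Ω (M.hamCorr θ 0 β m) := by
  have h := hamCorr_sub hr hG hθ β m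
  cases m with
  | zero =>
    exact isQuadraticFunctional_iff (X := fun _ _ _ => 0) (M.isJetOpen hr) h
      (fun _ _ => contDiffOn_const) fun j => by simp [δH'']
  | succ p =>
    refine isQuadraticFunctional_iff (X := fun μ ν t => ∑ γ, ∑ ξ, ∑ σ, M.c₁ γ ξ ν t
      * M.c₂ σ ξ μ t * partialD γ (θ β p) t * partialD σ G t) (M.isJetOpen hr) h
      (fun μ ν => ?_) fun j => ?_
    · have hc := M.contDiffOn_partialD₃ hr
      refine ContDiffOn.sum fun γ _ => ContDiffOn.sum fun ξ _ => ContDiffOn.sum fun σ _ =>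
        (((ContDiffOn.sum fun α' _ => ?_).mul (ContDiffOn.sum fun α' _ => ContDiffOn.sum
          fun β' _ => ?_)).mul (contDiffOn_partialD hr M.isOpen_U (hθ.contDiffOn β p) γ)).mul
            (contDiffOn_partialD hr M.isOpen_U hG σ)
      · exact contDiffOn_const.mul (hc _ _ _)
      · exact contDiffOn_const.mul (hc _ _ _)
    · simp only [δH'', Finset.sum_mul]
      refine (Finset.sum_congr rfl fun γ _ => (Finset.sum_congr rfl fun ξ _ =>
        (Finset.sum_congr rfl fun ν _ => Finset.sum_comm).trans Finset.sum_comm).trans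
          Finset.sum_comm).trans (Finset.sum_comm.trans (Finset.sum_congr rfl fun μ _ => ?_))
      refine (Finset.sum_congr rfl fun γ _ => Finset.sum_comm).trans Finset.sum_comm

end FrobeniusManifold
end OneLoop
-- Corrections to the brackets, the Poisson pencil and the first Hamiltonian structure
namespace OneLoop
open Matrix

namespace FrobeniusManifold
open JetAlgebra JetAlgebra.ProductData

variable {𝕜 : Type*} [RCLike 𝕜] {n : ℕ} [NeZero n] {r : WithTop ℕ∞}
  {M : FrobeniusManifold 𝕜 n r} (hr : ∞ ≤ r) {G : (Fin n → 𝕜) → 𝕜} (hG : ContDiffOn 𝕜 r G M.U)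
  {θ : Fin n → ℕ → (Fin n → 𝕜) → 𝕜} (hθ : M.IsDeformedFlat θ)

include hr hG hθ in
theorem bracketCorr₁_eq : OpEq M.Ω (M.bracketCorr₁ θ G)
    (fun ψ α j => M.bracketCorr₁ θ 0 ψ α j + (M.bracket₁'' G).op ψ α j) := by
  obtain ⟨w₀, h0, hw⟩ := M.exists_rep_w_add hr hθ
  refine (repOp_bracketCorr₁ hr (hw hG)).opEq fun ψ ψ' hψ α => ?_
  rw [add_deform]
  exact (repOp_bracketCorr₁ hr h0 ψ ψ' hψ α).add (M.repOp_bracket₁'' hr hG ψ ψ' hψ α)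

include hr hG hθ in
theorem bracketCorr₂_eq : OpEq M.Ω (M.bracketCorr₂ θ G)
    (fun ψ α j => M.bracketCorr₂ θ 0 ψ α j + (M.bracket₂'' G).op ψ α j) := by
  obtain ⟨w₀, h0, hw⟩ := M.exists_rep_w_add hr hθ
  refine (repOp_bracketCorr₂ hr (hw hG)).opEq fun ψ ψ' hψ α => ?_
  rw [add_deform]
  exact (repOp_bracketCorr₂ hr h0 ψ ψ' hψ α).add (M.repOp_bracket₂'' hr hG ψ ψ' hψ α)

include hr hG in
theorem isDiffPoly_bracket₁'' : ∀ (s : Fin 4) α β,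
    IsDiffPoly r M.U M.Ω (3 - (s : ℕ)) (M.bracket₁'' G s α β)
  | 0, _, _ => isDiffPoly_zero le_rfl
  | 1, α, β => (isHomogM_defE hG isHomogM_unit 0 α β).isDiffPoly (by norm_num) (M.rep_e₁ hr hG α β)
  | 2, α, β => (isHomogM_defB hG isHomogM_unit 0 α β).isDiffPoly (by norm_num) (M.rep_b₁ hr hG α β)
  | 3, α, β => (isHomogM_defA hG isHomogM_unit α β).isDiffPoly (by norm_num) (M.rep_a₁ hr hG α β)

include hr hG in
theorem isDiffPoly_bracket₂'' : ∀ (s : Fin 4) α β,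
    IsDiffPoly r M.U M.Ω (3 - (s : ℕ)) (M.bracket₂'' G s α β)
  | 0, α, β => (isHomogM_defQ hG M.expo α β).D.isDiffPoly (by norm_num)
      ((M.rep_q₂ hr hG α β).DX (M.isJetOpen hr))
  | 1, α, β => (isHomogM_defE hG isHomogM_g _ α β).isDiffPoly (by norm_num) (M.rep_e₂ hr hG α β)
  | 2, α, β => (isHomogM_defB hG isHomogM_g _ α β).isDiffPoly (by norm_num) (M.rep_b₂ hr hG α β)
  | 3, α, β => (isHomogM_defA hG isHomogM_g α β).isDiffPoly (by norm_num) (M.rep_a₂ hr hG α β)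

/-- Both terms of `bracket W n` are linear in the pair `(W, n)`, so a pencil member is a bracket of
the same kind and no separate compatibility of the two brackets has to be checked. -/
theorem pencil_eq (a₁ a₂ : 𝕜) : a₁ • M.P₁ hr + a₂ • M.P₂ hr
    = (M.S hr).bracket (a₁ • M.unitW + a₂ • M.eulerW hr) (a₁ • 0 + a₂ • M.expo) :=
  LinearMap.ext fun ψ => by
    rw [bracket_add, bracket_smul, bracket_smul]
    rfl

theorem compat_pencil (a₁ a₂ : 𝕜) :
    (M.S hr).Compat (a₁ • M.unitW + a₂ • M.eulerW hr) (a₁ • 0 + a₂ • M.expo) :=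
  ((M.compat_unitW hr).smul a₁).add ((M.compat_eulerW hr).smul a₂)

theorem repOp_pencil {P Q : Op 𝕜 n} {P' Q' : (Fin n → DF M.Ω) → Fin n → DF M.Ω}
    (h : RepOp P P') (h' : RepOp Q Q') (a₁ a₂ : 𝕜) :
    RepOp (fun ψ α j => a₁ * P ψ α j + a₂ * Q ψ α j) fun ψ => a₁ • P' ψ + a₂ • Q' ψ :=
  fun ψ ψ' hψ α => ((h ψ ψ' hψ α).const_mul a₁).add ((h' ψ ψ' hψ α).const_mul a₂)

include hr hG hθ in
theorem pencil_isPoisson (a₁ a₂ : 𝕜) :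
    IsSkew M.Ω (fun ψ α j => a₁ * M.bracket₁ ψ α j + a₂ * M.bracket₂ ψ α j) ∧
      IsSkew M.Ω (fun ψ α j => a₁ * M.bracketCorr₁ θ G ψ α j + a₂ * M.bracketCorr₂ θ G ψ α j) ∧
      IsJacobiMod M.Ω (fun ψ α j => a₁ * M.bracket₁ ψ α j + a₂ * M.bracket₂ ψ α j)
        (fun ψ α j => a₁ * M.bracketCorr₁ θ G ψ α j + a₂ * M.bracketCorr₂ θ G ψ α j) := by
  obtain ⟨w₀, h0, hw⟩ := M.exists_rep_w_add hr hθ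
  replace hw := hw hG
  set w' := w₀ + (M.J hr).opD ((M.S hr).gen (pt hr hG))
  have h1 : RepOp (fun ψ α j => a₁ * M.bracket₁ ψ α j + a₂ * M.bracket₂ ψ α j)
      ((M.S hr).bracket (a₁ • M.unitW + a₂ • M.eulerW hr) (a₁ • 0 + a₂ • M.expo)) := by
    rw [← pencil_eq]
    exact repOp_pencil (M.repOp_bracket₁ hr) (M.repOp_bracket₂ hr) a₁ a₂
  have h2 : RepOp (fun ψ α j => a₁ * M.bracketCorr₁ θ G ψ α j + a₂ * M.bracketCorr₂ θ G ψ α j)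
      ((M.J hr).deform w'
        ((M.S hr).bracket (a₁ • M.unitW + a₂ • M.eulerW hr) (a₁ • 0 + a₂ • M.expo))) := by
    have e : ((M.J hr).deform w'
        ((M.S hr).bracket (a₁ • M.unitW + a₂ • M.eulerW hr) (a₁ • 0 + a₂ • M.expo)))
        = fun ψ => a₁ • (M.J hr).deform w' (M.P₁ hr) ψ + a₂ • (M.J hr).deform w' (M.P₂ hr) ψ := by
      funext ψ
      rw [← pencil_eq, deform_add, deform_smul, deform_smul]
    rw [e]
    exact repOp_pencil (repOp_bracketCorr₁ hr hw) (repOp_bracketCorr₂ hr hw) a₁ a₂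
  have hskew := bracket_skew (M.S hr) (compat_pencil hr a₁ a₂)
  have hjac := bracket_jacobi (M.S hr) (compat_pencil hr a₁ a₂)
  exact ⟨h1.isSkew (M.isJetOpen hr) hskew, h2.isSkew (M.isJetOpen hr) (hskew.deform w'),
    h1.isJacobiMod (M.isJetOpen hr) h2 hjac (cycJac_deform _ _ hskew hjac w')⟩

/-- The differential of `θ_{β,p}`. -/
abbrev gradθ (β : Fin n) (p : ℕ) : Fin n → DF M.Ω := fun γ => (M.J hr).pd 0 γ (θp hr hθ β p)

theorem euler_θp (β : Fin n) (p : ℕ) : (M.J hr).euler (θp hr hθ β p) = gradθ hr hθ β p :=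
  (isPoint_pt hr (hθ.contDiffOn β p)).euler

theorem rep_euler_θ (β : Fin n) (p : ℕ) (γ : Fin n) :
    Rep (euler (fun i => θ β p (i 0)) γ) ((M.J hr).euler (θp hr hθ β p) γ) :=
  (rep_pt hr (hθ.contDiffOn β p)).euler (M.isJetOpen hr) γ

include hr hG hθ in
theorem flow_hamiltonian₁ (β : Fin n) (p : ℕ) (α : Fin n) {j : Jet 𝕜 n} (hj : j ∈ M.Ω) :
    M.K₀ θ β p α j = M.bracket₁ (euler fun i => θ β (p + 1) (i 0)) α j ∧
      M.flowCorr θ G β p α j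
        = M.bracket₁ (euler (M.hamCorr θ G β (p + 1))) α j
          + M.bracketCorr₁ θ G (euler fun i => θ β (p + 1) (i 0)) α j := by
  obtain ⟨w₀, h0, hw⟩ := M.exists_rep_w_add hr hθ
  replace hw := hw hG
  have hK : Kp hr hθ β p = M.P₁ hr ((M.J hr).euler (θp hr hθ β (p + 1))) := by
    rw [euler_θp]; rfl
  have hf := rep_flowCorr hr hθ hw β p α
  rw [(M.J hr).flow_eq_of_hamiltonian (M.P₁ hr) _ _ _ hK] at hf
  refine ⟨?_, hf.eq (((M.repOp_bracket₁ hr) _ _ (fun γ => (rep_hamCorr hr hθ hw β _).euler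
    (M.isJetOpen hr) γ) α).add (repOp_bracketCorr₁ hr hw _ _ (rep_euler_θ hr hθ β (p + 1)) α)) hj⟩
  refine (M.rep_K₀ hr hθ β p α).eq ?_ hj
  rw [hK]
  exact (M.repOp_bracket₁ hr) _ _ (rep_euler_θ hr hθ β (p + 1)) α

/-- Multiplication by `t_X` is symmetric, which exchanges the two gradients while shifting one level
from `γ` to `β`; skewness restores the order. Lowering `l` ends at `dθ_{γ,0}`, which is constant. -/
theorem int_gradθ_P₁ (β γ : Fin n) (m l : ℕ) :
    (M.J hr).int (gradθ hr hθ β m ⬝ᵥ M.P₁ hr (gradθ hr hθ γ l)) = 0 := by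
  induction l generalizing m with
  | zero => rw [P₁_apply, opD_grad_θp_zero, mulVec_zero, dotProduct_zero, map_zero]
  | succ l ih =>
    have h : gradθ hr hθ β m ⬝ᵥ M.P₁ hr (gradθ hr hθ γ (l + 1))
        = gradθ hr hθ γ l ⬝ᵥ M.P₁ hr (gradθ hr hθ β (m + 1)) := by
      rw [P₁_grad_succ, P₁_grad_succ, gen, gen]
      exact (M.S hr).dotProduct_mulVec_tan _ _ _
    have hs : (M.J hr).SkewOp (M.P₁ hr) := bracket_skew (M.S hr) (M.compat_unitW hr)
    rw [h, hs]
    exact neg_eq_zero.2 (ih (m + 1))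

include hr hG hθ in
theorem hamiltonians_commute (β : Fin n) (m : ℕ) (γ : Fin n) (l : ℕ) :
    IsTotalDeriv M.Ω (fun j => ∑ α, euler (fun i => θ β m (i 0)) α j
        * M.bracket₁ (euler fun i => θ γ l (i 0)) α j) ∧
      IsTotalDeriv M.Ω (fun j => ∑ α,
        (euler (M.hamCorr θ G β m) α j * M.bracket₁ (euler fun i => θ γ l (i 0)) α j
          + euler (fun i => θ β m (i 0)) α j
            * M.bracketCorr₁ θ G (euler fun i => θ γ l (i 0)) α j
          + euler (fun i => θ β m (i 0)) α j * M.bracket₁ (euler (M.hamCorr θ G γ l)) α j)) := by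
  obtain ⟨w₀, h0, hw⟩ := M.exists_rep_w_add hr hθ
  replace hw := hw hG
  have h := int_gradθ_P₁ hr hθ β γ m l
  rw [← euler_θp, ← euler_θp] at h
  have hE := fun β m => rep_euler_θ hr hθ β m
  have hH := fun β m γ => (rep_hamCorr hr hθ hw β m).euler (M.isJetOpen hr) γ
  constructor
  · exact ((Rep.dotProduct (hE β m) ((M.repOp_bracket₁ hr) _ _ (hE γ l))).isTotalDeriv_iff _).2 h
  · refine (Rep.isTotalDeriv_iff (M.isJetOpen hr) (Rep.congr
      (((Rep.dotProduct (hH β m) ((M.repOp_bracket₁ hr) _ _ (hE γ l))).add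
      (Rep.dotProduct (hE β m) (repOp_bracketCorr₁ hr hw _ _ (hE γ l)))).add
      (Rep.dotProduct (hE β m) ((M.repOp_bracket₁ hr) _ _ (hH γ l)))) fun j _ => ?_)).2
      ((M.J hr).int_bracket_deform (M.P₁ hr) _ _ _ h)
    simp only [Finset.sum_add_distrib]

end FrobeniusManifold
end OneLoop
-- Inverting the second bracket: the second Hamiltonian structure
namespace OneLoop
open Matrix

section matR

variable {𝕜 : Type*} [RCLike 𝕜] {n : ℕ} (R : ℕ → Matrix (Fin n) (Fin n) 𝕜)

theorem matR_eq_zero_of_lt {k m : ℕ} (h : m < k) : matR R k m = 0 := by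
  induction k generalizing m with
  | zero => omega
  | succ k ih =>
    rw [matR]
    refine Finset.sum_eq_zero fun i hi => ?_
    rw [Finset.mem_Icc] at hi
    rw [ih (by omega), mul_zero]

/-- The gradings of successive factors `R_i` add up to the total index. -/
theorem matR_grading {μ : Fin n → 𝕜}
    (hR : ∀ k, 1 ≤ k → ∀ ε α, R k ε α ≠ 0 → μ ε - μ α = k) {k m : ℕ} {ε β : Fin n}
    (h : matR R k m ε β ≠ 0) : μ ε - μ β = m := by
  induction k generalizing m ε with
  | zero =>
    rw [matR] at h
    split_ifs at h with hm
    · by_cases e : ε = β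
      · subst e; subst hm; simp
      · exact absurd (one_apply_ne e) h
    · exact absurd rfl h
  | succ k ih =>
    rw [matR, Matrix.sum_apply] at h
    obtain ⟨i, hi, h⟩ := Finset.exists_ne_zero_of_sum_ne_zero h
    rw [Matrix.mul_apply] at h
    obtain ⟨ε', -, h⟩ := Finset.exists_ne_zero_of_sum_ne_zero h
    rw [Finset.mem_Icc] at hi
    have h1 := hR i hi.1 ε ε' (left_ne_zero_of_mul h)
    have h2 := ih (right_ne_zero_of_mul h)
    rw [Nat.cast_sub hi.2] at h2
    linear_combination h1 + h2

end matR

section hat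

variable {𝕜 V : Type*} [RCLike 𝕜] {n : ℕ} [AddCommGroup V] [Module 𝕜 V]
  (R : ℕ → Matrix (Fin n) (Fin n) 𝕜) (s : 𝕜) (β : Fin n) (p : ℕ)

/-- `∑_{l ≤ p} (R_{p-l,k})^ε_β a_{ε,l}`. -/
def matRSum (k : ℕ) (a : Fin n → ℕ → V) : V :=
  ∑ l ∈ Finset.range (p + 1), ∑ ε, matR R k (p - l) ε β • a ε l

/-- `∑_{k,l} (-1)^k (R_{p-l,k})^ε_β a_{ε,l} / s^{k+1}`. -/
def hatSum (a : Fin n → ℕ → V) : V :=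
  ∑ k ∈ Finset.range (p + 1), ((-1) ^ k / s ^ (k + 1)) • matRSum R β p k a

theorem matRSum_zero (a : Fin n → ℕ → V) : matRSum R β p 0 a = a β p := by
  rw [matRSum, Finset.sum_range_succ, Finset.sum_eq_zero, zero_add]
  · simp [matR, Matrix.one_apply]
  · intro l hl
    have : p - l ≠ 0 := by have := Finset.mem_range.1 hl; omega
    simp [matR, this]

/-- A product of `p + 1` factors has total index at least `p + 1`, so the geometric series stops. -/
theorem matRSum_succ_self (a : Fin n → ℕ → V) : matRSum R β p (p + 1) a = 0 := by
  refine Finset.sum_eq_zero fun l _ => Finset.sum_eq_zero fun ε _ => ?_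
  rw [matR_eq_zero_of_lt R (by omega : p - l < p + 1)]
  exact zero_smul 𝕜 _

theorem map_matRSum {W : Type*} [AddCommGroup W] [Module 𝕜 W] (f : V →ₗ[𝕜] W) (k : ℕ)
    (a : Fin n → ℕ → V) : f (matRSum R β p k a) = matRSum R β p k fun ε l => f (a ε l) := by
  simp only [matRSum, map_sum, map_smul]

theorem map_hatSum {W : Type*} [AddCommGroup W] [Module 𝕜 W] (f : V →ₗ[𝕜] W)
    (a : Fin n → ℕ → V) : f (hatSum R s β p a) = hatSum R s β p fun ε l => f (a ε l) := by
  simp only [hatSum, map_sum, map_smul, map_matRSum]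

variable {R s β p}

/-- Applying one more `R` to the family `a` lengthens every product of matrices by one factor. -/
theorem matRSum_shift (k : ℕ) (a : Fin n → ℕ → V) :
    matRSum R β p k (fun ε l => ∑ i ∈ Finset.Icc 1 l, ∑ δ, R i δ ε • a δ (l - i))
      = matRSum R β p (k + 1) a := by
  simp only [matRSum, matR, Matrix.sum_apply, Matrix.mul_apply, Finset.sum_smul, Finset.smul_sum]
  have h1 : ∀ l, ∑ ε, ∑ i ∈ Finset.Icc 1 l, ∑ δ, matR R k (p - l) ε β • R i δ ε • a δ (l - i)
      = ∑ i ∈ Finset.Icc 1 l, ∑ δ, ∑ ε, matR R k (p - l) ε β • R i δ ε • a δ (l - i) := fun l =>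
    Finset.sum_comm.trans (Finset.sum_congr rfl fun i _ => Finset.sum_comm)
  have h2 : ∀ l, ∑ δ, ∑ i ∈ Finset.Icc 1 (p - l), ∑ ε,
        (R i δ ε * matR R k (p - l - i) ε β) • a δ l
      = ∑ i ∈ Finset.Icc 1 (p - l), ∑ δ, ∑ ε, (R i δ ε * matR R k (p - l - i) ε β) • a δ l :=
    fun l => Finset.sum_comm
  simp only [h1, h2]
  refine (Finset.sum_sigma' (Finset.range (p + 1)) (fun l => Finset.Icc 1 l) _).trans (Eq.trans ?_
    (Finset.sum_sigma' (Finset.range (p + 1)) (fun l => Finset.Icc 1 (p - l)) _).symm)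
  -- The new summation level is `l - i`, the one at which `a` is finally evaluated, while the index
  -- `i` of the added factor is kept.
  refine Finset.sum_bij' (fun x _ => ⟨x.1 - x.2, x.2⟩) (fun x _ => ⟨x.1 + x.2, x.2⟩) ?_ ?_ ?_ ?_ ?_
  · rintro ⟨l, i⟩ h
    simp only [Finset.mem_sigma, Finset.mem_range, Finset.mem_Icc] at h ⊢
    omega
  · rintro ⟨l, i⟩ h
    simp only [Finset.mem_sigma, Finset.mem_range, Finset.mem_Icc] at h ⊢
    omega
  · rintro ⟨l, i⟩ h
    simp only [Finset.mem_sigma, Finset.mem_range, Finset.mem_Icc] at h ⊢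
    rw [Nat.sub_add_cancel h.2.2]
  · rintro ⟨l, i⟩ h
    simp only [Nat.add_sub_cancel]
  · rintro ⟨l, i⟩ h
    simp only [Finset.mem_sigma, Finset.mem_range, Finset.mem_Icc] at h ⊢
    have e : p - (l - i) - i = p - l := by omega
    rw [e]
    exact Finset.sum_congr rfl fun δ _ => Finset.sum_congr rfl fun ε _ => by
      rw [smul_smul, mul_comm]

/-- This is the finite geometric series for the inverse of `s` plus a nilpotent: with alternating
signs and powers of `1 / s`, consecutive terms cancel, leaving the first, which is `y β p`, and the
last, which is zero. -/
theorem hatSum_telescope (hs : s ≠ 0) {x y : Fin n → ℕ → V}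
    (h : ∀ k, matRSum R β p k x = s • matRSum R β p k y + matRSum R β p (k + 1) y) :
    hatSum R s β p x = y β p := by
  have key : ∀ N, ∑ k ∈ Finset.range N, ((-1) ^ k / s ^ (k + 1)) • matRSum R β p k x
      = matRSum R β p 0 y - ((-1) ^ N / s ^ N) • matRSum R β p N y := by
    intro N
    induction N with
    | zero => simp
    | succ N ih =>
      have e : (-1) ^ N / s ^ (N + 1) * s = (-1) ^ N / s ^ N := by
        rw [pow_succ, mul_comm, ← mul_div_assoc, mul_comm (s ^ N), mul_div_mul_left _ _ hs]
      have e' : (-1 : 𝕜) ^ (N + 1) / s ^ (N + 1) = - ((-1) ^ N / s ^ (N + 1)) := by ring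
      rw [Finset.sum_range_succ, ih, h, smul_add, smul_smul, e, e', neg_smul]
      abel
  rw [hatSum, key, matRSum_succ_self, smul_zero, sub_zero, matRSum_zero]

theorem rep_hatDensity {Ω : Set (Jet 𝕜 n)} {h : Fin n → ℕ → Jet 𝕜 n → 𝕜} {a : Fin n → ℕ → DF Ω}
    (ha : ∀ ε l, Rep (h ε l) (a ε l)) : Rep (hatDensity R s β p h) (hatSum R s β p a) := by
  have e : hatSum R s β p a = ∑ l ∈ Finset.range (p + 1), ∑ k ∈ Finset.range (p - l + 1), ∑ ε,
      ((-1) ^ k * matR R k (p - l) ε β / s ^ (k + 1)) • a ε l := by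
    simp only [hatSum, matRSum, Finset.smul_sum, smul_smul]
    rw [Finset.sum_comm]
    refine Finset.sum_congr rfl fun l hl => ?_
    have hl' := Finset.mem_range.1 hl
    -- The density sums only over `k ≤ p - l`; the additional terms of `hatSum` contain products
    -- with more factors than their total index allows.
    refine ((Finset.sum_subset (Finset.range_mono (by omega : p - l + 1 ≤ p + 1)) fun k _ hk => ?_).trans ?_).symm
    · rw [Finset.mem_range, not_lt] at hk
      refine Finset.sum_eq_zero fun ε _ => ?_
      rw [matR_eq_zero_of_lt R (by omega : p - l < k)]
      simp
    · exact Finset.sum_congr rfl fun k _ => Finset.sum_congr rfl fun ε _ => by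
        congr 1; ring
  rw [e]
  exact (Rep.sum fun l _ => Rep.sum fun k _ => Rep.sum fun ε _ => (ha ε l).const_mul _).congr
    fun j _ => Finset.sum_congr rfl fun l _ => Finset.sum_congr rfl fun k _ =>
      Finset.sum_congr rfl fun ε _ => by ring

end hat

namespace FrobeniusManifold
open JetAlgebra JetAlgebra.ProductData

variable {𝕜 : Type*} [RCLike 𝕜] {n : ℕ} [NeZero n] {r : WithTop ℕ∞}
  {M : FrobeniusManifold 𝕜 n r} (hr : ∞ ≤ r) {G : (Fin n → 𝕜) → 𝕜} (hG : ContDiffOn 𝕜 r G M.U)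
  {θ : Fin n → ℕ → (Fin n → 𝕜) → 𝕜} (hθ : M.IsDeformedFlat θ)

theorem cot_mul_H (y : Fin n → DF M.Ω) : (M.S hr).cot y * M.H = (M.S hr).tan (M.H *ᵥ y) := by
  refine Matrix.ext fun α τ => ?_
  simp only [Matrix.mul_apply, cot, tan, of_apply, mulVec, dotProduct, S_c, Finset.sum_mul,
    Finset.mul_sum]
  have hs : ∀ α β, M.H α β = M.H β α := fun α β => congrFun (congrFun M.H_transpose β) α
  refine (Finset.sum_congr rfl fun j _ => ((Finset.sum_congr rfl fun σ _ =>
    Finset.sum_comm).trans Finset.sum_comm).trans (Finset.sum_congr rfl fun b _ =>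
      Finset.sum_comm)).trans (Finset.sum_comm.trans (Finset.sum_congr rfl fun b _ =>
        Finset.sum_comm.trans (Finset.sum_congr rfl fun a _ => Finset.sum_congr rfl fun j _ =>
          Finset.sum_congr rfl fun σ _ => ?_)))
  rw [hs σ b, hs j τ, M.cF_comm₂ hr a b j]; ring

theorem Hi_transpose : M.Hiᵀ = M.Hi := by
  have h := congrArg Matrix.transpose M.H_mul_Hi
  rw [transpose_mul, H_transpose, transpose_one] at h
  rw [← mul_one M.Hiᵀ, ← H_mul_Hi, ← mul_assoc, h, one_mul]

/-- Multiplications by two vector fields commute. Lowering an index turns one of them into `cot`,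
and `cot_mul_tan` applies. -/
theorem tan_mul_Hi_mul_tan (U V : Fin n → DF M.Ω) :
    (M.S hr).tan V * M.Hi * (M.S hr).tan U = (M.S hr).tan U * M.Hi * (M.S hr).tan V := by
  have h : (M.S hr).tan V * M.Hi = (M.S hr).cot (M.Hi *ᵥ V) := by
    have := M.cot_mul_H hr (M.Hi *ᵥ V)
    rw [mulVec_mulVec, H_mul_Hi, one_mulVec] at this
    rw [← this, mul_assoc, H_mul_Hi, mul_one]
  rw [h, cot_mul_tan, ← h, transpose_mul, Hi_transpose, tan_transpose, mul_assoc]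

/-- The derivative of `dθ_{β,p}` along `V`. -/
def dgradθ (V : Fin n → DF M.Ω) (β : Fin n) (p : ℕ) (γ : Fin n) : DF M.Ω :=
  ∑ ε, V ε * (M.J hr).pd 0 ε (gradθ hr hθ β p γ)

theorem H_mulVec_dgradθ (V : Fin n → DF M.Ω) (β : Fin n) (p : ℕ) :
    M.H *ᵥ dgradθ hr hθ V β (p + 1) = (M.S hr).tan V *ᵥ gradθ hr hθ β p := by
  funext α
  simp only [mulVec, dotProduct, dgradθ, gradθ, tan, of_apply]
  simp only [pd_pd_θp, S_c, Finset.sum_mul, Finset.mul_sum]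
  refine Finset.sum_comm.trans ((Finset.sum_congr rfl fun δ _ => Finset.sum_comm).trans
    (Finset.sum_comm.trans ?_))
  refine Finset.sum_congr rfl fun ρ _ => Finset.sum_congr rfl fun δ _ =>
    Finset.sum_congr rfl fun γ _ => Finset.sum_congr rfl fun α' _ => ?_
  rw [M.cF_comm₁ hr γ, M.cF_comm₂ hr α' γ]; ring

theorem dgradθ_zero (V : Fin n → DF M.Ω) (β : Fin n) : dgradθ hr hθ V β 0 = 0 := by
  funext γ
  simp [dgradθ, gradθ, pd_θp_zero, Hi]

theorem opD_gradθ (β : Fin n) (p : ℕ) :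
    (M.J hr).opD (gradθ hr hθ β p) = dgradθ hr hθ ((M.J hr).x 1) β p :=
  funext fun γ => ((isPoint_pt hr (hθ.contDiffOn β p)).pd γ).D

/-- By the recursion `dθ_{β,p+1}` varies along a field by multiplication, so the two multiplications
may be exchanged. It is used to trade `E · ∂_X dθ` for `t_X · (E dθ)`, where quasihomogeneity can be
applied. -/
theorem tan_mulVec_dgradθ (U V : Fin n → DF M.Ω) (β : Fin n) (p : ℕ) :
    (M.S hr).tan V *ᵥ dgradθ hr hθ U β p = (M.S hr).tan U *ᵥ dgradθ hr hθ V β p := by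
  cases p with
  | zero => rw [dgradθ_zero, dgradθ_zero, mulVec_zero, mulVec_zero]
  | succ p =>
    have h : ∀ W, dgradθ hr hθ W β (p + 1)
        = (M.Hi * (M.S hr).tan W) *ᵥ gradθ hr hθ β p := fun W => by
      rw [← mulVec_mulVec, ← H_mulVec_dgradθ, mulVec_mulVec, Hi_mul_H, one_mulVec]
    rw [h, h, mulVec_mulVec, mulVec_mulVec, ← mul_assoc, ← mul_assoc, tan_mul_Hi_mul_tan]

variable {R : ℕ → Matrix (Fin n) (Fin n) 𝕜} (hR : M.IsMonodromy θ R)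
include hR

/-- Differentiating the scaling law removes its constant, and commuting with `∂_γ` subtracts `1 -
q_γ`, which turns `(2 - d)/2` into `μ_γ`. -/
theorem dgradθ_eulerW (β : Fin n) (p : ℕ) (γ : Fin n) :
    dgradθ hr hθ (M.eulerW hr) β p γ = ((p : 𝕜) + M.mu β + M.mu γ) • gradθ hr hθ β p γ
      + ∑ k ∈ Finset.Icc 1 p, ∑ ε, R k ε β • gradθ hr hθ ε (p - k) γ := by
  obtain ⟨c, hc⟩ := hR.scaling β p
  have h : M.eulerD hr (θp hr hθ β p) = ((p : 𝕜) + (2 - M.d) / 2 + M.mu β) • θp hr hθ β p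
      + ∑ k ∈ Finset.Icc 1 p, ∑ ε, R k ε β • θp hr hθ ε (p - k) + algebraMap 𝕜 _ c := by
    refine Rep.ext (Rep.sum fun ε _ => (M.rep_eulerW hr ε).mul (rep_partialD hr
      (hθ.contDiffOn β p) ε)) (Rep.congr ((((rep_pt hr (hθ.contDiffOn β p)).const_mul _).add
        (Rep.sum fun k _ => Rep.sum fun ε _ => (rep_pt hr (hθ.contDiffOn ε (p - k))).const_mul
          (R k ε β))).add (rep_const c)) fun j hj => ?_)
    rw [hc _ hj.1]
    simp only [mul_comm (R _ _ _)]
  have h' := M.eulerD_pd hr γ (θp hr hθ β p)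
  rw [h] at h'
  simp only [map_add, map_sum, Derivation.map_smul, Derivation.map_algebraMap, add_zero] at h'
  refine h'.trans ?_
  simp only [gradθ, mu]
  module

/-- After the exchange both terms of the bracket are multiplication by `t_X`. The exponent `1/2 -
μ_γ` cancels the `γ`-dependence of the scaling weight, leaving a scalar. -/
theorem P₂_gradθ (β : Fin n) (p : ℕ) : M.P₂ hr (gradθ hr hθ β p)
    = ((p : 𝕜) + M.mu β + 1 / 2) • Kp hr hθ β p
      + ∑ k ∈ Finset.Icc 1 p, ∑ ε, R k ε β • Kp hr hθ ε (p - k) := by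
  have hK : ∀ β p, Kp hr hθ β p = (M.S hr).tan ((M.J hr).x 1) *ᵥ gradθ hr hθ β p := fun β p =>
    P₁_grad_succ hr hθ β p
  rw [P₂, bracket_apply, opD_gradθ, tan_mulVec_dgradθ, ← mulVec_add]
  have e : dgradθ hr hθ (M.eulerW hr) β p + ProductData.diag M.expo *ᵥ gradθ hr hθ β p
      = ((p : 𝕜) + M.mu β + 1 / 2) • gradθ hr hθ β p
        + ∑ k ∈ Finset.Icc 1 p, ∑ ε, R k ε β • gradθ hr hθ ε (p - k) := by
    funext γ
    rw [Pi.add_apply, dgradθ_eulerW hr hθ hR, ProductData.diag, mulVec_diagonal,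
      ← Algebra.smul_def]
    simp only [Pi.add_apply, Finset.sum_apply, Pi.smul_apply, expo]
    module
  rw [e, mulVec_add, mulVec_smul, ← hK]
  refine congrArg _ ?_
  have e2 : ∀ v : Fin n → DF M.Ω, (M.S hr).tan ((M.J hr).x 1) *ᵥ v
      = opM 𝕜 ((M.S hr).tan ((M.J hr).x 1)) v := fun v => rfl
  simp only [hK, e2, map_sum, map_smul]

/-- The differential of a point function as a linear map. -/
def gradL (hr : ∞ ≤ r) : DF M.Ω →ₗ[𝕜] Fin n → DF M.Ω :=
  LinearMap.pi fun γ => ((M.J hr).pd 0 γ : DF M.Ω →ₗ[𝕜] DF M.Ω)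

theorem Kp_eq_P₂ {β : Fin n} {p : ℕ} (hs : (p : 𝕜) + M.mu β + 1 / 2 ≠ 0) :
    Kp hr hθ β p = M.P₂ hr ((M.J hr).euler
      (hatSum R (p + M.mu β + 1 / 2) β p (θp hr hθ))) := by
  have hpt : (M.J hr).IsPoint (hatSum R (p + M.mu β + 1 / 2) β p (θp hr hθ)) := fun t γ => by
    have := map_hatSum R ((p : 𝕜) + M.mu β + 1 / 2) β p
      ((M.J hr).pd (t + 1) γ : DF M.Ω →ₗ[𝕜] DF M.Ω) (θp hr hθ)
    refine this.trans ?_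
    have z : (fun ε l => ((M.J hr).pd (t + 1) γ : DF M.Ω →ₗ[𝕜] DF M.Ω) (θp hr hθ ε l)) = 0 :=
      funext fun ε => funext fun l => isPoint_pt hr (hθ.contDiffOn ε l) t γ
    rw [z]
    simp [hatSum, matRSum]
  rw [hpt.euler]
  have h1 := map_hatSum R ((p : 𝕜) + M.mu β + 1 / 2) β p ((M.P₂ hr).comp (gradL (M := M) hr)) (θp hr hθ)
  refine Eq.trans ?_ h1.symm
  -- Telescoping with `x` the second bracket applied to the gradients of `θ` and `y` the flows; the
  -- relation between them is `P₂_gradθ`.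
  refine (hatSum_telescope hs fun k => ?_).symm
  rw [← matRSum_shift, matRSum, matRSum, matRSum, Finset.smul_sum, ← Finset.sum_add_distrib]
  refine Finset.sum_congr rfl fun l hl => ?_
  rw [Finset.smul_sum, ← Finset.sum_add_distrib]
  refine Finset.sum_congr rfl fun ε _ => ?_
  have h2 : ((M.P₂ hr).comp (gradL (M := M) hr)) (θp hr hθ ε l) = M.P₂ hr (gradθ hr hθ ε l) := rfl
  rw [h2, P₂_gradθ hr hθ hR, smul_add, smul_smul, smul_smul]
  refine congrArg (· + _) ?_
  by_cases h0 : matR R k (p - l) ε β = 0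
  · rw [h0, zero_mul, mul_zero]
  -- The scalar in `P₂_gradθ` at `(ε, l)` is `l + μ_ε + 1/2`. Wherever the matrix entry is nonzero
  -- the grading gives `μ_ε - μ_β = p - l`, so the scalar is always the same `p + μ_β + 1/2`.
  · have h3 := matR_grading R hR.grading h0
    have hl' := Finset.mem_range.1 hl
    rw [Nat.cast_sub (by omega)] at h3
    congr 1
    linear_combination matR R k (p - l) ε β * h3

include hr hG hθ in
theorem flow_hamiltonian₂ {β : Fin n} {p : ℕ} (hs : (p : 𝕜) + M.mu β + 1 / 2 ≠ 0) (α : Fin n)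
    {j : Jet 𝕜 n} (hj : j ∈ M.Ω) :
    M.K₀ θ β p α j
        = M.bracket₂ (euler (hatDensity R (p + M.mu β + 1 / 2) β p
            fun ε l i => θ ε l (i 0))) α j ∧
      M.flowCorr θ G β p α j
        = M.bracket₂ (euler (hatDensity R (p + M.mu β + 1 / 2) β p (M.hamCorr θ G))) α j
          + M.bracketCorr₂ θ G (euler (hatDensity R (p + M.mu β + 1 / 2) β p
              fun ε l i => θ ε l (i 0))) α j := by
  obtain ⟨w₀, h0, hw⟩ := M.exists_rep_w_add hr hθ
  replace hw := hw hG
  set w' := w₀ + (M.J hr).opD ((M.S hr).gen (pt hr hG))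
  have hK := Kp_eq_P₂ hr hθ hR hs
  have hf := rep_flowCorr hr hθ hw β p α
  rw [(M.J hr).flow_eq_of_hamiltonian (M.P₂ hr) _ _ _ hK] at hf
  have hE := fun γ => (rep_hatDensity (R := R) (s := (p : 𝕜) + M.mu β + 1 / 2) (β := β) (p := p)
    fun ε l => rep_pt hr (hθ.contDiffOn ε l)).euler (M.isJetOpen hr) γ
  have hH := fun γ => (rep_hatDensity (R := R) (s := (p : 𝕜) + M.mu β + 1 / 2) (β := β) (p := p)
    fun ε l => rep_hamCorr hr hθ hw ε l).euler (M.isJetOpen hr) γ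
  have e : hatSum R ((p : 𝕜) + M.mu β + 1 / 2) β p (fun ε l => -(M.J hr).pr w' (θp hr hθ ε l))
      = -(M.J hr).pr w' (hatSum R (p + M.mu β + 1 / 2) β p (θp hr hθ)) :=
    (map_hatSum R ((p : 𝕜) + M.mu β + 1 / 2) β p
      (-((M.J hr).pr w' : DF M.Ω →ₗ[𝕜] DF M.Ω)) (θp hr hθ)).symm
  rw [e] at hH
  refine ⟨?_, hf.eq (((M.repOp_bracket₂ hr) _ _ hH α).add
    (repOp_bracketCorr₂ hr hw _ _ hE α)) hj⟩
  refine (M.rep_K₀ hr hθ β p α).eq ?_ hj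
  rw [hK]
  exact (M.repOp_bracket₂ hr) _ _ hE α

end FrobeniusManifold
end OneLoop

end

/-! ### The proposition -/

theorem mainTheorem5 {𝕜 : Type*} [RCLike 𝕜] {n : ℕ} [NeZero n] {r : WithTop ℕ∞} (hr : ∞ ≤ r)
    (M : FrobeniusManifold 𝕜 n r) (θ : Fin n → ℕ → (Fin n → 𝕜) → 𝕜) (hθ : M.IsDeformedFlat θ)
    (G : (Fin n → 𝕜) → 𝕜) (hG : ContDiffOn 𝕜 r G M.U) :
    -- the hierarchy changes by a differential polynomial of degree 3
    (∀ β p α,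
      IsDiffPoly r M.U M.Ω 3 (fun j => M.flowCorr θ G β p α j - M.flowCorr θ 0 β p α j) ∧
      (IsDiffPoly r M.U M.Ω 3 (M.flowCorr θ G β p α) ↔
        IsDiffPoly r M.U M.Ω 3 (M.flowCorr θ 0 β p α))) ∧
    -- the Hamiltonians change by `δH''`
    (∀ β m,
      IsTotalDeriv M.Ω
        (fun j => M.hamCorr θ G β m j - (M.hamCorr θ 0 β m j + M.δH'' θ G β m j)) ∧
      (IsQuadraticFunctional r M.U M.Ω (M.hamCorr θ G β m) ↔
        IsQuadraticFunctional r M.U M.Ω (M.hamCorr θ 0 β m))) ∧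
    -- the first bracket changes by `{ , }''_1`
    (OpEq M.Ω (M.bracketCorr₁ θ G)
        (fun ψ α j => M.bracketCorr₁ θ 0 ψ α j + (M.bracket₁'' G).op ψ α j) ∧
      (∀ (s : Fin 4) α β, IsDiffPoly r M.U M.Ω (3 - (s : ℕ)) (M.bracket₁'' G s α β)) ∧
      (IsPolyBracketNoDelta r M.U M.Ω (M.bracketCorr₁ θ G) ↔
        IsPolyBracketNoDelta r M.U M.Ω (M.bracketCorr₁ θ 0))) ∧
    -- the second bracket changes by `{ , }''_2`
    (OpEq M.Ω (M.bracketCorr₂ θ G)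
        (fun ψ α j => M.bracketCorr₂ θ 0 ψ α j + (M.bracket₂'' G).op ψ α j) ∧
      (∀ (s : Fin 4) α β, IsDiffPoly r M.U M.Ω (3 - (s : ℕ)) (M.bracket₂'' G s α β)) ∧
      (IsPolyBracket r M.U M.Ω (M.bracketCorr₂ θ G) ↔
        IsPolyBracket r M.U M.Ω (M.bracketCorr₂ θ 0))) ∧
    -- modulo `ε⁴`, the linear combinations of the two brackets are Poisson brackets
    (∀ a₁ a₂ : 𝕜,
      IsSkew M.Ω (fun ψ α j => a₁ * M.bracket₁ ψ α j + a₂ * M.bracket₂ ψ α j) ∧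
      IsSkew M.Ω (fun ψ α j => a₁ * M.bracketCorr₁ θ G ψ α j + a₂ * M.bracketCorr₂ θ G ψ α j) ∧
      IsJacobiMod M.Ω (fun ψ α j => a₁ * M.bracket₁ ψ α j + a₂ * M.bracket₂ ψ α j)
        (fun ψ α j => a₁ * M.bracketCorr₁ θ G ψ α j + a₂ * M.bracketCorr₂ θ G ψ α j)) ∧
    -- modulo `ε⁴`, the hierarchy is Hamiltonian with respect to the first bracket
    (∀ β p α, ∀ j ∈ M.Ω,
      M.K₀ θ β p α j = M.bracket₁ (euler fun i => θ β (p + 1) (i 0)) α j ∧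
      M.flowCorr θ G β p α j
        = M.bracket₁ (euler (M.hamCorr θ G β (p + 1))) α j
          + M.bracketCorr₁ θ G (euler fun i => θ β (p + 1) (i 0)) α j) ∧
    -- modulo `ε⁴`, the Hamiltonians commute with respect to the first bracket
    (∀ β m γ l,
      IsTotalDeriv M.Ω (fun j => ∑ α, euler (fun i => θ β m (i 0)) α j
        * M.bracket₁ (euler fun i => θ γ l (i 0)) α j) ∧
      IsTotalDeriv M.Ω (fun j => ∑ α,
        (euler (M.hamCorr θ G β m) α j * M.bracket₁ (euler fun i => θ γ l (i 0)) α j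
          + euler (fun i => θ β m (i 0)) α j
            * M.bracketCorr₁ θ G (euler fun i => θ γ l (i 0)) α j
          + euler (fun i => θ β m (i 0)) α j * M.bracket₁ (euler (M.hamCorr θ G γ l)) α j))) ∧
    -- modulo `ε⁴`, the hierarchy is Hamiltonian with respect to the second bracket
    (∀ R, M.IsMonodromy θ R → ∀ (β : Fin n) (p : ℕ), (p : 𝕜) + M.mu β + 1 / 2 ≠ 0 →
      ∀ α, ∀ j ∈ M.Ω,
        M.K₀ θ β p α j
          = M.bracket₂ (euler (hatDensity R (p + M.mu β + 1 / 2) β p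
              fun ε l i => θ ε l (i 0))) α j ∧
        M.flowCorr θ G β p α j
          = M.bracket₂ (euler (hatDensity R (p + M.mu β + 1 / 2) β p (M.hamCorr θ G))) α j
            + M.bracketCorr₂ θ G (euler (hatDensity R (p + M.mu β + 1 / 2) β p
                fun ε l i => θ ε l (i 0))) α j) := by
  exact ⟨fun β p α => ⟨FrobeniusManifold.flowCorr_sub hr hG hθ β p α,
      isDiffPoly_iff_of_sub (FrobeniusManifold.flowCorr_sub hr hG hθ β p α)⟩,
    fun β m => ⟨FrobeniusManifold.hamCorr_sub hr hG hθ β m,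
      FrobeniusManifold.hamCorr_isQuadraticFunctional_iff hr hG hθ β m⟩,
    ⟨FrobeniusManifold.bracketCorr₁_eq hr hG hθ, FrobeniusManifold.isDiffPoly_bracket₁'' hr hG,
      isPolyBracketNoDelta_iff (FrobeniusManifold.bracketCorr₁_eq hr hG hθ) rfl
        (FrobeniusManifold.isDiffPoly_bracket₁'' hr hG)⟩,
    ⟨FrobeniusManifold.bracketCorr₂_eq hr hG hθ, FrobeniusManifold.isDiffPoly_bracket₂'' hr hG,
      isPolyBracket_iff (FrobeniusManifold.bracketCorr₂_eq hr hG hθ)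
        (FrobeniusManifold.isDiffPoly_bracket₂'' hr hG)⟩,
    FrobeniusManifold.pencil_isPoisson hr hG hθ,
    fun β p α _ hj => FrobeniusManifold.flow_hamiltonian₁ hr hG hθ β p α hj,
    FrobeniusManifold.hamiltonians_commute hr hG hθ,
    fun _ hR _ _ hs α _ hj => FrobeniusManifold.flow_hamiltonian₂ hr hG hθ hR hs α hj⟩
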